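/- Let $q\in\mathbb R_{>0}$ and $1\le r<n$; all algebras are unital over $\mathbb C$. **Quantum groups.** $\mathbb C_q[U_n]$ is the algebra generated by $u^i_j$ ($1\le i,j\le n$) and $\det_n^{-1}$ with relations $u^i_ku^j_k=qu^j_ku^i_k$, $u^k_iu^k_j=qu^k_ju^k_i$ for $i<j$; $u^i_lu^j_k=u^j_ku^i_l$, $u^i_ku^j_l=u^j_lu^i_k+(q-q^{-1})u^i_lu^j_k$ for $i<j$, $k<l$; and $\det_n\det_n^{-1}=1=\det_n^{-1}\det_n$, where $\det_n=\sum_{\sigma\in S_n}(-q)^{\ell(\sigma)}u^1_{\sigma(1)}\cdots u^n_{\sigma(n)}$ and $\ell(\sigma)$ is the number of inversions. $\mathbb C_q[SU_n]=\mathbb C_q[U_n]/\langle\det_n-1\rangle$ is a Hopf algebra with $\Delta(u^i_j)=\sum_ku^i_k\otimes u^k_j$, $\varepsilon(u^i_j)=\delta_{ij}$, and antipode $S$, with $S(u^i_j)$ equal to $(-q)^{i-j}$ times the quantum minor obtained by deleting row $j$ and column $i$. For $I=\{i_1<\dots<i_k\}$ and $J=\{j_1<\dots<j_k\}$ let $z^I_J=\sum_{\sigma\in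 S_k}(-q)^{\ell(\sigma)}u^{i_1}_{j_{\sigma(1)}}\cdots u^{i_k}_{j_{\sigma(k)}}$. Put $R=\{1,\dots,r\}$, $R^c=\{r+1,\dots,n\}$, $z^I=z^I_R$ for $|I|=r$, $\bar z^J=z^J_{R^c}$ for $|J|=n-r$, $z=z^R_R$ and $\bar z=z^{R^c}_{R^c}$. **Homogeneous spaces.** Let $\alpha_r:\mathbb C_q[SU_n]\to\mathbb C_q[U_r]$ and $\alpha'_r:\mathbb C_q[SU_n]\to\mathbb C_q[SU_r]$ be the algebra maps with $u^i_j\mapsto u^i_j$ for $i,j\in R$ and $u^i_j\mapsto\delta_{ij}1$ otherwise, except that $\alpha_r(u^n_n)=\det_r^{-1}$; let $\beta_r:\mathbb C_q[SU_n]\to\mathbb C_q[SU_{n-r}]$ be the algebra map with $u^i_j\mapsto u^{i-r}_{j-r}$ for $i,j\in R^c$ and $u^i_j\mapsto\delta_{ij}1$ otherwise. Put $\pi=(\alpha_r\otimes\beta_r)\circ\Delta$, $\sigma=(\alpha'_r\otimes\beta_r)\circ\Delta$, $\Delta_\pi=(\mathrm{id}\otimes\pi)\circ\Delta$, $\Delta_\sigma=(\mathrm{id}\otimes\sigma)\circ\Delta$,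 and $$\mathbb C_q[\mathrm{Gr}_{n,r}]=\{g:\Delta_\pi(g)=g\otimes1\},\quad \mathbb C_q[S^{n,r}]=\{g:\Delta_\sigma(g)=g\otimes1\},\quad \mathcal E_k=\{g:\Delta_\pi(g)=g\otimes\textstyle\det_r^k\otimes1\}\ (k\in\mathbb Z),$$ where $g$ runs over $\mathbb C_q[SU_n]$. Let $\mathbb C[U_1]=\mathbb C[t,t^{-1}]$ with $\Delta(t)=t\otimes t$. **Principal comodule algebras.** Let $H$ be a Hopf algebra with bijective antipode and $(P,\Delta_R)$ a right $H$-comodule algebra with coinvariants $M=\{p:\Delta_R(p)=p\otimes1\}$. It is *principal* if $P\otimes_MP\to P\otimes H$, $p\otimes p'\mapsto(p\otimes 1)\Delta_R(p')$, is bijective and $P$ is faithfully flat as a left and as a right $M$-module. With $\Delta_L(p)=S^{-1}(p_{(1)})\otimes p_{(0)}$, a *principal $\ell$-map* is a linear map $\ell:H\to P\otimes P$ with $\ell(1)=1\otimes1$, $m_P\circ\ell=\varepsilon_H1_P$, $(\ell\otimes\mathrm{id})\circ\Delta_H=(\mathrm{id}\otimes\Delta_R)\circ\ell$ and $(\mathrm{id}\otimes\ell)\circ\Delta_H=(\Delta_L\otimes\mathrm{id})\circ\ell$.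 **Proposition.** There is a unique algebra map $\Delta_R:\mathbb C_q[S^{n,r}]\to\mathbb C_q[S^{n,r}]\otimes\mathbb C[U_1]$ with $\Delta_R(x)=x\otimes t^k$ for all $k\in\mathbb Z$ and all $x\in\mathbb C_q[S^{n,r}]\cap\mathcal E_k$. It is a right $\mathbb C[U_1]$-coaction; all $z^I$ and $\bar z^J$ lie in $\mathbb C_q[S^{n,r}]$, with $\Delta_R(z^I)=z^I\otimes t$ and $\Delta_R(\bar z^J)=\bar z^J\otimes t^{-1}$; and its algebra of coinvariants is $\mathbb C_q[\mathrm{Gr}_{n,r}]$. With respect to it, a principal $\ell$-map $\ell:\mathbb C[U_1]\to\mathbb C_q[S^{n,r}]\otimes\mathbb C_q[S^{n,r}]$ is (well) defined by $$t^k\mapsto S\big((z^k)_{(1)}\big)\otimes (z^k)_{(2)},\qquad t^{-k}\mapsto S\big((\bar z^k)_{(1)}\big)\otimes(\bar z^k)_{(2)},\qquad k\in\mathbb N_0.$$ Hence $\mathbb C_q[\mathrm{Gr}_{n,r}]\hookrightarrow\mathbb C_q[S^{n,r}]$ is a principal $\mathbb C[U_1]$-comodule algebra (the standard circle bundle). 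-/

import Mathlib

open scoped TensorProduct LaurentPolynomial

namespace QGr

/-- The number of inversions of a map between finite ordinals. -/
def inversions {k n : ℕ} (f : Fin k → Fin n) : ℕ :=
  ∑ x, ∑ y, if x < y ∧ f y < f x then 1 else 0

lemma inversions_swap {k n : ℕ} (f : Fin k → Fin n) (i j : Fin k) (hij : (i : ℕ) + 1 = j)
    (h : f j < f i) : inversions (f ∘ Equiv.swap i j) + 1 = inversions f := by
  classical
  have key : ∀ x y : Fin k, (if Equiv.swap i j x < Equiv.swap i j y ∧ f y < f x then 1 else 0)
      + (if x = i then if y = j then 1 else 0 else 0) = if x < y ∧ f y < f x then 1 else 0 := by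
    intro x y
    simp only [Equiv.swap_apply_def]
    grind
  have e : inversions (f ∘ Equiv.swap i j)
      = ∑ x, ∑ y, if Equiv.swap i j x < Equiv.swap i j y ∧ f y < f x then 1 else 0 := by
    unfold inversions
    rw [← Equiv.sum_comp (Equiv.swap i j)]
    refine Finset.sum_congr rfl fun x _ => ?_
    rw [← Equiv.sum_comp (Equiv.swap i j)]
    simp
  rw [e]
  unfold inversions
  simp only [← key, Finset.sum_add_distrib]
  congr 1
  simp

lemma prod_two {B : Type*} [Ring B] {k : ℕ} (g : Fin k → B) (i j : Fin k)
    (hij : (i : ℕ) + 1 = j) : ∃ L R : B, ∀ g' : Fin k → B, (∀ x, x ≠ i → x ≠ j → g' x = g x) →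
      (List.ofFn g').prod = L * (g' i * g' j) * R := by
  refine ⟨((List.ofFn g).take i).prod, ((List.ofFn g).drop (i + 2)).prod, fun g' h => ?_⟩
  have h1 : (List.ofFn g').take i = (List.ofFn g).take i := by
    apply List.ext_getElem
    · simp
    · intro a h1 h2
      simp only [List.getElem_take, List.getElem_ofFn]
      simp at h1
      apply h <;> simp [Fin.ext_iff] <;> omega
  have h2 : (List.ofFn g').drop (i + 2) = (List.ofFn g).drop (i + 2) := by
    apply List.ext_getElem
    · simp
    · intro a h1 h2
      simp only [List.getElem_drop, List.getElem_ofFn]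
      simp at h1
      apply h <;> simp [Fin.ext_iff] <;> omega
  rw [← h1, ← h2]
  conv_lhs => rw [← List.take_append_drop i (List.ofFn g')]
  rw [List.drop_eq_getElem_cons (by simp), List.drop_eq_getElem_cons (by simp; omega)]
  simp [mul_assoc]
  congr 2
  congr 1
  exact congrArg g' (Fin.ext hij)


/-- The defining relations of quantum matrices, for a square array of elements of an algebra. -/
structure IsQMatrix (q : ℂ) {n : ℕ} {B : Type*} [Ring B] [Algebra ℂ B]
    (T : Fin n → Fin n → B) : Prop where
  col : ∀ i j k, i < j → T i k * T j k = q • (T j k * T i k)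
  row : ∀ i j k, i < j → T k i * T k j = q • (T k j * T k i)
  comm : ∀ i j k l, i < j → k < l → T i l * T j k = T j k * T i l
  cross : ∀ i j k l, i < j → k < l →
    T i k * T j l = T j l * T i k + (q - q⁻¹) • (T i l * T j k)

/-- The quantum determinant `∑_σ (-q)^{ℓ(σ)} T^1_{σ(1)} ⋯ T^n_{σ(n)}`. -/
def qdet (q : ℂ) {n : ℕ} {B : Type*} [Ring B] [Algebra ℂ B] (T : Fin n → Fin n → B) : B :=
  ∑ σ : Equiv.Perm (Fin n), (-q) ^ inversions σ • (List.ofFn fun i => T i (σ i)).prod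

section theory

variable {q : ℂ} {n k : ℕ} {B C : Type*} [Ring B] [Algebra ℂ B] [Ring C] [Algebra ℂ C]

lemma IsQMatrix.map {T : Fin n → Fin n → B} (hT : IsQMatrix q T) (f : B →ₐ[ℂ] C) :
    IsQMatrix q fun i j => f (T i j) where
  col i j k h := by rw [← map_mul, hT.col i j k h, map_smul, map_mul]
  row i j k h := by rw [← map_mul, hT.row i j k h, map_smul, map_mul]
  comm i j k l h h' := by rw [← map_mul, hT.comm i j k l h h', map_mul]
  cross i j k l h h' := by
    rw [← map_mul, hT.cross i j k l h h', map_add, map_smul, map_mul, map_mul]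

lemma map_qdet (T : Fin n → Fin n → B) (f : B →ₐ[ℂ] C) :
    f (qdet q T) = qdet q fun i j => f (T i j) := by
  simp only [qdet, map_sum, map_smul, map_list_prod, List.map_ofFn]
  rfl

lemma IsQMatrix.transpose {T : Fin n → Fin n → B} (hT : IsQMatrix q T) :
    IsQMatrix q fun i j => T j i where
  col i j k h := hT.row i j k h
  row i j k h := hT.col i j k h
  comm i j k l h h' := (hT.comm k l i j h' h).symm
  cross i j k l h h' := by rw [hT.cross k l i j h' h, hT.comm k l i j h' h]

lemma IsQMatrix.submatrix {T : Fin n → Fin n → B} (hT : IsQMatrix q T) {f g : Fin k → Fin n}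
    (hf : StrictMono f) (hg : StrictMono g) : IsQMatrix q fun i j => T (f i) (g j) where
  col i j k h := hT.col _ _ _ (hf h)
  row i j k h := hT.row _ _ _ (hg h)
  comm i j k l h h' := hT.comm _ _ _ _ (hf h) (hg h')
  cross i j k l h h' := hT.cross _ _ _ _ (hf h) (hg h')

lemma sum_perm_pair (F : Equiv.Perm (Fin n) → B) (i j : Fin n) (hij : i ≠ j) :
    ∑ σ, F σ = ∑ σ ∈ Finset.univ.filter (fun σ : Equiv.Perm (Fin n) => σ i < σ j),
      (F σ + F (σ * Equiv.swap i j)) := by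
  rw [← Finset.sum_filter_add_sum_filter_not _ (fun σ : Equiv.Perm (Fin n) => σ i < σ j),
    Finset.sum_add_distrib]
  congr 1
  symm
  refine Finset.sum_bij' (fun σ _ => σ * Equiv.swap i j) (fun σ _ => σ * Equiv.swap i j)
    ?_ ?_ ?_ ?_ ?_
  · intro σ; simp; exact le_of_lt
  · intro σ; simp
    intro h
    exact lt_of_le_of_ne h fun h' => hij (σ.injective h').symm
  · intro σ _; simp [mul_assoc]
  · intro σ _; simp [mul_assoc]
  · intro σ _; rfl

lemma inversions_mul_swap (σ : Equiv.Perm (Fin n)) (i j : Fin n) (hij : (i : ℕ) + 1 = j)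
    (h : σ i < σ j) : inversions (σ * Equiv.swap i j) = inversions σ + 1 := by
  rw [← inversions_swap (σ * Equiv.swap i j : Equiv.Perm (Fin n)) i j hij (by simpa using h)]
  congr 2
  ext x; simp

lemma qdet_rows_eq {T : Fin n → Fin n → B} (hT : IsQMatrix q T) (f : Fin n → Fin n)
    (i j : Fin n) (hij : (i : ℕ) + 1 = j) (h : f i = f j) :
    qdet q (fun x => T (f x)) = 0 := by
  have hne : i ≠ j := by intro h; simp [h] at hij
  unfold qdet
  rw [sum_perm_pair _ i j hne]
  refine Finset.sum_eq_zero fun σ hσ => ?_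
  have hσ : σ i < σ j := by simpa using hσ
  obtain ⟨L, R, hLR⟩ := prod_two (fun x => T (f x) (σ x)) i j hij
  rw [hLR _ (fun _ _ _ => rfl), hLR _ (fun x hx hx' => by
    simp [Equiv.swap_apply_of_ne_of_ne hx hx']), inversions_mul_swap σ i j hij hσ]
  simp only [Equiv.Perm.mul_apply, Equiv.swap_apply_left, Equiv.swap_apply_right, h,
    hT.row _ _ _ hσ, pow_succ]
  simp [mul_smul]

lemma qdet_rows_swap (hq : q ≠ 0) {T : Fin n → Fin n → B} (hT : IsQMatrix q T)
    (f : Fin n → Fin n) (i j : Fin n) (hij : (i : ℕ) + 1 = j) (h : f j < f i) :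
    qdet q (fun x => T (f x)) = (-q) • qdet q (fun x => T ((f ∘ Equiv.swap i j) x)) := by
  have hne : i ≠ j := by intro h; simp [h] at hij
  unfold qdet
  rw [sum_perm_pair _ i j hne, sum_perm_pair _ i j hne, Finset.smul_sum]
  refine Finset.sum_congr rfl fun σ hσ => ?_
  have hσ : σ i < σ j := by simpa using hσ
  obtain ⟨L, R, hLR⟩ := prod_two (fun x => T (f x) (σ x)) i j hij
  rw [hLR _ (fun _ _ _ => rfl), hLR _ (fun x hx hx' => by
    simp [Equiv.swap_apply_of_ne_of_ne hx hx']), hLR _ (fun x hx hx' => by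
    simp [Equiv.swap_apply_of_ne_of_ne hx hx']), hLR _ (fun x hx hx' => by
    simp [Equiv.swap_apply_of_ne_of_ne hx hx']), inversions_mul_swap σ i j hij hσ]
  simp only [Equiv.Perm.mul_apply, Equiv.swap_apply_left, Equiv.swap_apply_right,
    Function.comp_apply, pow_succ]
  have h1 := hT.cross _ _ _ _ h hσ
  have h2 := hT.comm _ _ _ _ h hσ
  rw [h1, ← h2]
  simp only [mul_add, add_mul, smul_add, smul_smul, mul_smul_comm, smul_mul_assoc]
  have e : -q * ((-q) ^ inversions σ * (q - q⁻¹)) + -q * ((-q) ^ inversions σ * -q)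
      = (-q) ^ inversions σ := by field_simp; ring
  rw [add_assoc, ← add_smul, e, ]
  module

lemma qdet_rows (hq : q ≠ 0) {T : Fin n → Fin n → B} (hT : IsQMatrix q T)
    (f : Fin n → Fin n) : qdet q (fun x => T (f x)) =
      if Function.Injective f then (-q) ^ inversions f • qdet q T else 0 := by
  induction hN : inversions f using Nat.strong_induction_on generalizing f with
  | _ N ih =>
  subst hN
  by_cases hd : ∃ i j : Fin n, (i : ℕ) + 1 = j ∧ f j < f i
  · obtain ⟨i, j, hij, h⟩ := hd
    have hs := inversions_swap f i j hij h
    rw [qdet_rows_swap hq hT f i j hij h, ih _ (by omega) _ rfl, ← hs]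
    simp only [EquivLike.injective_comp]
    split_ifs
    · rw [smul_smul, pow_succ']
    · simp
  by_cases he : ∃ i j : Fin n, (i : ℕ) + 1 = j ∧ f i = f j
  · obtain ⟨i, j, hij, h⟩ := he
    rw [qdet_rows_eq hT f i j hij h, if_neg]
    intro hf
    have := hf h
    simp [this] at hij
  push Not at hd he
  have hm : StrictMono f := by
    cases n with
    | zero => exact fun x => x.elim0
    | succ n =>
      rw [Fin.strictMono_iff_lt_succ]
      intro i
      exact lt_of_le_of_ne (hd _ _ (by simp)) (he _ _ (by simp))
  have hid : f = id := by
    funext x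
    have h1 := hm.le_apply (x := x)
    have h2 : f x ≤ x := hm.apply_le (x := x)
    exact le_antisymm h2 h1
  subst hid
  rw [if_pos Function.injective_id]
  have : inversions (id : Fin n → Fin n) = 0 := by
    simp only [inversions, id]
    refine Finset.sum_eq_zero fun x _ => Finset.sum_eq_zero fun y _ => if_neg ?_
    omega
  simp [this]


lemma qdet_transpose {p : ℝ} (hp : 0 < p) {T : Fin n → Fin n → B} (hT : IsQMatrix (p : ℂ) T) :
    qdet p (fun i j => T j i) = qdet p T := by
  have hq : (p : ℂ) ≠ 0 := by exact_mod_cast hp.ne'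
  set c : ℂ := ∑ σ : Equiv.Perm (Fin n), (-(p : ℂ)) ^ inversions σ * (-(p : ℂ)) ^ inversions σ
    with hc
  have hc0 : c ≠ 0 := by
    have : c = ((∑ σ : Equiv.Perm (Fin n), p ^ inversions σ * p ^ inversions σ : ℝ) : ℂ) := by
      rw [hc]; push_cast
      refine Finset.sum_congr rfl fun σ _ => ?_
      rw [← mul_pow, ← mul_pow]; simp
    rw [this]
    have : 0 < ∑ σ : Equiv.Perm (Fin n), p ^ inversions σ * p ^ inversions σ :=
      Finset.sum_pos (fun σ _ => by positivity) Finset.univ_nonempty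
    exact_mod_cast this.ne'
  have key : ∀ {S : Fin n → Fin n → B}, IsQMatrix (p : ℂ) S →
      c • qdet p S = ∑ τ : Equiv.Perm (Fin n), ∑ σ : Equiv.Perm (Fin n),
        ((-(p : ℂ)) ^ inversions τ * (-(p : ℂ)) ^ inversions σ) •
          (List.ofFn fun i => S (τ i) (σ i)).prod := by
    intro S hS
    rw [hc, Finset.sum_smul]
    refine Finset.sum_congr rfl fun τ _ => ?_
    have := qdet_rows hq hS τ
    rw [if_pos τ.injective] at this
    rw [mul_smul, ← this, qdet, Finset.smul_sum]
    simp only [smul_smul]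
  have h := key hT
  rw [Finset.sum_comm] at h
  have h' := key hT.transpose
  have : c • qdet p (fun i j => T j i) = c • qdet p T := by
    rw [h, h']
    refine Finset.sum_congr rfl fun τ _ => Finset.sum_congr rfl fun σ _ => ?_
    rw [mul_comm]
  exact smul_right_injective _ hc0 this

/-- The permutation taking `c` to `p` and acting as `τ` on the complements. -/
def extendPerm (c p : Fin (n + 1)) (τ : Equiv.Perm (Fin n)) : Equiv.Perm (Fin (n + 1)) :=
  (finSuccEquiv' c).trans ((Equiv.optionCongr τ).trans (finSuccEquiv' p).symm)

@[simp] lemma extendPerm_self (c p : Fin (n + 1)) (τ : Equiv.Perm (Fin n)) :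
    extendPerm c p τ c = p := by simp [extendPerm]

@[simp] lemma extendPerm_succAbove (c p : Fin (n + 1)) (τ : Equiv.Perm (Fin n)) (i : Fin n) :
    extendPerm c p τ (c.succAbove i) = p.succAbove (τ i) := by simp [extendPerm]

lemma extendPerm_bijective (c : Fin (n + 1)) :
    Function.Bijective fun x : Fin (n + 1) × Equiv.Perm (Fin n) => extendPerm c x.1 x.2 := by
  rw [Fintype.bijective_iff_injective_and_card]
  refine ⟨?_, by simp [Fintype.card_perm, Nat.factorial_succ]⟩
  rintro ⟨p, τ⟩ ⟨p', τ'⟩ h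
  have h1 : p = p' := by simpa using DFunLike.congr_fun h c
  subst h1
  refine Prod.ext rfl (Equiv.ext fun i => ?_)
  simpa using DFunLike.congr_fun h (c.succAbove i)

lemma sum_perm_extend (c : Fin (n + 1)) (F : Equiv.Perm (Fin (n + 1)) → B) :
    ∑ σ, F σ = ∑ p, ∑ τ, F (extendPerm c p τ) := by
  rw [← Fintype.sum_prod_type', ← (extendPerm_bijective c).sum_comp]

lemma sum_castSucc_lt (p : Fin (n + 1)) : ∑ y : Fin n, (if y.castSucc < p then 1 else 0) = (p : ℕ) := by
  have : ∑ y : Fin (n + 1), (if y < p then 1 else 0) = (p : ℕ) := by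
    rw [Finset.sum_boole, Finset.filter_gt_eq_Iio]; simp
  rw [Fin.sum_univ_castSucc] at this
  simpa [Fin.le_last, not_lt.2 (Fin.le_last p)] using this

lemma inversions_extend_zero (p : Fin (n + 1)) (τ : Equiv.Perm (Fin n)) :
    inversions (extendPerm 0 p τ) = p + inversions τ := by
  have hs : ∀ i : Fin n, extendPerm 0 p τ i.succ = p.succAbove (τ i) := fun i => by
    simpa using extendPerm_succAbove 0 p τ i
  have h1 : ∑ y : Fin n, (if p.succAbove (τ y) < p then 1 else 0) = (p : ℕ) := by
    rw [Equiv.sum_comp τ (fun y => if p.succAbove y < p then 1 else 0)]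
    simp only [Fin.succAbove_lt_iff_castSucc_lt]
    exact sum_castSucc_lt p
  simp only [inversions, Fin.sum_univ_succ, hs, extendPerm_self]
  simp [h1, Fin.succ_pos]

lemma inversions_extend_last (p : Fin (n + 1)) (τ : Equiv.Perm (Fin n)) :
    inversions (extendPerm (Fin.last n) p τ) = (n - p) + inversions τ := by
  have hs : ∀ i : Fin n, extendPerm (Fin.last n) p τ i.castSucc = p.succAbove (τ i) := fun i => by
    simpa using extendPerm_succAbove (Fin.last n) p τ i
  have h1 : ∑ y : Fin n, (if p < p.succAbove (τ y) then 1 else 0) = n - (p : ℕ) := by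
    rw [Equiv.sum_comp τ (fun y => if p < p.succAbove y then 1 else 0)]
    simp only [Fin.lt_succAbove_iff_le_castSucc]
    have h2 := sum_castSucc_lt p
    have h3 : ∑ y : Fin n, (if y.castSucc < p then 1 else 0)
        + ∑ y : Fin n, (if p ≤ y.castSucc then 1 else 0) = n := by
      rw [← Finset.sum_add_distrib]
      have : ∀ y : Fin n, ((if y.castSucc < p then 1 else 0) + if p ≤ y.castSucc then 1 else 0) = 1 := by
        intro y; split_ifs <;> first | rfl | (exfalso; omega)
      simp [this]
    omega
  simp only [inversions, Fin.sum_univ_castSucc, hs, extendPerm_self]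
  simp [Finset.sum_add_distrib, h1, Fin.castSucc_lt_last, not_lt.2 (Fin.le_last _)]
  omega

lemma qdet_expand_first (T : Fin (n + 1) → Fin (n + 1) → B) :
    qdet q T = ∑ p : Fin (n + 1), (-q) ^ (p : ℕ) •
      (T 0 p * qdet q fun i j => T i.succ (p.succAbove j)) := by
  have hs : ∀ p τ, ∀ i : Fin n, extendPerm 0 p τ i.succ = p.succAbove (τ i) := fun p τ i => by
    simpa using extendPerm_succAbove 0 p τ i
  rw [qdet, sum_perm_extend 0]
  refine Finset.sum_congr rfl fun p _ => ?_
  rw [qdet, Finset.mul_sum, Finset.smul_sum]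
  refine Finset.sum_congr rfl fun τ _ => ?_
  rw [inversions_extend_zero]
  simp [List.ofFn_succ, hs, pow_add, mul_smul]

lemma qdet_expand_last (T : Fin (n + 1) → Fin (n + 1) → B) :
    qdet q T = ∑ p : Fin (n + 1), (-q) ^ (n - p : ℕ) •
      ((qdet q fun i j => T i.castSucc (p.succAbove j)) * T (Fin.last n) p) := by
  have hs : ∀ p τ, ∀ i : Fin n, extendPerm (Fin.last n) p τ i.castSucc = p.succAbove (τ i) :=
    fun p τ i => by simpa using extendPerm_succAbove (Fin.last n) p τ i
  rw [qdet, sum_perm_extend (Fin.last n)]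
  refine Finset.sum_congr rfl fun p _ => ?_
  rw [qdet, Finset.sum_mul, Finset.smul_sum]
  refine Finset.sum_congr rfl fun τ _ => ?_
  rw [inversions_extend_last]
  simp [List.ofFn_succ', hs, pow_add, mul_smul, -List.ofFn_succ, List.concat_eq_append]

lemma inversions_one : inversions (1 : Equiv.Perm (Fin n)) = 0 := by
  simp only [inversions, Equiv.Perm.one_apply]
  refine Finset.sum_eq_zero fun x _ => Finset.sum_eq_zero fun y _ => if_neg ?_
  omega

/-- The quantum cofactor matrix: up to the factor `(-q)^{i-j}`, its entry `(i, j)` is the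
quantum determinant of the array with row `j` and column `i` deleted. -/
noncomputable def qcof (q : ℂ) : {n : ℕ} → (Fin n → Fin n → B) → Fin n → Fin n → B
  | 0, _ => fun i _ => i.elim0
  | _ + 1, T => fun i j =>
      (-q) ^ ((i : ℤ) - (j : ℤ)) • qdet q fun a b => T (j.succAbove a) (i.succAbove b)

lemma sum_mul_qcof (hq : q ≠ 0) {T : Fin n → Fin n → B} (hT : IsQMatrix q T) (i j : Fin n) :
    ∑ k, T i k * qcof q T k j = if i = j then qdet q T else 0 := by
  cases n with
  | zero => exact i.elim0
  | succ n =>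
  have hq' : -q ≠ 0 := neg_ne_zero.2 hq
  set f : Fin (n + 1) → Fin (n + 1) := Fin.cons i j.succAbove with hf
  have h1 := qdet_rows hq hT f
  rw [qdet_expand_first] at h1
  have h2 : ∑ k, T i k * qcof q T k j = (-q) ^ (-(j : ℤ)) •
      (if Function.Injective f then (-q) ^ inversions f • qdet q T else 0) := by
    rw [← h1, Finset.smul_sum]
    refine Finset.sum_congr rfl fun k _ => ?_
    simp only [qcof, hf, Fin.cons_zero, Fin.cons_succ, mul_smul_comm, smul_smul]
    rw [sub_eq_neg_add, zpow_add₀ hq', zpow_natCast]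
  rw [h2]
  have h3 : Function.Injective f ↔ i = j := by
    rw [hf, Fin.cons_injective_iff]
    simp [Fin.succAbove_right_injective, Fin.range_succAbove]
  by_cases hij : i = j
  · rw [if_pos (h3.2 hij), if_pos hij, smul_smul]
    have : f = extendPerm 0 j 1 := by
      funext x
      refine Fin.cases ?_ (fun x => ?_) x
      · simp [hf, hij]
      · rw [hf, Fin.cons_succ, ← Fin.zero_succAbove, extendPerm_succAbove]; rfl
    rw [this, inversions_extend_zero, inversions_one, add_zero, ← zpow_natCast, ← zpow_add₀ hq']
    simp
  · rw [if_neg (fun h => hij (h3.1 h)), if_neg hij, smul_zero]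

lemma sum_qcof_mul {p : ℝ} (hp : 0 < p) {T : Fin n → Fin n → B} (hT : IsQMatrix (p : ℂ) T)
    (i j : Fin n) : ∑ k, qcof p T i k * T k j = if i = j then qdet p T else 0 := by
  cases n with
  | zero => exact i.elim0
  | succ n =>
  have hq : (p : ℂ) ≠ 0 := by exact_mod_cast hp.ne'
  have hq' : -(p : ℂ) ≠ 0 := neg_ne_zero.2 hq
  set f : Fin (n + 1) → Fin (n + 1) := Fin.snoc i.succAbove j with hf
  have h1 := qdet_rows hq hT.transpose f
  rw [qdet_expand_last] at h1
  have h2 : ∑ k, qcof p T i k * T k j = (-(p : ℂ)) ^ ((i : ℤ) - n) •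
      (if Function.Injective f then (-(p : ℂ)) ^ inversions f • qdet p (fun i j => T j i) else 0) := by
    rw [← h1, Finset.smul_sum]
    refine Finset.sum_congr rfl fun k _ => ?_
    have h4 := qdet_transpose hp (hT.submatrix (Fin.strictMono_succAbove k) (Fin.strictMono_succAbove i))
    simp only [qcof, hf, Fin.snoc_last, Fin.snoc_castSucc, smul_mul_assoc, smul_smul, h4]
    rw [← zpow_natCast, ← zpow_add₀ hq', Nat.cast_sub (by omega)]
    congr 2
    ring
  rw [h2, qdet_transpose hp hT]
  by_cases hij : i = j
  · have : f = extendPerm (Fin.last n) i 1 := by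
      funext x
      refine Fin.lastCases ?_ (fun x => ?_) x
      · simp [hf, hij]
      · rw [hf, Fin.snoc_castSucc, ← Fin.succAbove_last, extendPerm_succAbove]; rfl
    rw [this, if_pos (extendPerm _ _ _).injective, if_pos hij, smul_smul, inversions_extend_last,
      inversions_one, add_zero, ← zpow_natCast, ← zpow_add₀ hq', Nat.cast_sub (by omega)]
    simp
  · rw [if_neg, if_neg hij, smul_zero]
    intro h
    obtain ⟨x, hx⟩ := Fin.exists_succAbove_eq (Ne.symm hij)
    have : f x.castSucc = f (Fin.last n) := by simp [hf, hx]
    exact absurd (h this) (Fin.castSucc_lt_last x).ne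

lemma qdet_comm {p : ℝ} (hp : 0 < p) {T : Fin n → Fin n → B} (hT : IsQMatrix (p : ℂ) T)
    (i j : Fin n) : qdet p T * T i j = T i j * qdet p T := by
  have hq : (p : ℂ) ≠ 0 := by exact_mod_cast hp.ne'
  have h : ∑ a, ∑ b, T i a * qcof p T a b * T b j = ∑ a, T i a * ∑ b, qcof p T a b * T b j := by
    simp only [Finset.mul_sum, mul_assoc]
  rw [Finset.sum_comm] at h
  simp only [← Finset.sum_mul, sum_mul_qcof hq hT, sum_qcof_mul hp hT] at h
  simpa using h

/-- Diagonal coefficients of the braiding `e_i ⊗ e_j ↦ e_j ⊗ e_i + w(i,j) e_i ⊗ e_j`. -/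
noncomputable def braidCoeff (q : ℂ) (i j : Fin n) : ℂ :=
  if i = j then q - 1 else if i < j then q - q⁻¹ else 0

lemma isQMatrix_iff_braid (hq : q ≠ 0) {T : Fin n → Fin n → B} :
    IsQMatrix q T ↔ ∀ i j k l, T j k * T i l + braidCoeff q i j • (T i k * T j l) =
      T i l * T j k + braidCoeff q k l • (T i k * T j l) := by
  constructor
  · intro hT i j k l
    have hqq : (q - q⁻¹) * q = q * q - 1 := by field_simp
    rcases lt_trichotomy i j with hij | rfl | hij <;> rcases lt_trichotomy k l with hkl | rfl | hkl
    · simp [braidCoeff, hij, hij.ne, hkl, hkl.ne, hT.comm i j k l hij hkl]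
    · simp only [braidCoeff, hij, hij.ne, hT.col i j k hij, if_true, if_false, smul_smul]
      rw [hqq]; module
    · have := hT.cross i j l k hij hkl
      simp [braidCoeff, hij, hij.ne, hkl.ne', hkl.not_gt, this]
    · simp only [braidCoeff, hkl, hkl.ne, hT.row k l i hkl, if_true, if_false, smul_smul]
      rw [hqq]; module
    · simp [braidCoeff]
    · simp only [braidCoeff, hkl.ne', hkl.not_gt, hT.row l k i hkl, if_true, if_false, zero_smul,
        add_zero]
      module
    · have := hT.cross j i k l hij hkl
      simp [braidCoeff, hij.ne', hij.not_gt, hkl, hkl.ne, this, hT.comm j i k l hij hkl]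
    · simp only [braidCoeff, hij.ne', hij.not_gt, hT.col j i k hij, if_true, if_false, zero_smul,
        add_zero]
      module
    · simp [braidCoeff, hij.ne', hij.not_gt, hkl.ne', hkl.not_gt, hT.comm j i l k hij hkl]
  · intro h
    have hcomm : ∀ i j k l, i < j → k < l → T i l * T j k = T j k * T i l := by
      intro i j k l hij hkl
      have := h i j k l
      simp only [braidCoeff, hij, hij.ne, hkl, hkl.ne, if_true, if_false] at this
      exact (add_right_cancel this).symm
    refine ⟨?_, ?_, hcomm, ?_⟩
    · intro i j k hij
      have := h j i k k
      simp only [braidCoeff, hij.ne', hij.not_gt, if_true, if_false, zero_smul, add_zero] at this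
      rw [this]; module
    · intro i j k hij
      have := h k k j i
      simp only [braidCoeff, hij.ne', hij.not_gt, if_true, if_false, zero_smul, add_zero] at this
      rw [← this]; module
    · intro i j k l hij hkl
      have := h j i k l
      simp only [braidCoeff, hij.ne', hij.not_gt, hkl, hkl.ne, if_true, if_false, zero_smul,
        add_zero] at this
      rw [this, hcomm i j k l hij hkl]

lemma IsQMatrix.mul (hq : q ≠ 0) {S T : Fin n → Fin n → B} (hS : IsQMatrix q S)
    (hT : IsQMatrix q T) (hST : ∀ i j k l, Commute (S i j) (T k l)) :
    IsQMatrix q fun i j => ∑ a, S i a * T a j := by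
  rw [isQMatrix_iff_braid hq] at hS hT ⊢
  have hprod : ∀ i j k l, (∑ a, S i a * T a k) * (∑ b, S j b * T b l) =
      ∑ a, ∑ b, (S i a * S j b) * (T a k * T b l) := by
    intro i j k l
    rw [Finset.sum_mul_sum]
    refine Finset.sum_congr rfl fun a _ => Finset.sum_congr rfl fun b _ => ?_
    rw [(hST j b a k).mul_mul_mul_comm]
  intro i j k l
  rw [hprod, hprod, hprod]
  simp only [Finset.smul_sum, ← Finset.sum_add_distrib]
  calc _ = ∑ a, ∑ b, (S j a * S i b + braidCoeff q i j • (S i a * S j b)) * (T a k * T b l) := by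
        simp only [add_mul, smul_mul_assoc]
    _ = ∑ a, ∑ b, (S i b * S j a) * (T a k * T b l) +
        ∑ a, ∑ b, braidCoeff q a b • ((S i a * S j b) * (T a k * T b l)) := by
        rw [← Finset.sum_add_distrib]
        refine Finset.sum_congr rfl fun a _ => ?_
        rw [← Finset.sum_add_distrib]
        refine Finset.sum_congr rfl fun b _ => ?_
        rw [hS i j a b, add_mul, smul_mul_assoc]
    _ = ∑ a, ∑ b, (S i a * S j b) * (T b k * T a l + braidCoeff q a b • (T a k * T b l)) := by
        rw [Finset.sum_comm]
        simp only [mul_add, mul_smul_comm, Finset.sum_add_distrib]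
    _ = _ := by
        refine Finset.sum_congr rfl fun a _ => Finset.sum_congr rfl fun b _ => ?_
        rw [hT a b k l, mul_add, mul_smul_comm]

lemma prod_ofFn_sum {m : ℕ} (F : Fin k → Fin m → B) :
    (List.ofFn fun x => ∑ y, F x y).prod = ∑ f : Fin k → Fin m, (List.ofFn fun x => F x (f x)).prod := by
  classical
  have := (MultilinearMap.mkPiAlgebraFin ℂ k B).map_sum F
  simpa [MultilinearMap.mkPiAlgebraFin_apply] using this

lemma prod_ofFn_commute (F G : Fin k → B) (h : ∀ x y, Commute (F x) (G y)) :
    (List.ofFn fun x => F x * G x).prod = (List.ofFn F).prod * (List.ofFn G).prod := by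
  induction k with
  | zero => simp
  | succ k ih =>
    have hc : Commute (List.ofFn fun i : Fin k => F i.succ).prod (G 0) := by
      apply Commute.list_prod_left
      intro a ha
      obtain ⟨i, rfl⟩ := (List.mem_ofFn' _ _).1 ha
      exact h _ _
    simp only [List.ofFn_succ, List.prod_cons]
    rw [ih (fun i => F i.succ) (fun i => G i.succ) (fun x y => h _ _)]
    exact hc.symm.mul_mul_mul_comm _ _

lemma sum_inj_eq_sum_perm (F : (Fin n → Fin n) → B) :
    ∑ f : Fin n → Fin n, (if Function.Injective f then F f else 0) =
      ∑ σ : Equiv.Perm (Fin n), F σ := by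
  classical
  rw [← Finset.sum_filter]
  symm
  refine Finset.sum_bij (fun σ _ => σ) ?_ ?_ ?_ ?_
  · intro σ _; simp [σ.injective]
  · intro σ _ τ _ h; exact DFunLike.coe_injective h
  · intro f hf
    exact ⟨Equiv.ofBijective f (Finite.injective_iff_bijective.1 (by simpa using hf)),
      Finset.mem_univ _, rfl⟩
  · intro σ _; rfl

lemma qdet_mul (hq : q ≠ 0) {S T : Fin n → Fin n → B} (hT : IsQMatrix q T)
    (hST : ∀ i j k l, Commute (S i j) (T k l)) :
    qdet q (fun i j => ∑ a, S i a * T a j) = qdet q S * qdet q T := by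
  have h1 : ∀ f : Fin n → Fin n, (List.ofFn fun x => S x (f x)).prod * qdet q (fun x => T (f x)) =
      if Function.Injective f then
        ((-q) ^ inversions f • (List.ofFn fun x => S x (f x)).prod) * qdet q T else 0 := by
    intro f
    rw [qdet_rows hq hT f]
    split_ifs <;> simp
  calc _ = ∑ f : Fin n → Fin n,
        (List.ofFn fun x => S x (f x)).prod * qdet q (fun x => T (f x)) := by
        simp only [qdet, prod_ofFn_sum, Finset.mul_sum, Finset.smul_sum, mul_smul_comm]
        rw [Finset.sum_comm]
        refine Finset.sum_congr rfl fun f _ => Finset.sum_congr rfl fun σ _ => ?_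
        rw [prod_ofFn_commute _ _ fun x y => hST _ _ _ _]
    _ = _ := by
        simp only [h1]
        rw [sum_inj_eq_sum_perm (fun f =>
          ((-q) ^ inversions f • (List.ofFn fun x => S x (f x)).prod) * qdet q T),
          ← Finset.sum_mul]
        rfl

section inverse

variable {T s : Fin n → Fin n → B}

lemma braid_inverse (hq : q ≠ 0) (hT : IsQMatrix q T)
    (h1 : ∀ i j, ∑ k, T i k * s k j = if i = j then 1 else 0)
    (h2 : ∀ i j, ∑ k, s i k * T k j = if i = j then 1 else 0) :
    IsQMatrix q fun i j => MulOpposite.op (s i j) := by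
  classical
  rw [isQMatrix_iff_braid hq] at hT ⊢
  let R : Matrix (Fin n × Fin n) (Fin n × Fin n) B := Matrix.of fun x y =>
    (if x = y.swap then 1 else 0) + if x = y then algebraMap ℂ B (braidCoeff q x.1 x.2) else 0
  let U : Matrix (Fin n × Fin n) (Fin n × Fin n) B := Matrix.of fun x y => T x.1 y.1 * T x.2 y.2
  let W : Matrix (Fin n × Fin n) (Fin n × Fin n) B := Matrix.of fun x y => s x.2 y.2 * s x.1 y.1
  have hUW : U * W = 1 := by
    ext ⟨i, j⟩ ⟨k, l⟩
    simp only [Matrix.mul_apply, Fintype.sum_prod_type, U, W, Matrix.of_apply, Matrix.one_apply, Prod.mk.injEq]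
    have : ∀ a, ∑ b, T i a * T j b * (s b l * s a k) =
        T i a * (if j = l then 1 else 0) * s a k := by
      intro a
      simp only [← h1, Finset.mul_sum, Finset.sum_mul, mul_assoc]
    simp only [this]
    by_cases hjl : j = l <;> simp [hjl, h1]
  have hWU : W * U = 1 := by
    ext ⟨i, j⟩ ⟨k, l⟩
    simp only [Matrix.mul_apply, Fintype.sum_prod_type, U, W, Matrix.of_apply, Matrix.one_apply, Prod.mk.injEq]
    have : ∀ b, ∑ a, s j b * s i a * (T a k * T b l) =
        s j b * (if i = k then 1 else 0) * T b l := by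
      intro a
      simp only [← h2, Finset.mul_sum, Finset.sum_mul, mul_assoc]
    rw [Finset.sum_comm]
    simp only [this]
    by_cases hik : i = k <;> simp [hik, h2]
  have hswap : ∀ x y : Fin n × Fin n, x = y.swap ↔ y = x.swap := by
    intro x y; constructor <;> rintro rfl <;> simp
  have hl : ∀ (V : Matrix (Fin n × Fin n) (Fin n × Fin n) B) x y,
      (R * V) x y = V x.swap y + braidCoeff q x.1 x.2 • V x y := by
    intro V x y
    simp only [Matrix.mul_apply, R, Matrix.of_apply, add_mul, Finset.sum_add_distrib, hswap x, ite_mul, one_mul,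
      zero_mul, Finset.sum_ite_eq, Finset.sum_ite_eq', Finset.mem_univ, if_true,
      Algebra.smul_def]
  have hr : ∀ (V : Matrix (Fin n × Fin n) (Fin n × Fin n) B) x y,
      (V * R) x y = V x y.swap + braidCoeff q y.1 y.2 • V x y := by
    intro V x y
    simp only [Matrix.mul_apply, R, Matrix.of_apply, mul_add, Finset.sum_add_distrib, mul_ite, mul_one,
      mul_zero, Finset.sum_ite_eq, Finset.sum_ite_eq', Finset.mem_univ, if_true,
      Algebra.smul_def, Algebra.commutes]
  have hRU : R * U = U * R := by
    ext ⟨i, j⟩ ⟨k, l⟩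
    rw [hl, hr]
    exact hT i j k l
  have hWR : W * R = R * W := by
    calc W * R = W * (R * U) * W := by rw [mul_assoc, mul_assoc, hUW, mul_one]
      _ = R * W := by rw [hRU, ← mul_assoc, hWU, one_mul]
  intro i j k l
  have := congrFun (congrFun hWR (i, j)) (k, l)
  rw [hl, hr] at this
  simp only [← MulOpposite.op_mul, ← MulOpposite.op_smul, ← MulOpposite.op_add]
  exact congrArg _ this.symm

lemma qdet_inverse (hq : q ≠ 0) (hT : IsQMatrix q T) (hd : qdet q T = 1)
    (h1 : ∀ i j, ∑ k, T i k * s k j = if i = j then 1 else 0)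
    (h2 : ∀ i j, ∑ k, s i k * T k j = if i = j then 1 else 0) :
    qdet q (fun i j => MulOpposite.op (s i j)) = 1 := by
  classical
  have key : ∀ (m : ℕ) (g h : Fin m → Fin n), ∑ f : Fin m → Fin n,
      (List.ofFn fun x => T (g x) (f x)).prod *
        (List.ofFn fun x => MulOpposite.op (s (f x) (h x))).prod.unop = if g = h then 1 else 0 := by
    intro m
    induction m with
    | zero => intro g h; simp [Subsingleton.elim g h]
    | succ m ih =>
      intro g h
      rw [← (Fin.consEquiv fun _ => Fin n).sum_comp, Fintype.sum_prod_type]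
      simp only [Fin.consEquiv_apply, List.ofFn_succ, Fin.cons_zero, Fin.cons_succ,
        List.prod_cons, MulOpposite.unop_mul, MulOpposite.unop_op]
      have : ∀ a, ∑ f : Fin m → Fin n,
          T (g 0) a * (List.ofFn fun x : Fin m => T (g x.succ) (f x)).prod *
          ((List.ofFn fun x : Fin m => MulOpposite.op (s (f x) (h x.succ))).prod.unop * s a (h 0)) =
          T (g 0) a * (if (fun x : Fin m => g x.succ) = fun x => h x.succ then 1 else 0)
            * s a (h 0) := by
        intro a
        rw [← ih]
        simp only [Finset.mul_sum, Finset.sum_mul, mul_assoc]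
      simp only [this]
      have hgh : g = h ↔ g 0 = h 0 ∧ (fun x : Fin m => g x.succ) = fun x => h x.succ := by
        constructor
        · rintro rfl; simp
        · rintro ⟨h0, hs⟩
          funext x
          exact Fin.cases h0 (fun x => congrFun hs x) x
      simp only [hgh]
      by_cases hs : (fun x : Fin m => g x.succ) = fun x => h x.succ <;> simp [hs, h1]
  have hs := braid_inverse hq hT h1 h2
  have h3 : ∀ f : Fin n → Fin n, (List.ofFn fun x => T x (f x)).prod *
      (qdet q fun x j => MulOpposite.op (s (f x) j)).unop =
      if Function.Injective f then ((-q) ^ inversions f • (List.ofFn fun x => T x (f x)).prod) *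
        (qdet q fun i j => MulOpposite.op (s i j)).unop else 0 := by
    intro f
    have := qdet_rows hq hs f
    rw [this]
    split_ifs <;> simp
  have h4 : ∑ f : Fin n → Fin n, (List.ofFn fun x => T x (f x)).prod *
      (qdet q fun x j => MulOpposite.op (s (f x) j)).unop = 1 := by
    simp only [qdet, Finset.unop_sum, MulOpposite.unop_smul, Finset.mul_sum, mul_smul_comm]
    rw [Finset.sum_comm]
    simp only [← Finset.smul_sum, key n (fun x => x)]
    rw [Finset.sum_eq_single 1]
    · rw [if_pos (by rfl), inversions_one]; simp
    · intro σ _ hσ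
      rw [if_neg, smul_zero]
      intro h
      exact hσ (Equiv.ext fun x => (congrFun h x).symm)
    · simp
  simp only [h3] at h4
  rw [sum_inj_eq_sum_perm (fun f => ((-q) ^ inversions f • (List.ofFn fun x => T x (f x)).prod) *
    (qdet q fun i j => MulOpposite.op (s i j)).unop), ← Finset.sum_mul] at h4
  change qdet q T * _ = 1 at h4
  rw [hd, one_mul] at h4
  exact MulOpposite.unop_injective h4

end inverse

/-- The block diagonal array with blocks `T` and `T'`. -/
def qblock {r m : ℕ} (T : Fin r → Fin r → B) (T' : Fin m → Fin m → B) :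
    Fin (r + m) → Fin (r + m) → B := fun i j =>
  Fin.addCases (motive := fun _ => B)
    (fun i' => Fin.addCases (motive := fun _ => B) (fun j' => T i' j') (fun _ => 0) j)
    (fun i' => Fin.addCases (motive := fun _ => B) (fun _ => 0) (fun j' => T' i' j') j) i

section block

variable {r m : ℕ} {T : Fin r → Fin r → B} {T' : Fin m → Fin m → B}

@[simp] lemma qblock_ll (i j) : qblock T T' (Fin.castAdd m i) (Fin.castAdd m j) = T i j := by
  simp [qblock]

@[simp] lemma qblock_lr (i j) : qblock T T' (Fin.castAdd m i) (Fin.natAdd r j) = 0 := by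
  simp [qblock]

@[simp] lemma qblock_rl (i j) : qblock T T' (Fin.natAdd r i) (Fin.castAdd m j) = 0 := by
  simp [qblock]

@[simp] lemma qblock_rr (i j) : qblock T T' (Fin.natAdd r i) (Fin.natAdd r j) = T' i j := by
  simp [qblock]

lemma IsQMatrix.block (hT : IsQMatrix q T) (hT' : IsQMatrix q T')
    (h : ∀ i j k l, Commute (T i j) (T' k l)) : IsQMatrix q (qblock T T') := by
  have hlt : ∀ (i : Fin m) (j : Fin r), ¬ Fin.natAdd r i < Fin.castAdd m j := fun i j => by
    simp [Fin.lt_def]; omega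
  have hll : ∀ i j : Fin r, Fin.castAdd m i < Fin.castAdd m j ↔ i < j := fun _ _ => Iff.rfl
  refine ⟨?_, ?_, ?_, ?_⟩
  · intro i j k
    induction i using Fin.addCases <;> induction j using Fin.addCases <;>
      induction k using Fin.addCases <;> simp +contextual [hlt, hll, hT.col _ _ _, hT'.col _ _ _]
  · intro i j k
    induction i using Fin.addCases <;> induction j using Fin.addCases <;>
      induction k using Fin.addCases <;> simp +contextual [hlt, hll, hT.row _ _ _, hT'.row _ _ _]
  · intro i j k l
    induction i using Fin.addCases <;> induction j using Fin.addCases <;>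
      induction k using Fin.addCases <;> induction l using Fin.addCases <;>
      simp +contextual [hlt, hll, (h _ _ _ _).eq]
    · exact hT.comm _ _ _ _
    · exact hT'.comm _ _ _ _
  · intro i j k l
    induction i using Fin.addCases <;> induction j using Fin.addCases <;>
      induction k using Fin.addCases <;> induction l using Fin.addCases <;>
      simp +contextual [hlt, hll, hT.cross _ _ _ _, hT'.cross _ _ _ _, (h _ _ _ _).eq]

/-- The block permutation with blocks `σ` and `τ`. -/
def blockPerm (σ : Equiv.Perm (Fin r)) (τ : Equiv.Perm (Fin m)) : Equiv.Perm (Fin (r + m)) :=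
  finSumFinEquiv.permCongr (Equiv.sumCongr σ τ)

@[simp] lemma blockPerm_left (σ : Equiv.Perm (Fin r)) (τ : Equiv.Perm (Fin m)) (i : Fin r) :
    blockPerm σ τ (Fin.castAdd m i) = Fin.castAdd m (σ i) := by
  simp [blockPerm, Equiv.permCongr_apply]

@[simp] lemma blockPerm_right (σ : Equiv.Perm (Fin r)) (τ : Equiv.Perm (Fin m)) (i : Fin m) :
    blockPerm σ τ (Fin.natAdd r i) = Fin.natAdd r (τ i) := by
  simp [blockPerm, Equiv.permCongr_apply]

lemma inversions_blockPerm (σ : Equiv.Perm (Fin r)) (τ : Equiv.Perm (Fin m)) :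
    inversions (blockPerm σ τ) = inversions σ + inversions τ := by
  have h1 : ∀ (i : Fin m) (j : Fin r), ¬ Fin.natAdd r i < Fin.castAdd m j := fun i j => by
    simp [Fin.lt_def]; omega
  have h2 : ∀ i j : Fin r, Fin.castAdd m i < Fin.castAdd m j ↔ i < j := fun _ _ => Iff.rfl
  simp only [inversions, Fin.sum_univ_add, h1, h2, blockPerm_left, blockPerm_right,
    Fin.natAdd_lt_natAdd_iff, false_and, and_false, if_false, Finset.sum_const_zero, add_zero,
    zero_add]

lemma qdet_block : qdet q (qblock T T') = qdet q T * qdet q T' := by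
  symm
  simp only [qdet, Finset.sum_mul_sum]
  rw [← Fintype.sum_prod_type']
  refine Fintype.sum_of_injective
    (fun x : Equiv.Perm (Fin r) × Equiv.Perm (Fin m) => blockPerm x.1 x.2) ?_ _ _ ?_ ?_
  · rintro ⟨σ, τ⟩ ⟨σ', τ'⟩ h
    refine Prod.ext (Equiv.ext fun i => ?_) (Equiv.ext fun i => ?_)
    · simpa using DFunLike.congr_fun h (Fin.castAdd m i)
    · simpa using DFunLike.congr_fun h (Fin.natAdd r i)
  · intro ρ hρ
    by_cases hmap : ∃ i j, ρ (Fin.castAdd m i) = Fin.natAdd r j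
    · obtain ⟨i, j, hij⟩ := hmap
      rw [List.prod_eq_zero, smul_zero]
      rw [List.mem_ofFn]
      exact ⟨Fin.castAdd m i, by rw [hij]; simp⟩
    · exfalso
      apply hρ
      push Not at hmap
      have : finSumFinEquiv.symm.permCongr ρ ∈ (Equiv.Perm.sumCongrHom (Fin r) (Fin m)).range := by
        apply Equiv.Perm.mem_sumCongrHom_range_of_perm_mapsTo_inl
        rintro _ ⟨i, rfl⟩
        rcases h : finSumFinEquiv.symm (ρ (Fin.castAdd m i)) with j | j
        · exact ⟨j, by simp [Equiv.permCongr_apply, h]⟩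
        · exfalso
          rw [Equiv.symm_apply_eq] at h
          exact hmap i j (by simpa using h)
      obtain ⟨⟨σ, τ⟩, h⟩ := this
      refine ⟨(σ, τ), ?_⟩
      have h' : Equiv.sumCongr σ τ = finSumFinEquiv.symm.permCongr ρ := h
      ext x
      simp [blockPerm, h', Equiv.permCongr_apply]
  · rintro ⟨σ, τ⟩
    have h1 : (List.ofFn fun i => qblock T T' i (blockPerm σ τ i)) =
        (List.ofFn fun i => T i (σ i)) ++ List.ofFn fun i => T' i (τ i) := by
      rw [List.ofFn_add]
      congr 1
      · congr 1; funext i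
        exact (congrArg _ (blockPerm_left σ τ i)).trans (qblock_ll _ _)
      · congr 1; funext i
        exact (congrArg _ (blockPerm_right σ τ i)).trans (qblock_rr _ _)
    simp only [h1, inversions_blockPerm, List.prod_append, smul_mul_smul_comm, pow_add]

end block

lemma isQMatrix_diag (d : Fin n → B) (hd : ∀ i j, Commute (d i) (d j)) :
    IsQMatrix q fun i j => if i = j then d i else 0 := by
  refine ⟨?_, ?_, ?_, ?_⟩
  · intro i j k h
    by_cases h1 : i = k <;> by_cases h2 : j = k <;> simp [h1, h2]
    omega
  · intro i j k h
    by_cases h1 : k = i <;> by_cases h2 : k = j <;> simp [h1, h2, h.ne, h.ne']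
  · intro i j k l h h'
    have h1 : ¬ (i = l ∧ j = k) := by omega
    by_cases h2 : i = l <;> by_cases h3 : j = k <;> simp_all
  · intro i j k l h h'
    have h1 : ¬ (i = l ∧ j = k) := by omega
    by_cases h2 : i = l <;> by_cases h3 : j = k <;> by_cases h4 : i = k <;>
      by_cases h5 : j = l <;> simp_all [(hd _ _).eq]

lemma qdet_diag (d : Fin n → B) :
    qdet q (fun i j => if i = j then d i else 0) = (List.ofFn d).prod := by
  rw [qdet, Finset.sum_eq_single 1]
  · rw [inversions_one]; simp
  · intro σ _ hσ
    have : ∃ i, ¬ i = σ i := by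
      by_contra h
      push Not at h
      exact hσ (Equiv.ext fun i => (h i).symm)
    obtain ⟨i, hi⟩ := this
    rw [List.prod_eq_zero, smul_zero]
    rw [List.mem_ofFn]
    exact ⟨i, by simp [hi]⟩
  · simp

end theory

/-! ### The quantum groups -/

/-- Generators of the coordinate algebra of the quantum general linear group. -/
inductive GLGen (n : ℕ) : Type
  | entry (i j : Fin n) : GLGen n
  | detInv : GLGen n

/-- The defining relations of the coordinate algebra of the quantum general linear group. -/
inductive GLRel (q : ℝ) (n : ℕ) : FreeAlgebra ℂ (GLGen n) → FreeAlgebra ℂ (GLGen n) → Prop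
  | col (i j k : Fin n) (h : i < j) : GLRel q n
      (FreeAlgebra.ι ℂ (.entry i k) * FreeAlgebra.ι ℂ (.entry j k))
      ((q : ℂ) • (FreeAlgebra.ι ℂ (.entry j k) * FreeAlgebra.ι ℂ (.entry i k)))
  | row (i j k : Fin n) (h : i < j) : GLRel q n
      (FreeAlgebra.ι ℂ (.entry k i) * FreeAlgebra.ι ℂ (.entry k j))
      ((q : ℂ) • (FreeAlgebra.ι ℂ (.entry k j) * FreeAlgebra.ι ℂ (.entry k i)))
  | comm (i j k l : Fin n) (h : i < j) (h' : k < l) : GLRel q n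
      (FreeAlgebra.ι ℂ (.entry i l) * FreeAlgebra.ι ℂ (.entry j k))
      (FreeAlgebra.ι ℂ (.entry j k) * FreeAlgebra.ι ℂ (.entry i l))
  | cross (i j k l : Fin n) (h : i < j) (h' : k < l) : GLRel q n
      (FreeAlgebra.ι ℂ (.entry i k) * FreeAlgebra.ι ℂ (.entry j l))
      (FreeAlgebra.ι ℂ (.entry j l) * FreeAlgebra.ι ℂ (.entry i k) +
        ((q : ℂ) - (q : ℂ)⁻¹) • (FreeAlgebra.ι ℂ (.entry i l) * FreeAlgebra.ι ℂ (.entry j k)))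
  | det_mul_inv : GLRel q n
      (qdet (q : ℂ) (fun i j => FreeAlgebra.ι ℂ (GLGen.entry i j)) * FreeAlgebra.ι ℂ .detInv) 1
  | inv_mul_det : GLRel q n
      (FreeAlgebra.ι ℂ .detInv * qdet (q : ℂ) (fun i j => FreeAlgebra.ι ℂ (GLGen.entry i j))) 1

/-- The coordinate algebra `ℂ_q[GL_n]`, which is also the algebra underlying `ℂ_q[U_n]`. -/
def QU (q : ℝ) (n : ℕ) : Type := RingQuot (GLRel q n)

noncomputable instance (q : ℝ) (n : ℕ) : Ring (QU q n) := inferInstanceAs (Ring (RingQuot _))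

noncomputable instance (q : ℝ) (n : ℕ) : Algebra ℂ (QU q n) :=
  inferInstanceAs (Algebra ℂ (RingQuot _))

namespace QU

variable {q : ℝ} {n : ℕ} {B : Type*} [Ring B] [Algebra ℂ B]

/-- The generator `u^i_j`. -/
noncomputable def u (q : ℝ) {n : ℕ} (i j : Fin n) : QU q n :=
  RingQuot.mkAlgHom ℂ (GLRel q n) (FreeAlgebra.ι ℂ (.entry i j))

/-- The generator `det_n⁻¹`. -/
noncomputable def detInv (q : ℝ) (n : ℕ) : QU q n :=
  RingQuot.mkAlgHom ℂ (GLRel q n) (FreeAlgebra.ι ℂ .detInv)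

lemma isQMatrix_u : IsQMatrix (q : ℂ) (u q (n := n)) where
  col i j k h := by
    have := RingQuot.mkAlgHom_rel ℂ (GLRel.col (q := q) i j k h)
    simp only [map_mul, map_smul] at this
    exact this
  row i j k h := by
    have := RingQuot.mkAlgHom_rel ℂ (GLRel.row (q := q) i j k h)
    simp only [map_mul, map_smul] at this
    exact this
  comm i j k l h h' := by
    have := RingQuot.mkAlgHom_rel ℂ (GLRel.comm (q := q) i j k l h h')
    simp only [map_mul, map_smul] at this
    exact this
  cross i j k l h h' := by
    have := RingQuot.mkAlgHom_rel ℂ (GLRel.cross (q := q) i j k l h h')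
    simp only [map_mul, map_smul, map_add] at this
    exact this

lemma qdet_mul_detInv : qdet (q : ℂ) (u q (n := n)) * detInv q n = 1 := by
  have := RingQuot.mkAlgHom_rel ℂ (GLRel.det_mul_inv (q := q) (n := n))
  rw [map_mul, map_qdet, map_one] at this
  exact this

lemma detInv_mul_qdet : detInv q n * qdet (q : ℂ) (u q (n := n)) = 1 := by
  have := RingQuot.mkAlgHom_rel ℂ (GLRel.inv_mul_det (q := q) (n := n))
  rw [map_mul, map_qdet, map_one] at this
  exact this

/-- The quantum determinant as a unit of `ℂ_q[U_n]`. -/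
noncomputable def detUnit (q : ℝ) (n : ℕ) : (QU q n)ˣ where
  val := qdet (q : ℂ) (u q (n := n))
  inv := detInv q n
  val_inv := qdet_mul_detInv
  inv_val := detInv_mul_qdet

/-- The universal property of `ℂ_q[U_n]`. -/
noncomputable def lift (T : Fin n → Fin n → B) (d : B) (hT : IsQMatrix (q : ℂ) T)
    (h1 : qdet (q : ℂ) T * d = 1) (h2 : d * qdet (q : ℂ) T = 1) : QU q n →ₐ[ℂ] B :=
  RingQuot.liftAlgHom ℂ ⟨FreeAlgebra.lift ℂ fun
    | .entry i j => T i j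
    | .detInv => d, by
    intro x y h
    cases h with
    | col i j k h => simpa only [map_mul, map_smul, FreeAlgebra.lift_ι_apply] using hT.col i j k h
    | row i j k h => simpa only [map_mul, map_smul, FreeAlgebra.lift_ι_apply] using hT.row i j k h
    | comm i j k l h h' => simpa only [map_mul, FreeAlgebra.lift_ι_apply] using hT.comm i j k l h h'
    | cross i j k l h h' =>
      simpa only [map_mul, map_add, map_smul, FreeAlgebra.lift_ι_apply] using hT.cross i j k l h h'
    | det_mul_inv => rw [map_mul, map_qdet]; simpa using h1
    | inv_mul_det => rw [map_mul, map_qdet]; simpa using h2⟩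

@[simp] lemma lift_u (T : Fin n → Fin n → B) (d : B) (hT : IsQMatrix (q : ℂ) T)
    (h1 : qdet (q : ℂ) T * d = 1) (h2 : d * qdet (q : ℂ) T = 1) (i j : Fin n) :
    lift T d hT h1 h2 (u q i j) = T i j := by
  unfold lift u
  erw [RingQuot.liftAlgHom_mkAlgHom_apply]
  simp

@[simp] lemma lift_detInv (T : Fin n → Fin n → B) (d : B) (hT : IsQMatrix (q : ℂ) T)
    (h1 : qdet (q : ℂ) T * d = 1) (h2 : d * qdet (q : ℂ) T = 1) :
    lift T d hT h1 h2 (detInv q n) = d := by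
  unfold lift detInv
  erw [RingQuot.liftAlgHom_mkAlgHom_apply]
  simp

lemma algHom_ext {f g : QU q n →ₐ[ℂ] B} (h : ∀ i j, f (u q i j) = g (u q i j)) : f = g := by
  have hd : f (detInv q n) = g (detInv q n) := by
    have h1 : f (qdet (q : ℂ) (u q (n := n))) = g (qdet (q : ℂ) (u q (n := n))) := by
      rw [map_qdet, map_qdet]; simp only [h]
    refine left_inv_eq_right_inv (a := f (qdet (q : ℂ) (u q (n := n)))) ?_ ?_
    · rw [← map_mul, detInv_mul_qdet, map_one]
    · rw [h1, ← map_mul, qdet_mul_detInv, map_one]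
  refine RingQuot.ringQuot_ext' ℂ _ _ (FreeAlgebra.hom_ext (funext fun x => ?_))
  cases x with
  | entry i j => exact h i j
  | detInv => exact hd

lemma detInv_comm (hq : 0 < q) (i j : Fin n) : Commute (u q i j) (detInv q n) :=
  (show Commute (u q i j) (detUnit q n : QU q n) from
    (qdet_comm hq isQMatrix_u i j).symm).units_inv_right

end QU

/-- The coordinate algebra `ℂ_q[SU_n] = ℂ_q[U_n] / ⟨det_n - 1⟩`. -/
def QSU (q : ℝ) (n : ℕ) : Type :=
  RingQuot fun a b : QU q n => a = qdet (q : ℂ) (QU.u q) ∧ b = 1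

noncomputable instance (q : ℝ) (n : ℕ) : Ring (QSU q n) := inferInstanceAs (Ring (RingQuot _))

noncomputable instance (q : ℝ) (n : ℕ) : Algebra ℂ (QSU q n) :=
  inferInstanceAs (Algebra ℂ (RingQuot _))

namespace QSU

variable {q : ℝ} {n : ℕ} {B : Type*} [Ring B] [Algebra ℂ B]

/-- The canonical projection from `ℂ_q[U_n]` to `ℂ_q[SU_n]`. -/
noncomputable def proj (q : ℝ) (n : ℕ) : QU q n →ₐ[ℂ] QSU q n := RingQuot.mkAlgHom ℂ _

/-- The generator `u^i_j`. -/
noncomputable def u (q : ℝ) {n : ℕ} (i j : Fin n) : QSU q n := proj q n (QU.u q i j)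

lemma isQMatrix_u : IsQMatrix (q : ℂ) (u q (n := n)) := QU.isQMatrix_u.map (proj q n)

@[simp] lemma qdet_u : qdet (q : ℂ) (u q (n := n)) = 1 := by
  have : proj q n (qdet (q : ℂ) (QU.u q)) = proj q n 1 := RingQuot.mkAlgHom_rel ℂ ⟨rfl, rfl⟩
  rw [map_qdet, map_one] at this
  exact this

/-- The universal property of `ℂ_q[SU_n]`. -/
noncomputable def lift (T : Fin n → Fin n → B) (hT : IsQMatrix (q : ℂ) T)
    (h : qdet (q : ℂ) T = 1) : QSU q n →ₐ[ℂ] B :=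
  RingQuot.liftAlgHom ℂ ⟨QU.lift T 1 hT (by simpa using h) (by simpa using h), by
    rintro x y ⟨rfl, rfl⟩
    rw [map_qdet]; simpa using h⟩

@[simp] lemma lift_u (T : Fin n → Fin n → B) (hT : IsQMatrix (q : ℂ) T)
    (h : qdet (q : ℂ) T = 1) (i j : Fin n) : lift T hT h (u q i j) = T i j := by
  unfold lift u proj
  erw [RingQuot.liftAlgHom_mkAlgHom_apply]
  simp

lemma algHom_ext {f g : QSU q n →ₐ[ℂ] B} (h : ∀ i j, f (u q i j) = g (u q i j)) : f = g :=
  RingQuot.ringQuot_ext' ℂ _ _ (QU.algHom_ext h)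

lemma induction {P : QSU q n → Prop} (hc : ∀ c : ℂ, P (algebraMap ℂ _ c))
    (hu : ∀ i j, P (u q i j)) (hadd : ∀ x y, P x → P y → P (x + y))
    (hmul : ∀ x y, P x → P y → P (x * y)) (x : QSU q n) : P x := by
  let S : Subalgebra ℂ (QSU q n) :=
    { carrier := {x | P x}
      mul_mem' := fun {a b} ha hb => hmul a b ha hb
      add_mem' := fun {a b} ha hb => hadd a b ha hb
      algebraMap_mem' := hc }
  let T : Fin n → Fin n → S := fun i j => ⟨u q i j, hu i j⟩
  have hinj : Function.Injective S.val := Subtype.val_injective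
  have hT : IsQMatrix (q : ℂ) T := by
    have h := isQMatrix_u (q := q) (n := n)
    exact ⟨fun i j k h1 => hinj (h.col i j k h1), fun i j k h1 => hinj (h.row i j k h1),
      fun i j k l h1 h2 => hinj (h.comm i j k l h1 h2),
      fun i j k l h1 h2 => hinj (h.cross i j k l h1 h2)⟩
  have hd : qdet (q : ℂ) T = 1 := hinj (by rw [map_qdet, map_one]; exact qdet_u)
  have : S.val.comp (lift T hT hd) = AlgHom.id ℂ _ := algHom_ext fun i j => by simp [T]
  have hx := AlgHom.congr_fun this x
  simp only [AlgHom.comp_apply, AlgHom.id_apply] at hx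
  rw [← hx]
  exact (lift T hT hd x).2

end QSU

namespace QSU

variable {q : ℝ} {n : ℕ}

lemma coproduct_array (i j : Fin n) : ∑ k, u q i k ⊗ₜ[ℂ] u q k j = ∑ k,
    (Algebra.TensorProduct.includeLeft : _ →ₐ[ℂ] QSU q n ⊗[ℂ] QSU q n) (u q i k) *
      (Algebra.TensorProduct.includeRight : _ →ₐ[ℂ] QSU q n ⊗[ℂ] QSU q n) (u q k j) := by
  simp

lemma coproduct_commute (i j k l : Fin n) : Commute
    ((Algebra.TensorProduct.includeLeft : _ →ₐ[ℂ] QSU q n ⊗[ℂ] QSU q n) (u q i j))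
    ((Algebra.TensorProduct.includeRight : _ →ₐ[ℂ] QSU q n ⊗[ℂ] QSU q n) (u q k l)) := by
  simp [Commute, SemiconjBy]

lemma isQMatrix_coproduct (hq : 0 < q) :
    IsQMatrix (q : ℂ) fun i j : Fin n => ∑ k, u q i k ⊗ₜ[ℂ] u q k j := by
  have hq' : (q : ℂ) ≠ 0 := by exact_mod_cast hq.ne'
  simp only [coproduct_array]
  exact (isQMatrix_u.map _).mul hq' (isQMatrix_u.map _) coproduct_commute

lemma qdet_coproduct (hq : 0 < q) :
    qdet (q : ℂ) (fun i j : Fin n => ∑ k, u q i k ⊗ₜ[ℂ] u q k j) = 1 := by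
  have hq' : (q : ℂ) ≠ 0 := by exact_mod_cast hq.ne'
  simp only [coproduct_array]
  rw [qdet_mul hq' (isQMatrix_u.map _) coproduct_commute, ← map_qdet, ← map_qdet, qdet_u,
    map_one, map_one, one_mul]

/-- The counit `ε(u^i_j) = δ_{ij}`. -/
noncomputable def counitHom (q : ℝ) (n : ℕ) : QSU q n →ₐ[ℂ] ℂ :=
  lift (fun i j => if i = j then 1 else 0) (isQMatrix_diag (fun _ => 1) fun _ _ => .one_left 1)
    (by rw [qdet_diag (fun _ : Fin n => (1 : ℂ))]; simp)

@[simp] lemma counitHom_u (i j : Fin n) :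
    counitHom q n (u q i j) = if i = j then 1 else 0 := lift_u _ _ _ _ _

variable [hq : Fact (0 < q)]

lemma q_ne_zero : (q : ℂ) ≠ 0 := by exact_mod_cast hq.out.ne'

/-- The coproduct `Δ(u^i_j) = ∑_k u^i_k ⊗ u^k_j`. -/
noncomputable def comulHom (q : ℝ) [hq : Fact (0 < q)] (n : ℕ) :
    QSU q n →ₐ[ℂ] QSU q n ⊗[ℂ] QSU q n :=
  lift (fun i j => ∑ k, u q i k ⊗ₜ u q k j) (isQMatrix_coproduct hq.out) (qdet_coproduct hq.out)

@[simp] lemma comulHom_u (i j : Fin n) :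
    comulHom q n (u q i j) = ∑ k, u q i k ⊗ₜ u q k j := lift_u _ _ _ _ _

noncomputable instance : Bialgebra ℂ (QSU q n) :=
  Bialgebra.ofAlgHom (comulHom q n) (counitHom q n)
    (algHom_ext fun i j => by
      simp [TensorProduct.sum_tmul, TensorProduct.tmul_sum]
      exact Finset.sum_comm)
    (algHom_ext fun i j => by simp [TensorProduct.ite_tmul])
    (algHom_ext fun i j => by simp [TensorProduct.tmul_ite])

lemma comul_u (i j : Fin n) :
    Coalgebra.comul (R := ℂ) (u q i j) = ∑ k, u q i k ⊗ₜ u q k j := comulHom_u i j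

lemma counit_u (i j : Fin n) :
    Coalgebra.counit (R := ℂ) (u q i j) = if i = j then 1 else 0 := counitHom_u i j

lemma u_mul_qcof (i j : Fin n) :
    ∑ k, u q i k * qcof (q : ℂ) (u q) k j = if i = j then 1 else 0 := by
  rw [sum_mul_qcof q_ne_zero isQMatrix_u, qdet_u]

lemma qcof_mul_u (i j : Fin n) :
    ∑ k, qcof (q : ℂ) (u q) i k * u q k j = if i = j then 1 else 0 := by
  rw [sum_qcof_mul hq.out isQMatrix_u, qdet_u]

/-- The antipode, as an algebra homomorphism to the opposite algebra; `S(u^i_j)` is the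
quantum cofactor. -/
noncomputable def antipodeHom (q : ℝ) [Fact (0 < q)] (n : ℕ) : QSU q n →ₐ[ℂ] (QSU q n)ᵐᵒᵖ :=
  lift (fun i j => MulOpposite.op (qcof (q : ℂ) (u q) i j))
    (braid_inverse q_ne_zero isQMatrix_u u_mul_qcof qcof_mul_u)
    (qdet_inverse q_ne_zero isQMatrix_u qdet_u u_mul_qcof qcof_mul_u)

noncomputable instance : HopfAlgebraStruct ℂ (QSU q n) where
  antipode := (MulOpposite.opLinearEquiv ℂ).symm.toLinearMap ∘ₗ (antipodeHom q n).toLinearMap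

lemma antipode_apply (x : QSU q n) :
    HopfAlgebraStruct.antipode ℂ x = (antipodeHom q n x).unop := rfl

lemma antipode_u (i j : Fin n) :
    HopfAlgebraStruct.antipode ℂ (u q i j) = qcof (q : ℂ) (u q) i j := by
  rw [antipode_apply, antipodeHom, lift_u, MulOpposite.unop_op]

lemma antipode_mul (x y : QSU q n) : HopfAlgebraStruct.antipode ℂ (x * y) =
    HopfAlgebraStruct.antipode ℂ y * HopfAlgebraStruct.antipode ℂ x := by
  simp [antipode_apply]

lemma antipode_left (x : QSU q n) :
    LinearMap.mul' ℂ _ ((HopfAlgebraStruct.antipode ℂ).rTensor _ (Coalgebra.comul (R := ℂ) x)) =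
      algebraMap ℂ (QSU q n) (Coalgebra.counit x) := by
  induction x using induction with
  | hc c =>
    rw [Bialgebra.comul_algebraMap, Bialgebra.counit_algebraMap]
    simp [Algebra.TensorProduct.algebraMap_apply, antipode_apply]
  | hu i j =>
    rw [comul_u, counit_u]
    simp only [map_sum, LinearMap.rTensor_tmul, LinearMap.mul'_apply, antipode_u, qcof_mul_u]
    split_ifs <;> simp
  | hadd x y hx hy => simp only [map_add, hx, hy]
  | hmul x y hx hy =>
    have key : ∀ s t : QSU q n ⊗[ℂ] QSU q n, ∀ c : ℂ,
        LinearMap.mul' ℂ _ ((HopfAlgebraStruct.antipode ℂ).rTensor _ s) = algebraMap ℂ _ c →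
        LinearMap.mul' ℂ _ ((HopfAlgebraStruct.antipode ℂ).rTensor _ (s * t)) =
        algebraMap ℂ _ c * LinearMap.mul' ℂ _ ((HopfAlgebraStruct.antipode ℂ).rTensor _ t) := by
      intro s t c hs
      induction t with
      | zero => simp
      | add t t' ht ht' => simp only [mul_add, map_add, ht, ht']
      | tmul a b =>
        have : ∀ s : QSU q n ⊗[ℂ] QSU q n,
            LinearMap.mul' ℂ _ ((HopfAlgebraStruct.antipode ℂ).rTensor _ (s * a ⊗ₜ b)) =
            HopfAlgebraStruct.antipode ℂ a *
              LinearMap.mul' ℂ _ ((HopfAlgebraStruct.antipode ℂ).rTensor _ s) * b := by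
          intro s
          induction s with
          | zero => simp
          | add s s' hs hs' => simp only [add_mul, mul_add, map_add, hs, hs']
          | tmul c d => simp [antipode_mul, mul_assoc]
        rw [this, hs, LinearMap.rTensor_tmul, LinearMap.mul'_apply, ← Algebra.commutes, mul_assoc]
    rw [Bialgebra.comul_mul, key _ _ _ hx, hy, Bialgebra.counit_mul, map_mul]

lemma antipode_right (x : QSU q n) :
    LinearMap.mul' ℂ _ ((HopfAlgebraStruct.antipode ℂ).lTensor _ (Coalgebra.comul (R := ℂ) x)) =
      algebraMap ℂ (QSU q n) (Coalgebra.counit x) := by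
  induction x using induction with
  | hc c =>
    rw [Bialgebra.comul_algebraMap, Bialgebra.counit_algebraMap]
    simp [Algebra.TensorProduct.algebraMap_apply, antipode_apply]
  | hu i j =>
    rw [comul_u, counit_u]
    simp only [map_sum, LinearMap.lTensor_tmul, LinearMap.mul'_apply, antipode_u, u_mul_qcof]
    split_ifs <;> simp
  | hadd x y hx hy => simp only [map_add, hx, hy]
  | hmul x y hx hy =>
    have key : ∀ s t : QSU q n ⊗[ℂ] QSU q n, ∀ c : ℂ,
        LinearMap.mul' ℂ _ ((HopfAlgebraStruct.antipode ℂ).lTensor _ t) = algebraMap ℂ _ c →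
        LinearMap.mul' ℂ _ ((HopfAlgebraStruct.antipode ℂ).lTensor _ (s * t)) =
        LinearMap.mul' ℂ _ ((HopfAlgebraStruct.antipode ℂ).lTensor _ s) * algebraMap ℂ _ c := by
      intro s t c ht
      induction s with
      | zero => simp
      | add s s' hs hs' => simp only [add_mul, map_add, hs, hs']
      | tmul a b =>
        have : ∀ t : QSU q n ⊗[ℂ] QSU q n,
            LinearMap.mul' ℂ _ ((HopfAlgebraStruct.antipode ℂ).lTensor _ (a ⊗ₜ b * t)) =
            a * LinearMap.mul' ℂ _ ((HopfAlgebraStruct.antipode ℂ).lTensor _ t) *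
              HopfAlgebraStruct.antipode ℂ b := by
          intro t
          induction t with
          | zero => simp
          | add s s' hs hs' => simp only [add_mul, mul_add, map_add, hs, hs']
          | tmul c d => simp [antipode_mul, mul_assoc]
        rw [this, ht, LinearMap.lTensor_tmul, LinearMap.mul'_apply, mul_assoc, Algebra.commutes,
          mul_assoc]
    rw [Bialgebra.comul_mul, key _ _ _ hy, hx, Bialgebra.counit_mul, map_mul]

noncomputable instance : HopfAlgebra ℂ (QSU q n) where
  mul_antipode_rTensor_comul := LinearMap.ext antipode_left
  mul_antipode_lTensor_comul := LinearMap.ext antipode_right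

end QSU

/-! ### The quantum Grassmannian and its circle bundle -/

section homogeneous

variable (q : ℝ)

/-- The map `α_r : ℂ_q[SU_{r+m}] → ℂ_q[U_r]` sending `u^i_j` to `u^i_j` for `i, j ≤ r`,
`u^n_n` to `det_r⁻¹`, and any other `u^i_j` to `δ_{ij}`. -/
noncomputable def alpha [hq : Fact (0 < q)] (r m : ℕ) (hm : 0 < m) :
    QSU q (r + m) →ₐ[ℂ] QU q r :=
  QSU.lift (qblock (QU.u q)
    (fun i j => if i = j then (if (i : ℕ) + 1 = m then QU.detInv q r else 1) else 0))
    (QU.isQMatrix_u.block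
      (isQMatrix_diag (fun i : Fin m => if (i : ℕ) + 1 = m then QU.detInv q r else 1) fun i j => by
        split_ifs <;> simp)
      fun i j k l => by
        split_ifs
        · exact QU.detInv_comm hq.out i j
        · exact Commute.one_right _
        · exact Commute.zero_right _)
    (by
      rw [qdet_block, qdet_diag (fun i : Fin m => if (i : ℕ) + 1 = m then QU.detInv q r else 1)]
      obtain ⟨m, rfl⟩ := Nat.exists_eq_succ_of_ne_zero hm.ne'
      rw [List.ofFn_succ']
      have : ∀ i : Fin m, ¬ (i : ℕ) = m := fun i => i.2.ne
      simp [this, QU.qdet_mul_detInv])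

/-- The map `α'_r : ℂ_q[SU_{r+m}] → ℂ_q[SU_r]` sending `u^i_j` to `u^i_j` for `i, j ≤ r`
and any other `u^i_j` to `δ_{ij}`. -/
noncomputable def alpha' (r m : ℕ) : QSU q (r + m) →ₐ[ℂ] QSU q r :=
  QSU.lift (qblock (QSU.u q) fun i j => if i = j then 1 else 0)
    (QSU.isQMatrix_u.block (isQMatrix_diag (fun _ => 1) fun _ _ => .one_left 1)
      fun i j k l => by split_ifs <;> simp)
    (by rw [qdet_block, qdet_diag (fun _ : Fin m => (1 : QSU q r))]; simp)

/-- The map `β_r : ℂ_q[SU_{r+m}] → ℂ_q[SU_m]` sending `u^i_j` to `u^{i-r}_{j-r}` for `i, j > r`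
and any other `u^i_j` to `δ_{ij}`. -/
noncomputable def beta (r m : ℕ) : QSU q (r + m) →ₐ[ℂ] QSU q m :=
  QSU.lift (qblock (fun i j => if i = j then 1 else 0) (QSU.u q))
    ((isQMatrix_diag (fun _ => 1) fun _ _ => .one_left 1).block QSU.isQMatrix_u
      fun i j k l => by split_ifs <;> simp)
    (by rw [qdet_block, qdet_diag (fun _ : Fin r => (1 : QSU q m))]; simp)

variable [Fact (0 < q)] (r m : ℕ) (hm : 0 < m)

/-- The map `π_{n,r} = (α_r ⊗ β_r) ∘ Δ`, with `n = r + m`. -/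
noncomputable def piMap : QSU q (r + m) →ₐ[ℂ] QU q r ⊗[ℂ] QSU q m :=
  (Algebra.TensorProduct.map (alpha q r m hm) (beta q r m)).comp (Bialgebra.comulAlgHom ℂ _)

/-- The map `σ_{n,r} = (α'_r ⊗ β_r) ∘ Δ`, with `n = r + m`. -/
noncomputable def sigmaMap : QSU q (r + m) →ₐ[ℂ] QSU q r ⊗[ℂ] QSU q m :=
  (Algebra.TensorProduct.map (alpha' q r m) (beta q r m)).comp (Bialgebra.comulAlgHom ℂ _)

end homogeneous

/-- The right coaction `(id ⊗ π) ∘ Δ` on `G` induced by an algebra map `π : G → K`. -/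
noncomputable def inducedCoaction {G K : Type*} [Ring G] [Bialgebra ℂ G] [Ring K] [Algebra ℂ K]
    (π : G →ₐ[ℂ] K) : G →ₐ[ℂ] G ⊗[ℂ] K :=
  (Algebra.TensorProduct.map (AlgHom.id ℂ G) π).comp (Bialgebra.comulAlgHom ℂ G)

/-- The subalgebra of coinvariant elements `δ(p) = p ⊗ 1`. -/
noncomputable def coinvariants {P H : Type*} [Ring P] [Algebra ℂ P] [Ring H] [Algebra ℂ H]
    (δ : P →ₐ[ℂ] P ⊗[ℂ] H) : Subalgebra ℂ P :=
  AlgHom.equalizer δ Algebra.TensorProduct.includeLeft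

section bundle

variable (q : ℝ) [Fact (0 < q)] (r m : ℕ) (hm : 0 < m)

/-- The quantum Grassmannian `ℂ_q[Gr_{n,r}]`, with `n = r + m`. -/
noncomputable def quantumGrassmannian : Subalgebra ℂ (QSU q (r + m)) :=
  coinvariants (inducedCoaction (piMap q r m hm))

/-- The quantum homogeneous space `ℂ_q[S^{n,r}]`, with `n = r + m`. -/
noncomputable def quantumSphere : Subalgebra ℂ (QSU q (r + m)) :=
  coinvariants (inducedCoaction (sigmaMap q r m))

/-- The line bundle `E_k`: the elements `g` with `Δ_π(g) = g ⊗ det_r^k ⊗ 1`. -/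
noncomputable def lineBundle (k : ℤ) : Submodule ℂ (QSU q (r + m)) :=
  LinearMap.eqLocus (inducedCoaction (piMap q r m hm)).toLinearMap
    ((TensorProduct.mk ℂ (QSU q (r + m)) (QU q r ⊗[ℂ] QSU q m)).flip
      (((QU.detUnit q r ^ k : (QU q r)ˣ) : QU q r) ⊗ₜ 1))

end bundle

/-- The quantum minor `z^I_J` of `ℂ_q[SU_n]`, where `I`, `J` are given by their increasing
enumerations. -/
noncomputable def qminor (q : ℝ) {n k : ℕ} (I J : Fin k ↪o Fin n) : QSU q n :=
  qdet (q : ℂ) fun a b => QSU.u q (I a) (J b)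

/-! ### Principal comodule algebras -/

section principal

universe u v

variable {P : Type u} [Ring P] [Algebra ℂ P]

/-- The relations `p m ⊗ n = p ⊗ m n` defining `P ⊗_M N` for a left `M`-module `N`. -/
def rightRel (M : Subalgebra ℂ P) (N : Type v) [AddCommGroup N] [Module ℂ N] [Module M N] :
    Submodule ℂ (P ⊗[ℂ] N) :=
  Submodule.span ℂ {x | ∃ (p : P) (a : M) (y : N), x = (p * a) ⊗ₜ y - p ⊗ₜ (a • y)}

/-- The relations `n m ⊗ p = n ⊗ m p` defining `N ⊗_M P` for a right `M`-module `N`. -/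
def leftRel (M : Subalgebra ℂ P) (N : Type v) [AddCommGroup N] [Module ℂ N] [Module Mᵐᵒᵖ N] :
    Submodule ℂ (N ⊗[ℂ] P) :=
  Submodule.span ℂ {x | ∃ (y : N) (a : M) (p : P),
    x = (MulOpposite.op a • y) ⊗ₜ p - y ⊗ₜ ((a : P) * p)}

/-- The map `P ⊗_M N → P ⊗_M N'` induced by a map of left `M`-modules `N → N'`. -/
noncomputable def rightMap (M : Subalgebra ℂ P) {N N' : Type v} [AddCommGroup N] [Module ℂ N]
    [Module M N] [IsScalarTower ℂ M N] [AddCommGroup N'] [Module ℂ N'] [Module M N']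
    [IsScalarTower ℂ M N'] (f : N →ₗ[M] N') :
    ((P ⊗[ℂ] N) ⧸ rightRel M N) →ₗ[ℂ] ((P ⊗[ℂ] N') ⧸ rightRel M N') :=
  Submodule.mapQ _ _ ((f.restrictScalars ℂ).lTensor P) (by
    rw [rightRel, Submodule.span_le]
    rintro _ ⟨p, a, y, rfl⟩
    refine Submodule.subset_span ⟨p, a, f y, ?_⟩
    simp)

/-- The map `N ⊗_M P → N' ⊗_M P` induced by a map of right `M`-modules `N → N'`. -/
noncomputable def leftMap (M : Subalgebra ℂ P) {N N' : Type v} [AddCommGroup N] [Module ℂ N]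
    [Module Mᵐᵒᵖ N] [IsScalarTower ℂ Mᵐᵒᵖ N] [AddCommGroup N'] [Module ℂ N'] [Module Mᵐᵒᵖ N']
    [IsScalarTower ℂ Mᵐᵒᵖ N'] (f : N →ₗ[Mᵐᵒᵖ] N') :
    ((N ⊗[ℂ] P) ⧸ leftRel M N) →ₗ[ℂ] ((N' ⊗[ℂ] P) ⧸ leftRel M N') :=
  Submodule.mapQ _ _ ((f.restrictScalars ℂ).rTensor P) (by
    rw [leftRel, Submodule.span_le]
    rintro _ ⟨y, a, p, rfl⟩
    refine Submodule.subset_span ⟨f y, a, p, ?_⟩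
    simp)

/-- `P` is faithfully flat as a right `M`-module: `P ⊗_M -` preserves and reflects exactness. -/
def IsRightFaithfullyFlat (M : Subalgebra ℂ P) : Prop :=
  ∀ (N₁ N₂ N₃ : Type u) [AddCommGroup N₁] [Module ℂ N₁] [Module M N₁] [IsScalarTower ℂ M N₁]
    [AddCommGroup N₂] [Module ℂ N₂] [Module M N₂] [IsScalarTower ℂ M N₂]
    [AddCommGroup N₃] [Module ℂ N₃] [Module M N₃] [IsScalarTower ℂ M N₃]
    (f : N₁ →ₗ[M] N₂) (g : N₂ →ₗ[M] N₃),
    Function.Exact f g ↔ Function.Exact (rightMap M f) (rightMap M g)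

/-- `P` is faithfully flat as a left `M`-module: `- ⊗_M P` preserves and reflects exactness. -/
def IsLeftFaithfullyFlat (M : Subalgebra ℂ P) : Prop :=
  ∀ (N₁ N₂ N₃ : Type u) [AddCommGroup N₁] [Module ℂ N₁] [Module Mᵐᵒᵖ N₁]
    [IsScalarTower ℂ Mᵐᵒᵖ N₁] [AddCommGroup N₂] [Module ℂ N₂] [Module Mᵐᵒᵖ N₂]
    [IsScalarTower ℂ Mᵐᵒᵖ N₂] [AddCommGroup N₃] [Module ℂ N₃] [Module Mᵐᵒᵖ N₃]
    [IsScalarTower ℂ Mᵐᵒᵖ N₃] (f : N₁ →ₗ[Mᵐᵒᵖ] N₂) (g : N₂ →ₗ[Mᵐᵒᵖ] N₃),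
    Function.Exact f g ↔ Function.Exact (leftMap M f) (leftMap M g)

variable {H : Type v} [Ring H] [HopfAlgebra ℂ H]

/-- An algebra map `δ : P → P ⊗ H` makes `P` a right `H`-comodule algebra if it is
coassociative and counital. -/
structure IsComoduleAlgebra (δ : P →ₐ[ℂ] P ⊗[ℂ] H) : Prop where
  coassoc : (TensorProduct.assoc ℂ P H H).toLinearMap ∘ₗ δ.toLinearMap.rTensor H ∘ₗ δ.toLinearMap =
    (Coalgebra.comul (R := ℂ) (A := H)).lTensor P ∘ₗ δ.toLinearMap
  counit : (TensorProduct.rid ℂ P).toLinearMap ∘ₗ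
    (Coalgebra.counit (R := ℂ) (A := H)).lTensor P ∘ₗ δ.toLinearMap = LinearMap.id

/-- The map `(m_P ⊗ id) ∘ (id ⊗ δ) : P ⊗ P → P ⊗ H`. -/
noncomputable def liftedCan (δ : P →ₐ[ℂ] P ⊗[ℂ] H) : P ⊗[ℂ] P →ₗ[ℂ] P ⊗[ℂ] H :=
  (LinearMap.mul' ℂ P).rTensor H ∘ₗ (TensorProduct.assoc ℂ P P H).symm.toLinearMap ∘ₗ
    δ.toLinearMap.lTensor P

lemma liftedCan_tmul (δ : P →ₐ[ℂ] P ⊗[ℂ] H) (p p' : P) :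
    liftedCan δ (p ⊗ₜ p') = (p ⊗ₜ 1) * δ p' := by
  have : ∀ t : P ⊗[ℂ] H, (LinearMap.mul' ℂ P).rTensor H
      ((TensorProduct.assoc ℂ P P H).symm (p ⊗ₜ t)) = (p ⊗ₜ 1) * t := by
    intro t
    induction t with
    | zero => simp
    | add a b ha hb => rw [TensorProduct.tmul_add, map_add, map_add, ha, hb, mul_add]
    | tmul a b => simp
  simpa [liftedCan] using this (δ p')

/-- The canonical map `P ⊗_M P → P ⊗ H`, where `M` is the algebra of coinvariants. -/
noncomputable def can (δ : P →ₐ[ℂ] P ⊗[ℂ] H) :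
    ((P ⊗[ℂ] P) ⧸ rightRel (coinvariants δ) P) →ₗ[ℂ] P ⊗[ℂ] H :=
  Submodule.liftQ _ (liftedCan δ) (by
    rw [rightRel, Submodule.span_le]
    rintro _ ⟨p, a, y, rfl⟩
    have ha : δ a = (a : P) ⊗ₜ 1 := a.2
    have hs : a • y = (a : P) * y := rfl
    simp [liftedCan_tmul, hs, ha, ← mul_assoc])

/-- Principal right `H`-comodule algebras: Hopf--Galois extensions of the coinvariants that are
faithfully flat on both sides. -/
structure IsPrincipal (δ : P →ₐ[ℂ] P ⊗[ℂ] H) : Prop where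
  comoduleAlgebra : IsComoduleAlgebra δ
  hopfGalois : Function.Bijective (can δ)
  rightFlat : IsRightFaithfullyFlat (coinvariants δ)
  leftFlat : IsLeftFaithfullyFlat (coinvariants δ)

/-- The left coaction `p ↦ S⁻¹(p_(1)) ⊗ p_(0)` associated with a right coaction. -/
noncomputable def leftCoaction (hS : Function.Bijective (HopfAlgebra.antipode ℂ (A := H)))
    (δ : P →ₐ[ℂ] P ⊗[ℂ] H) : P →ₗ[ℂ] H ⊗[ℂ] P :=
  (LinearEquiv.ofBijective _ hS).symm.toLinearMap.rTensor P ∘ₗ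
    (TensorProduct.comm ℂ P H).toLinearMap ∘ₗ δ.toLinearMap

/-- Principal `ℓ`-maps of a right `H`-comodule algebra. -/
structure IsPrincipalEllMap (hS : Function.Bijective (HopfAlgebra.antipode ℂ (A := H)))
    (δ : P →ₐ[ℂ] P ⊗[ℂ] H) (ℓ : H →ₗ[ℂ] P ⊗[ℂ] P) : Prop where
  map_one : ℓ 1 = 1 ⊗ₜ 1
  mul_comp : LinearMap.mul' ℂ P ∘ₗ ℓ =
    Algebra.linearMap ℂ P ∘ₗ Coalgebra.counit (R := ℂ) (A := H)
  right : ℓ.rTensor H ∘ₗ Coalgebra.comul (R := ℂ) (A := H) =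
    (TensorProduct.assoc ℂ P P H).symm.toLinearMap ∘ₗ δ.toLinearMap.lTensor P ∘ₗ ℓ
  left : ℓ.lTensor H ∘ₗ Coalgebra.comul (R := ℂ) (A := H) =
    (TensorProduct.assoc ℂ H P P).toLinearMap ∘ₗ (leftCoaction hS δ).rTensor P ∘ₗ ℓ

end principal

/-- The antipode of `ℂ[U_1] = ℂ[t, t⁻¹]` is bijective. -/
lemma laurent_antipode_bijective :
    Function.Bijective (HopfAlgebra.antipode ℂ (A := ℂ[T;T⁻¹])) := by
  have : Function.Involutive (HopfAlgebra.antipode ℂ (A := ℂ[T;T⁻¹])) := by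
    intro x
    induction x using LaurentPolynomial.induction_on' with
    | add a b ha hb => rw [map_add, map_add, ha, hb]
    | C_mul_T n a =>
      simp [LaurentPolynomial.antipode_C_mul_T]
  exact this.bijective

end QGr

open QGr

/-! Write G for ℂ_q[SU_n] with n = r + m, P for ℂ_q[S^{n,r}] and M for the coinvariants. Classically
S(U_r × U_m) is the product of its normal subgroup SU_r × SU_m with the circle of matrices diag(t,
1, …, 1, t⁻¹), and this circle acts on the quotient of SU_n by SU_r × SU_m. The proof is the
algebraic form of this picture.

The circle coacts on all of G by u^i_j ↦ u^i_j ⊗ t^{w j}, with weights w = (1, 0, …, 0, -1). It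
normalises SU_r × SU_m (`sigma_circle`), so the coaction restricts to P; this gives
`sphereCoaction`. The map π and the pair (circle, σ) determine each other:
`inducedCoaction_piMap_eq` rebuilds Δ_π from the pair, while `blockCharacter_piMap` and `proj_piMap`
recover the circle and σ from π. Hence E_k is exactly the part of P of degree k
(`mem_lineBundle_iff_homogeneous`). A comodule over ℂ[t, t⁻¹] is the sum of its homogeneous parts,
so a coaction with prescribed values on every E_k is unique, and the coinvariants are E_0, the
Grassmannian.

For the ℓ-map let x be z^k or z̄^k. Such x is invariant under SU_r × SU_m and homogeneous under the
circle on both sides, by multiplicativity of quantum determinants (`qdet_sum_tmul`, `qdet_scale`).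
In S(x_(1)) ⊗ x_(2) the right leg inherits the right invariance of x (`inducedCoaction_right_leg`).
The left leg inherits the left invariance with inverted weight, because S reverses the coproduct
(`inducedCoaction_antipode`, `QSU.antipodeComul`). As P is the kernel of a linear map and everything
is flat over ℂ, the element lies in P ⊗ P. Its product is ε(x) = 1.

Principality follows from the ℓ-map alone. The maps p ↦ p_(0) ℓ(p_(1)) and p ↦ ℓ(S(p_(1))) p_(0) are
M-linear sections of the multiplications M ⊗ P → P and P ⊗ M → P. The first yields the inverse of
the canonical map. Through them the tensor products over M become natural retracts of tensor
products over ℂ, so they preserve exactness. Projection to degree zero makes N a natural retract of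
P ⊗_M N and of N ⊗_M P, so they reflect it too. -/

namespace QGr

/-! ### Comodules over the Laurent polynomials -/

section slice

variable {V W : Type*} [AddCommGroup V] [Module ℂ V] [AddCommGroup W] [Module ℂ W]

/-- The coefficient of `T k`, as a linear form on Laurent polynomials. -/
noncomputable def laurentCoeff (k : ℤ) : ℂ[T;T⁻¹] →ₗ[ℂ] ℂ :=
  Finsupp.lapply k ∘ₗ (AddMonoidAlgebra.coeffLinearEquiv ℂ).toLinearMap

lemma laurentCoeff_T (k n : ℤ) :
    laurentCoeff k (LaurentPolynomial.T n) = if n = k then 1 else 0 :=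
  LaurentPolynomial.T_apply k n

lemma C_mul_T_eq_smul (a : ℂ) (n : ℤ) :
    LaurentPolynomial.C a * LaurentPolynomial.T n = a • (LaurentPolynomial.T n : ℂ[T;T⁻¹]) :=
  (LaurentPolynomial.smul_eq_C_mul a _).symm

lemma laurent_hom_ext {f g : ℂ[T;T⁻¹] →ₗ[ℂ] V}
    (h : ∀ n : ℤ, f (LaurentPolynomial.T n) = g (LaurentPolynomial.T n)) : f = g := by
  refine LinearMap.ext fun x => ?_
  induction x using LaurentPolynomial.induction_on' with
  | add a b ha hb => rw [map_add, map_add, ha, hb]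
  | C_mul_T n a => rw [C_mul_T_eq_smul, map_smul, map_smul, h]

/-- The linear map on Laurent polynomials with prescribed values at the monomials. -/
noncomputable def laurentConstr (f : ℤ → V) : ℂ[T;T⁻¹] →ₗ[ℂ] V :=
  (AddMonoidAlgebra.basis ℤ ℂ).constr ℂ f

lemma laurentConstr_T (f : ℤ → V) (n : ℤ) : laurentConstr f (LaurentPolynomial.T n) = f n :=
  (AddMonoidAlgebra.basis ℤ ℂ).constr_basis ℂ f n

/-- The coefficient of `T k` of an element of `V ⊗ ℂ[t, t⁻¹]`. -/
noncomputable def slice (k : ℤ) : V ⊗[ℂ] ℂ[T;T⁻¹] →ₗ[ℂ] V :=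
  (TensorProduct.rid ℂ V).toLinearMap ∘ₗ (laurentCoeff k).lTensor V

lemma slice_tmul (k : ℤ) (v : V) (h : ℂ[T;T⁻¹]) : slice k (v ⊗ₜ[ℂ] h) = laurentCoeff k h • v := by
  simp [slice]

lemma slice_tmul_T (k n : ℤ) (v : V) :
    slice k (v ⊗ₜ[ℂ] (LaurentPolynomial.T n : ℂ[T;T⁻¹])) = if n = k then v else 0 := by
  rw [slice_tmul, laurentCoeff_T, ite_smul, one_smul, zero_smul]

lemma slice_rTensor (f : V →ₗ[ℂ] W) (k : ℤ) (w : V ⊗[ℂ] ℂ[T;T⁻¹]) :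
    slice k (f.rTensor _ w) = f (slice k w) := by
  induction w with
  | zero => simp
  | add a b ha hb => simp only [map_add, ha, hb]
  | tmul v h => simp [slice_tmul]

/-- Together with `slice_sum` this identifies V ⊗ ℂ[t, t⁻¹] with the finitely supported families ℤ →
V; later computations reduce to monomials through it. -/
lemma exists_eq_sum_tmul_T (w : V ⊗[ℂ] ℂ[T;T⁻¹]) :
    ∃ v : ℤ →₀ V, w = v.sum fun k x => x ⊗ₜ (LaurentPolynomial.T k : ℂ[T;T⁻¹]) := by
  induction w with
  | zero => exact ⟨0, by simp⟩
  | add a b ha hb =>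
    obtain ⟨v, rfl⟩ := ha
    obtain ⟨v', rfl⟩ := hb
    refine ⟨v + v', ?_⟩
    rw [Finsupp.sum_add_index' (by simp) (by intros; rw [TensorProduct.add_tmul])]
  | tmul x h =>
    induction h using LaurentPolynomial.induction_on' with
    | add a b ha hb =>
      obtain ⟨v, hv⟩ := ha
      obtain ⟨v', hv'⟩ := hb
      refine ⟨v + v', ?_⟩
      rw [Finsupp.sum_add_index' (by simp) (by intros; rw [TensorProduct.add_tmul]),
        TensorProduct.tmul_add, hv, hv']
    | C_mul_T n a =>
      refine ⟨Finsupp.single n (a • x), ?_⟩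
      rw [Finsupp.sum_single_index (by simp), C_mul_T_eq_smul, TensorProduct.tmul_smul,
        TensorProduct.smul_tmul']

lemma slice_sum (k : ℤ) (v : ℤ →₀ V) :
    slice k (v.sum fun k x => x ⊗ₜ[ℂ] (LaurentPolynomial.T k : ℂ[T;T⁻¹])) = v k := by
  simp only [Finsupp.sum, map_sum, slice_tmul_T]
  rw [Finset.sum_ite_eq' v.support k]
  simp +contextual

end slice

/-! ### The grading defined by a coaction of ℂ[t, t⁻¹]. -/

section graded

universe u

variable {P : Type u} [Ring P] [Algebra ℂ P] {δ : P →ₐ[ℂ] P ⊗[ℂ] ℂ[T;T⁻¹]}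

/-- Take the coefficient of t^k in the last leg of the coassociativity identity: since every t^j is
grouplike, only the term x_k ⊗ t^k survives on the right. -/
lemma IsComoduleAlgebra.slice_homogeneous (hδ : IsComoduleAlgebra δ) (x : P) (k : ℤ) :
    δ (slice k (δ x)) = slice k (δ x) ⊗ₜ LaurentPolynomial.T k := by
  have h := congrArg (slice k ∘ₗ (TensorProduct.assoc ℂ P _ _).symm.toLinearMap)
    (LinearMap.congr_fun hδ.coassoc x)
  simp only [LinearMap.comp_apply, LinearEquiv.coe_coe, LinearEquiv.symm_apply_apply,
    AlgHom.toLinearMap_apply] at h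
  rw [slice_rTensor] at h
  rw [← AlgHom.toLinearMap_apply, h]
  generalize δ x = w
  obtain ⟨v, rfl⟩ := exists_eq_sum_tmul_T w
  rw [slice_sum]
  simp only [Finsupp.sum, map_sum, LinearMap.lTensor_tmul, LaurentPolynomial.comul_T,
    TensorProduct.assoc_symm_tmul, slice_tmul_T]
  rw [Finset.sum_ite_eq' v.support k]
  simp +contextual

/-- The counit takes the value 1 at every t^k, so the counit axiom reads as the decomposition of x
into its homogeneous components. -/
lemma IsComoduleAlgebra.sum_slice (hδ : IsComoduleAlgebra δ) (x : P) :
    ∃ s : Finset ℤ, x = ∑ k ∈ s, slice k (δ x) := by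
  have h := LinearMap.congr_fun hδ.counit x
  simp only [LinearMap.comp_apply, LinearEquiv.coe_coe, AlgHom.toLinearMap_apply,
    LinearMap.id_apply] at h
  obtain ⟨v, hv⟩ := exists_eq_sum_tmul_T (δ x)
  refine ⟨v.support, ?_⟩
  rw [hv] at h ⊢
  simp only [slice_sum]
  conv_lhs => rw [← h]
  simp [Finsupp.sum]

lemma IsComoduleAlgebra.induction_homogeneous (hδ : IsComoduleAlgebra δ) {motive : P → Prop}
    (hom : ∀ (k : ℤ) (x : P), δ x = x ⊗ₜ LaurentPolynomial.T k → motive x)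
    (add : ∀ x y, motive x → motive y → motive (x + y)) (x : P) : motive x := by
  obtain ⟨s, hs⟩ := hδ.sum_slice x
  rw [hs]
  -- The empty sum is covered because 0 is homogeneous of degree 0.
  refine Finset.sum_induction _ motive add (hom 0 0 (by simp)) fun k _ => ?_
  exact hom k _ (hδ.slice_homogeneous x k)

/-- Source of the uniqueness of the coaction, and of all later checks made only on homogeneous
elements. -/
lemma IsComoduleAlgebra.hom_ext (hδ : IsComoduleAlgebra δ) {V : Type*} [AddCommGroup V]
    [Module ℂ V] {f g : P →ₗ[ℂ] V}
    (h : ∀ (k : ℤ) (x : P), δ x = x ⊗ₜ LaurentPolynomial.T k → f x = g x) : f = g :=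
  LinearMap.ext fun x => hδ.induction_homogeneous (motive := fun x => f x = g x) h
    (fun x y hx hy => by rw [map_add, map_add, hx, hy]) x

lemma mem_coinvariants_iff {x : P} : x ∈ coinvariants δ ↔ δ x = x ⊗ₜ 1 := Iff.rfl

/-- Multiplication by a homogeneous element shifts degrees; with n = 0 this is the M-linearity of
the projection to degree zero. -/
lemma slice_mul_T_left (a : P) (k n : ℤ) (w : P ⊗[ℂ] ℂ[T;T⁻¹]) :
    slice (n + k) ((a ⊗ₜ LaurentPolynomial.T n) * w) = a * slice k w := by
  obtain ⟨v, rfl⟩ := exists_eq_sum_tmul_T w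
  simp only [Finsupp.sum, Finset.mul_sum, map_sum, Algebra.TensorProduct.tmul_mul_tmul,
    ← LaurentPolynomial.T_add, slice_tmul_T, add_right_inj, mul_ite, mul_zero]

lemma slice_mul_T_right (a : P) (k n : ℤ) (w : P ⊗[ℂ] ℂ[T;T⁻¹]) :
    slice (k + n) (w * (a ⊗ₜ LaurentPolynomial.T n)) = slice k w * a := by
  obtain ⟨v, rfl⟩ := exists_eq_sum_tmul_T w
  simp only [Finsupp.sum, Finset.sum_mul, map_sum, Algebra.TensorProduct.tmul_mul_tmul,
    ← LaurentPolynomial.T_add, slice_tmul_T, add_left_inj, ite_mul, zero_mul]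

/-- The projection onto the coinvariants, i.e. onto the component of degree zero. -/
noncomputable def coinvProj (hδ : IsComoduleAlgebra δ) : P →ₗ[ℂ] coinvariants δ :=
  (slice 0 ∘ₗ δ.toLinearMap).codRestrict (coinvariants δ).toSubmodule fun x => by
    have := hδ.slice_homogeneous x 0
    rwa [LaurentPolynomial.T_zero] at this

lemma coe_coinvProj (hδ : IsComoduleAlgebra δ) (x : P) :
    (coinvProj hδ x : P) = slice 0 (δ x) := rfl

/-- With `coinvProj_mul_right` and `coinvProj_one`, this makes M a direct summand of P as an
M-bimodule, which is what the faithful half of faithful flatness uses. -/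
lemma coinvProj_mul_left (hδ : IsComoduleAlgebra δ) (a : coinvariants δ) (x : P) :
    coinvProj hδ (a * x) = a * coinvProj hδ x := by
  refine Subtype.ext ?_
  rw [coe_coinvProj, map_mul, mem_coinvariants_iff.1 a.2, ← LaurentPolynomial.T_zero]
  exact slice_mul_T_left (a : P) 0 0 (δ x)

lemma coinvProj_mul_right (hδ : IsComoduleAlgebra δ) (a : coinvariants δ) (x : P) :
    coinvProj hδ (x * a) = coinvProj hδ x * a := by
  refine Subtype.ext ?_
  rw [coe_coinvProj, map_mul, mem_coinvariants_iff.1 a.2, ← LaurentPolynomial.T_zero]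
  exact slice_mul_T_right (a : P) 0 0 (δ x)

lemma coinvProj_one (hδ : IsComoduleAlgebra δ) : coinvProj hδ 1 = 1 := by
  refine Subtype.ext ?_
  rw [coe_coinvProj, map_one, Algebra.TensorProduct.one_def, ← LaurentPolynomial.T_zero,
    slice_tmul_T, if_pos rfl]
  rfl

end graded

/-! ### Principality from a principal `ℓ`-map -/

section splitting

universe u

variable {P : Type u} [Ring P] [Algebra ℂ P] {δ : P →ₐ[ℂ] P ⊗[ℂ] ℂ[T;T⁻¹]}
  {ℓ : ℂ[T;T⁻¹] →ₗ[ℂ] P ⊗[ℂ] P}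

lemma mul_rTensor_assoc_symm {V : Type*} [AddCommGroup V] [Module ℂ V] (p : P) (w : P ⊗[ℂ] V) :
    (LinearMap.mul' ℂ P).rTensor V ((TensorProduct.assoc ℂ P P V).symm (p ⊗ₜ w)) =
      (LinearMap.mulLeft ℂ p).rTensor V w := by
  induction w with
  | zero => simp
  | add x y hx hy => simp only [TensorProduct.tmul_add, map_add, hx, hy]
  | tmul x y => simp

lemma mul_lTensor_assoc {V : Type*} [AddCommGroup V] [Module ℂ V] (p : P) (w : V ⊗[ℂ] P) :
    (LinearMap.mul' ℂ P).lTensor V (TensorProduct.assoc ℂ V P P (w ⊗ₜ p)) =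
      (LinearMap.mulRight ℂ p).lTensor V w := by
  induction w with
  | zero => simp
  | add x y hx hy => simp only [TensorProduct.add_tmul, map_add, hx, hy]
  | tmul x y => simp

lemma mul_rTensor_mulLeft (p : P) (w : P ⊗[ℂ] P) :
    LinearMap.mul' ℂ P ((LinearMap.mulLeft ℂ p).rTensor P w) = p * LinearMap.mul' ℂ P w := by
  induction w with
  | zero => simp
  | add x y hx hy => simp only [map_add, hx, hy, mul_add]
  | tmul x y => simp [mul_assoc]

lemma mul_lTensor_mulRight (p : P) (w : P ⊗[ℂ] P) :
    LinearMap.mul' ℂ P ((LinearMap.mulRight ℂ p).lTensor P w) = LinearMap.mul' ℂ P w * p := by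
  induction w with
  | zero => simp
  | add x y hx hy => simp only [map_add, hx, hy, add_mul]
  | tmul x y => simp [mul_assoc]

lemma IsPrincipalEllMap.mul_T (h : IsPrincipalEllMap laurent_antipode_bijective δ ℓ) (k : ℤ) :
    LinearMap.mul' ℂ P (ℓ (LaurentPolynomial.T k)) = 1 := by
  have := LinearMap.congr_fun h.mul_comp (LaurentPolynomial.T k)
  simpa using this

/-- As t^k is grouplike, right colinearity of ℓ says that the right leg of ℓ(t^k) is homogeneous of
degree k. -/
lemma IsPrincipalEllMap.right_T (h : IsPrincipalEllMap laurent_antipode_bijective δ ℓ) (k : ℤ) :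
    δ.toLinearMap.lTensor P (ℓ (LaurentPolynomial.T k)) = TensorProduct.assoc ℂ P P _
      (ℓ (LaurentPolynomial.T k) ⊗ₜ (LaurentPolynomial.T k : ℂ[T;T⁻¹])) := by
  have := LinearMap.congr_fun h.right (LaurentPolynomial.T k)
  simp only [LinearMap.comp_apply, LaurentPolynomial.comul_T, LinearMap.rTensor_tmul,
    LinearEquiv.coe_coe] at this
  rw [this, LinearEquiv.apply_symm_apply]

/-- The antipode exchanges t^n and t^{-n}; this sign is why left legs of ℓ(t^k) have degree -k. -/
lemma laurentCoeff_antipode_symm (k : ℤ) (h : ℂ[T;T⁻¹]) : laurentCoeff k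
    ((LinearEquiv.ofBijective _ laurent_antipode_bijective).symm h) = laurentCoeff (-k) h := by
  obtain ⟨h, rfl⟩ := (LinearEquiv.ofBijective _ laurent_antipode_bijective).surjective h
  rw [LinearEquiv.symm_apply_apply, LinearEquiv.ofBijective_apply]
  refine LinearMap.congr_fun (f := laurentCoeff k) (g := laurentCoeff (-k) ∘ₗ
    HopfAlgebra.antipode ℂ) (laurent_hom_ext fun n => ?_) h
  simp [LaurentPolynomial.antipode_T, laurentCoeff_T]

lemma laurentCoeff_leftCoaction (k : ℤ) (p : P) :
    TensorProduct.lid ℂ P ((laurentCoeff k).rTensor P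
      (leftCoaction laurent_antipode_bijective δ p)) = slice (-k) (δ p) := by
  simp only [leftCoaction, LinearMap.comp_apply, AlgHom.toLinearMap_apply]
  generalize δ p = w
  induction w with
  | zero => simp
  | add x y hx hy => simp only [map_add, hx, hy]
  | tmul x y =>
    simp only [LinearEquiv.coe_coe, TensorProduct.comm_tmul, LinearMap.rTensor_tmul,
      TensorProduct.lid_tmul, slice_tmul]
    rw [← laurentCoeff_antipode_symm]

/-- Left colinearity means that the left leg of ℓ(t^k) has degree -k. It is recorded in projected
form, as invariance under the projection to that degree, so that it composes with other maps on the
leg. -/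
lemma IsPrincipalEllMap.left_T (h : IsPrincipalEllMap laurent_antipode_bijective δ ℓ) (k : ℤ) :
    (slice (-k) ∘ₗ δ.toLinearMap).rTensor P (ℓ (LaurentPolynomial.T k)) =
      ℓ (LaurentPolynomial.T k) := by
  -- Reading off the coefficient of t^k in the first leg turns the left side of the colinearity
  -- axiom into ℓ(t^k) itself.
  have := congrArg (TensorProduct.lid ℂ (P ⊗[ℂ] P) ∘ (laurentCoeff k).rTensor (P ⊗[ℂ] P))
    (LinearMap.congr_fun h.left (LaurentPolynomial.T k))
  simp only [Function.comp_apply, LinearMap.comp_apply, LaurentPolynomial.comul_T,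
    LinearMap.lTensor_tmul, LinearMap.rTensor_tmul, laurentCoeff_T, if_true,
    TensorProduct.lid_tmul, one_smul] at this
  conv_rhs => rw [this]
  generalize ℓ (LaurentPolynomial.T k) = w
  induction w with
  | zero => simp
  | add x y hx hy => simp only [map_add, hx, hy]
  | tmul x y =>
    simp only [LinearMap.rTensor_tmul, LinearMap.comp_apply, AlgHom.toLinearMap_apply]
    rw [← laurentCoeff_leftCoaction]
    generalize leftCoaction laurent_antipode_bijective δ x = w
    induction w with
    | zero => simp
    | add a b ha hb => simp only [map_add, TensorProduct.add_tmul, ha, hb]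
    | tmul a b => simp [TensorProduct.smul_tmul']

lemma IsPrincipalEllMap.right_slice_T (h : IsPrincipalEllMap laurent_antipode_bijective δ ℓ)
    (k : ℤ) : (slice k ∘ₗ δ.toLinearMap).lTensor P (ℓ (LaurentPolynomial.T k)) =
      ℓ (LaurentPolynomial.T k) := by
  rw [LinearMap.lTensor_comp, LinearMap.comp_apply, h.right_T]
  generalize ℓ (LaurentPolynomial.T k) = w
  induction w with
  | zero => simp
  | add x y hx hy => simp only [map_add, TensorProduct.add_tmul, hx, hy]
  | tmul x y => simp [slice_tmul_T]

/-- The splitting `p ↦ p_(0) ℓ(p_(1))` of the multiplication `M ⊗ P → P`. -/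
noncomputable def leftSplitting (δ : P →ₐ[ℂ] P ⊗[ℂ] ℂ[T;T⁻¹])
    (ℓ : ℂ[T;T⁻¹] →ₗ[ℂ] P ⊗[ℂ] P) : P →ₗ[ℂ] P ⊗[ℂ] P :=
  (LinearMap.mul' ℂ P).rTensor P ∘ₗ (TensorProduct.assoc ℂ P P P).symm.toLinearMap ∘ₗ
    ℓ.lTensor P ∘ₗ δ.toLinearMap

/-- The splitting `p ↦ ℓ(S(p_(1))) p_(0)` of the multiplication `P ⊗ M → P`. -/
noncomputable def rightSplitting (δ : P →ₐ[ℂ] P ⊗[ℂ] ℂ[T;T⁻¹])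
    (ℓ : ℂ[T;T⁻¹] →ₗ[ℂ] P ⊗[ℂ] P) : P →ₗ[ℂ] P ⊗[ℂ] P :=
  (LinearMap.mul' ℂ P).lTensor P ∘ₗ (TensorProduct.assoc ℂ P P P).toLinearMap ∘ₗ
    (ℓ ∘ₗ HopfAlgebra.antipode ℂ).rTensor P ∘ₗ (TensorProduct.comm ℂ P _).toLinearMap ∘ₗ
    δ.toLinearMap

lemma leftSplitting_homogeneous {k : ℤ} {x : P} (hx : δ x = x ⊗ₜ LaurentPolynomial.T k) :
    leftSplitting δ ℓ x = (LinearMap.mulLeft ℂ x).rTensor P (ℓ (LaurentPolynomial.T k)) := by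
  simp only [leftSplitting, LinearMap.comp_apply, AlgHom.toLinearMap_apply, hx,
    LinearMap.lTensor_tmul, LinearEquiv.coe_coe, mul_rTensor_assoc_symm]

lemma rightSplitting_homogeneous {k : ℤ} {x : P} (hx : δ x = x ⊗ₜ LaurentPolynomial.T k) :
    rightSplitting δ ℓ x = (LinearMap.mulRight ℂ x).lTensor P (ℓ (LaurentPolynomial.T (-k))) := by
  simp only [rightSplitting, LinearMap.comp_apply, AlgHom.toLinearMap_apply, hx,
    LinearEquiv.coe_coe, TensorProduct.comm_tmul, LinearMap.rTensor_tmul, mul_lTensor_assoc,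
    LaurentPolynomial.antipode_T]

/-- Multiplying by a coinvariant leaves the degree k, hence the factor ℓ(t^k), unchanged. This
linearity, like that of `rightSplitting_mul`, lets the splitting descend to tensor products over M.
-/
lemma leftSplitting_mul (hδ : IsComoduleAlgebra δ) (a : coinvariants δ) (x : P) :
    leftSplitting δ ℓ (a * x) =
      (LinearMap.mulLeft ℂ (a : P)).rTensor P (leftSplitting δ ℓ x) := by
  refine LinearMap.congr_fun (f := leftSplitting δ ℓ ∘ₗ LinearMap.mulLeft ℂ (a : P))
    (g := (LinearMap.mulLeft ℂ (a : P)).rTensor P ∘ₗ leftSplitting δ ℓ)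
    (hδ.hom_ext fun k x hx => ?_) x
  have : δ (a * x) = (a * x) ⊗ₜ LaurentPolynomial.T k := by
    rw [map_mul, hx, mem_coinvariants_iff.1 a.2, Algebra.TensorProduct.tmul_mul_tmul, one_mul]
  simp only [LinearMap.comp_apply, LinearMap.mulLeft_apply]
  rw [leftSplitting_homogeneous this, leftSplitting_homogeneous hx, LinearMap.mulLeft_mul,
    LinearMap.rTensor_comp, LinearMap.comp_apply]

lemma rightSplitting_mul (hδ : IsComoduleAlgebra δ) (a : coinvariants δ) (x : P) :
    rightSplitting δ ℓ (x * a) =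
      (LinearMap.mulRight ℂ (a : P)).lTensor P (rightSplitting δ ℓ x) := by
  refine LinearMap.congr_fun (f := rightSplitting δ ℓ ∘ₗ LinearMap.mulRight ℂ (a : P))
    (g := (LinearMap.mulRight ℂ (a : P)).lTensor P ∘ₗ rightSplitting δ ℓ)
    (hδ.hom_ext fun k x hx => ?_) x
  have : δ (x * a) = (x * a) ⊗ₜ LaurentPolynomial.T k := by
    rw [map_mul, hx, mem_coinvariants_iff.1 a.2, Algebra.TensorProduct.tmul_mul_tmul, mul_one]
  simp only [LinearMap.comp_apply, LinearMap.mulRight_apply]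
  rw [rightSplitting_homogeneous this, rightSplitting_homogeneous hx, LinearMap.mulRight_mul,
    LinearMap.lTensor_comp, LinearMap.comp_apply]

lemma mul_leftSplitting (hδ : IsComoduleAlgebra δ)
    (h : IsPrincipalEllMap laurent_antipode_bijective δ ℓ) (x : P) :
    LinearMap.mul' ℂ P (leftSplitting δ ℓ x) = x := by
  refine LinearMap.congr_fun (f := LinearMap.mul' ℂ P ∘ₗ leftSplitting δ ℓ)
    (g := LinearMap.id) (hδ.hom_ext fun k x hx => ?_) x
  rw [LinearMap.comp_apply, leftSplitting_homogeneous hx, mul_rTensor_mulLeft, h.mul_T, mul_one,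
    LinearMap.id_apply]

lemma mul_rightSplitting (hδ : IsComoduleAlgebra δ)
    (h : IsPrincipalEllMap laurent_antipode_bijective δ ℓ) (x : P) :
    LinearMap.mul' ℂ P (rightSplitting δ ℓ x) = x := by
  refine LinearMap.congr_fun (f := LinearMap.mul' ℂ P ∘ₗ rightSplitting δ ℓ)
    (g := LinearMap.id) (hδ.hom_ext fun k x hx => ?_) x
  rw [LinearMap.comp_apply, rightSplitting_homogeneous hx, mul_lTensor_mulRight, h.mul_T, one_mul,
    LinearMap.id_apply]

/-- The projection onto the coinvariants, with values in the whole algebra. -/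
noncomputable def degreeZero (δ : P →ₐ[ℂ] P ⊗[ℂ] ℂ[T;T⁻¹]) : P →ₗ[ℂ] P :=
  slice 0 ∘ₗ δ.toLinearMap

/-- The splitting lands in M ⊗ P: for x of degree k the left leg of x ℓ(t^k) has degree k + (-k) =
0. -/
lemma degreeZero_leftSplitting (hδ : IsComoduleAlgebra δ)
    (h : IsPrincipalEllMap laurent_antipode_bijective δ ℓ) (x : P) :
    (degreeZero δ).rTensor P (leftSplitting δ ℓ x) = leftSplitting δ ℓ x := by
  refine LinearMap.congr_fun (f := (degreeZero δ).rTensor P ∘ₗ leftSplitting δ ℓ)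
    (g := leftSplitting δ ℓ) (hδ.hom_ext fun k x hx => ?_) x
  rw [LinearMap.comp_apply, leftSplitting_homogeneous hx]
  conv_rhs => rw [← h.left_T k, ← LinearMap.comp_apply, ← LinearMap.rTensor_comp]
  rw [← LinearMap.comp_apply, ← LinearMap.rTensor_comp]
  refine LinearMap.congr_fun (congrArg _ (LinearMap.ext fun y => ?_)) _
  have := slice_mul_T_left x (-k) k (δ y)
  rw [add_neg_cancel] at this
  simpa [degreeZero, hx] using this

/-- For x of degree k the right leg of ℓ(t^{-k}) x has degree -k + k = 0, so this splitting lands in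
P ⊗ M. -/
lemma degreeZero_rightSplitting (hδ : IsComoduleAlgebra δ)
    (h : IsPrincipalEllMap laurent_antipode_bijective δ ℓ) (x : P) :
    (degreeZero δ).lTensor P (rightSplitting δ ℓ x) = rightSplitting δ ℓ x := by
  refine LinearMap.congr_fun (f := (degreeZero δ).lTensor P ∘ₗ rightSplitting δ ℓ)
    (g := rightSplitting δ ℓ) (hδ.hom_ext fun k x hx => ?_) x
  rw [LinearMap.comp_apply, rightSplitting_homogeneous hx]
  conv_rhs => rw [← h.right_slice_T (-k), ← LinearMap.comp_apply, ← LinearMap.lTensor_comp]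
  rw [← LinearMap.comp_apply, ← LinearMap.lTensor_comp]
  refine LinearMap.congr_fun (congrArg _ (LinearMap.ext fun y => ?_)) _
  have := slice_mul_T_right x (-k) k (δ y)
  rw [neg_add_cancel] at this
  simpa [degreeZero, hx] using this

end splitting

/-! ### Bijectivity of the canonical map. -/

section hopfGalois

universe u

variable {P : Type u} [Ring P] [Algebra ℂ P] {δ : P →ₐ[ℂ] P ⊗[ℂ] ℂ[T;T⁻¹]}
  {ℓ : ℂ[T;T⁻¹] →ₗ[ℂ] P ⊗[ℂ] P}

lemma mk_rightRel (M : Subalgebra ℂ P) {N : Type*} [AddCommGroup N] [Module ℂ N] [Module M N]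
    (p : P) (a : M) (y : N) : (rightRel M N).mkQ ((p * a) ⊗ₜ y) =
      (rightRel M N).mkQ (p ⊗ₜ (a • y)) := by
  rw [← sub_eq_zero, ← map_sub, Submodule.mkQ_apply, Submodule.Quotient.mk_eq_zero]
  exact Submodule.subset_span ⟨p, a, y, rfl⟩

lemma mk_leftRel (M : Subalgebra ℂ P) {N : Type*} [AddCommGroup N] [Module ℂ N] [Module Mᵐᵒᵖ N]
    (y : N) (a : M) (p : P) : (leftRel M N).mkQ ((MulOpposite.op a • y) ⊗ₜ p) =
      (leftRel M N).mkQ (y ⊗ₜ ((a : P) * p)) := by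
  rw [← sub_eq_zero, ← map_sub, Submodule.mkQ_apply, Submodule.Quotient.mk_eq_zero]
  exact Submodule.subset_span ⟨y, a, p, rfl⟩

/-- An element of `M ⊗ P` acts on `P ⊗_M P` through the multiplication. -/
lemma mk_mulLeft_degreeZero (hδ : IsComoduleAlgebra δ) (p : P) (w : P ⊗[ℂ] P) :
    (rightRel (coinvariants δ) P).mkQ
        ((LinearMap.mulLeft ℂ p).rTensor P ((degreeZero δ).rTensor P w)) =
      (rightRel (coinvariants δ) P).mkQ
        (p ⊗ₜ LinearMap.mul' ℂ P ((degreeZero δ).rTensor P w)) := by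
  induction w with
  | zero => simp
  | add x y hx hy => simp only [map_add, TensorProduct.tmul_add, hx, hy]
  | tmul x y =>
    simp only [LinearMap.rTensor_tmul, LinearMap.mulLeft_apply, LinearMap.mul'_apply]
    exact mk_rightRel _ p (coinvProj hδ x) y

/-- The inverse of the canonical map. -/
noncomputable def canInv (δ : P →ₐ[ℂ] P ⊗[ℂ] ℂ[T;T⁻¹]) (ℓ : ℂ[T;T⁻¹] →ₗ[ℂ] P ⊗[ℂ] P) :
    P ⊗[ℂ] ℂ[T;T⁻¹] →ₗ[ℂ] (P ⊗[ℂ] P) ⧸ rightRel (coinvariants δ) P :=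
  (rightRel (coinvariants δ) P).mkQ ∘ₗ (LinearMap.mul' ℂ P).rTensor P ∘ₗ
    (TensorProduct.assoc ℂ P P P).symm.toLinearMap ∘ₗ ℓ.lTensor P

lemma canInv_tmul (p : P) (h : ℂ[T;T⁻¹]) : canInv δ ℓ (p ⊗ₜ h) =
    (rightRel (coinvariants δ) P).mkQ ((LinearMap.mulLeft ℂ p).rTensor P (ℓ h)) := by
  simp only [canInv, LinearMap.comp_apply, LinearMap.lTensor_tmul, LinearEquiv.coe_coe,
    mul_rTensor_assoc_symm]

lemma canInv_mul (p : P) (w : P ⊗[ℂ] ℂ[T;T⁻¹]) : canInv δ ℓ ((p ⊗ₜ 1) * w) =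
    (rightRel (coinvariants δ) P).mkQ ((LinearMap.mulLeft ℂ p).rTensor P
      ((LinearMap.mul' ℂ P).rTensor P ((TensorProduct.assoc ℂ P P P).symm (ℓ.lTensor P w)))) := by
  induction w with
  | zero => simp
  | add x y hx hy => simp only [mul_add, map_add, hx, hy]
  | tmul x y =>
    rw [Algebra.TensorProduct.tmul_mul_tmul, one_mul, canInv_tmul, LinearMap.lTensor_tmul,
      mul_rTensor_assoc_symm, LinearMap.mulLeft_mul, LinearMap.rTensor_comp, LinearMap.comp_apply]

lemma liftedCan_mulLeft (p : P) (w : P ⊗[ℂ] P) :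
    liftedCan δ ((LinearMap.mulLeft ℂ p).rTensor P w) = (p ⊗ₜ 1) * liftedCan δ w := by
  induction w with
  | zero => simp
  | add x y hx hy => simp only [map_add, hx, hy, mul_add]
  | tmul x y =>
    rw [LinearMap.rTensor_tmul, LinearMap.mulLeft_apply, liftedCan_tmul, liftedCan_tmul,
      ← mul_assoc, Algebra.TensorProduct.tmul_mul_tmul, one_mul]

/-- The right leg has degree k, so t^k splits off, and the two legs then multiply to 1. By left
P-linearity this settles one composite of `can` and `canInv`. -/
lemma liftedCan_T (h : IsPrincipalEllMap laurent_antipode_bijective δ ℓ) (k : ℤ) :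
    liftedCan δ (ℓ (LaurentPolynomial.T k)) = 1 ⊗ₜ LaurentPolynomial.T k := by
  simp only [liftedCan, LinearMap.comp_apply, LinearEquiv.coe_coe]
  rw [h.right_T, LinearEquiv.symm_apply_apply, LinearMap.rTensor_tmul, h.mul_T]

/-- A comodule algebra with a principal `ℓ`-map is a Hopf–Galois extension. -/
lemma can_bijective (hδ : IsComoduleAlgebra δ)
    (h : IsPrincipalEllMap laurent_antipode_bijective δ ℓ) : Function.Bijective (can δ) := by
  refine Function.bijective_iff_has_inverse.2 ⟨canInv δ ℓ, fun x => ?_, fun w => ?_⟩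
  · obtain ⟨x, rfl⟩ := Submodule.mkQ_surjective _ x
    induction x with
    | zero => simp
    | add x y hx hy => simp only [map_add, hx, hy]
    | tmul p p' =>
      have h1 : can δ ((rightRel (coinvariants δ) P).mkQ (p ⊗ₜ p')) = (p ⊗ₜ 1) * δ p' :=
        liftedCan_tmul δ p p'
      rw [h1, canInv_mul]
      -- The candidate inverse sends (p ⊗ 1) δ(p') to the class of p times the splitting of p'. The
      -- left leg of that splitting lies in M, so it crosses the tensor sign and multiplies back to
      -- p'.
      change (rightRel (coinvariants δ) P).mkQ
        ((LinearMap.mulLeft ℂ p).rTensor P (leftSplitting δ ℓ p')) = _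
      rw [← degreeZero_leftSplitting hδ h, mk_mulLeft_degreeZero hδ,
        degreeZero_leftSplitting hδ h, mul_leftSplitting hδ h]
  · obtain ⟨v, rfl⟩ := exists_eq_sum_tmul_T w
    simp only [Finsupp.sum, map_sum]
    refine Finset.sum_congr rfl fun k _ => ?_
    rw [canInv_tmul]
    change liftedCan δ _ = _
    rw [liftedCan_mulLeft, liftedCan_T h, Algebra.TensorProduct.tmul_mul_tmul, mul_one, one_mul]

end hopfGalois

/-! ### Faithful flatness -/

/-- A natural retract of an exact pair of maps is exact. -/
lemma exact_of_retract {A₁ A₂ A₃ B₁ B₂ B₃ : Type*} [AddCommGroup A₁] [AddCommGroup A₂]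
    [AddCommGroup A₃] [AddCommGroup B₁] [AddCommGroup B₂] [AddCommGroup B₃]
    {f : A₁ → A₂} {g : A₂ → A₃} {f' : B₁ → B₂} {g' : B₂ → B₃}
    (i₁ : A₁ → B₁) (i₂ : A₂ → B₂) (i₃ : A₃ → B₃) (p₁ : B₁ → A₁) (p₂ : B₂ → A₂) (p₃ : B₃ → A₃)
    (hi : ∀ x, i₂ (f x) = f' (i₁ x)) (hi' : ∀ x, i₃ (g x) = g' (i₂ x))
    (hp : ∀ x, p₂ (f' x) = f (p₁ x)) (h₂ : ∀ x, p₂ (i₂ x) = x) (h₃ : ∀ x, p₃ (i₃ x) = x)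
    (i0 : i₃ 0 = 0) (p0 : p₃ 0 = 0) (h : Function.Exact f' g') : Function.Exact f g := by
  intro y
  constructor
  · intro hy
    -- An element of the kernel of g is carried into the kernel of g', lifted along f', and the lift
    -- is retracted.
    obtain ⟨w, hw⟩ := (h (i₂ y)).1 (by rw [← hi', hy, i0])
    exact ⟨p₁ w, by rw [← hp, hw, h₂]⟩
  · rintro ⟨x, rfl⟩
    rw [← h₃ (g (f x)), hi', hi, (h _).2 ⟨_, rfl⟩, p0]

section flat

universe u

variable {P : Type u} [Ring P] [Algebra ℂ P] {δ : P →ₐ[ℂ] P ⊗[ℂ] ℂ[T;T⁻¹]}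
  {ℓ : ℂ[T;T⁻¹] →ₗ[ℂ] P ⊗[ℂ] P}

section right

variable {N N' : Type u} [AddCommGroup N] [Module ℂ N] [Module (coinvariants δ) N]
  [IsScalarTower ℂ (coinvariants δ) N] [AddCommGroup N'] [Module ℂ N']
  [Module (coinvariants δ) N'] [IsScalarTower ℂ (coinvariants δ) N']

/-- The map `P ⊗ N → N` given by projection to the coinvariants. -/
noncomputable def rightAct (hδ : IsComoduleAlgebra δ) (N : Type u) [AddCommGroup N] [Module ℂ N]
    [Module (coinvariants δ) N] [IsScalarTower ℂ (coinvariants δ) N] : P ⊗[ℂ] N →ₗ[ℂ] N :=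
  TensorProduct.lift (LinearMap.mk₂ ℂ (fun p y => coinvProj hδ p • y)
    (fun p p' y => by rw [map_add, add_smul]) (fun c p y => by rw [map_smul, smul_assoc])
    (fun p y y' => smul_add _ _ _) (fun c p y => by
      -- Complex scalars act through central elements of M, hence commute with the action of the
      -- projected element.
      rw [← algebraMap_smul (coinvariants δ) c y, ← algebraMap_smul (coinvariants δ) c (_ • y),
        smul_smul, smul_smul, Algebra.commutes]))

lemma rightAct_tmul (hδ : IsComoduleAlgebra δ) (p : P) (y : N) :
    rightAct hδ N (p ⊗ₜ y) = coinvProj hδ p • y := rfl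

/-- The retraction of `P ⊗_M N` onto `N`. -/
noncomputable def rightRetr (hδ : IsComoduleAlgebra δ) (N : Type u) [AddCommGroup N] [Module ℂ N]
    [Module (coinvariants δ) N] [IsScalarTower ℂ (coinvariants δ) N] :
    ((P ⊗[ℂ] N) ⧸ rightRel (coinvariants δ) N) →ₗ[ℂ] N :=
  Submodule.liftQ _ (rightAct hδ N) (by
    rw [rightRel, Submodule.span_le]
    rintro _ ⟨p, a, y, rfl⟩
    simp [rightAct_tmul, coinvProj_mul_right, mul_smul])

/-- The embedding of `P ⊗_M N` into `P ⊗ N`. -/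
noncomputable def rightEmbed (hδ : IsComoduleAlgebra δ) (ℓ : ℂ[T;T⁻¹] →ₗ[ℂ] P ⊗[ℂ] P)
    (N : Type u) [AddCommGroup N] [Module ℂ N]
    [Module (coinvariants δ) N] [IsScalarTower ℂ (coinvariants δ) N] :
    ((P ⊗[ℂ] N) ⧸ rightRel (coinvariants δ) N) →ₗ[ℂ] P ⊗[ℂ] N :=
  Submodule.liftQ _ ((rightAct hδ N).lTensor P ∘ₗ (TensorProduct.assoc ℂ P P N).toLinearMap ∘ₗ
    (rightSplitting δ ℓ).rTensor N) (by
    rw [rightRel, Submodule.span_le]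
    rintro _ ⟨p, a, y, rfl⟩
    simp only [SetLike.mem_coe, LinearMap.mem_ker, map_sub, LinearMap.comp_apply,
      LinearMap.rTensor_tmul, rightSplitting_mul hδ]
    generalize rightSplitting δ ℓ p = w
    rw [sub_eq_zero]
    induction w with
    | zero => simp
    | add x y hx hy => simp only [map_add, TensorProduct.add_tmul, hx, hy]
    | tmul x y => simp [rightAct_tmul, coinvProj_mul_right, mul_smul])

/-- Projection from P ⊗ N undoes the embedding: the second leg of the splitting of p lies in M and
was moved into N; modulo the relations it can be moved back, where the splitting multiplies to p. -/
lemma mkQ_rightEmbed (hδ : IsComoduleAlgebra δ)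
    (h : IsPrincipalEllMap laurent_antipode_bijective δ ℓ)
    (x : (P ⊗[ℂ] N) ⧸ rightRel (coinvariants δ) N) :
    (rightRel (coinvariants δ) N).mkQ (rightEmbed hδ ℓ N x) = x := by
  obtain ⟨x, rfl⟩ := Submodule.mkQ_surjective _ x
  induction x with
  | zero => simp
  | add x y hx hy => simp only [map_add, hx, hy]
  | tmul p y =>
    have key : ∀ w : P ⊗[ℂ] P, (rightRel (coinvariants δ) N).mkQ
        ((rightAct hδ N).lTensor P (TensorProduct.assoc ℂ P P N (w ⊗ₜ y))) =
        (rightRel (coinvariants δ) N).mkQ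
          (LinearMap.mul' ℂ P ((degreeZero δ).lTensor P w) ⊗ₜ y) := by
      intro w
      induction w with
      | zero => simp
      | add a b ha hb => simp only [map_add, TensorProduct.add_tmul, ha, hb]
      | tmul a b => exact (mk_rightRel _ a (coinvProj hδ b) y).symm
    refine (key (rightSplitting δ ℓ p)).trans ?_
    rw [degreeZero_rightSplitting hδ h, mul_rightSplitting hδ h]

lemma rightEmbed_rightMap (hδ : IsComoduleAlgebra δ) (f : N →ₗ[coinvariants δ] N')
    (x : (P ⊗[ℂ] N) ⧸ rightRel (coinvariants δ) N) :
    rightEmbed hδ ℓ N' (rightMap _ f x) =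
      (f.restrictScalars ℂ).lTensor P (rightEmbed hδ ℓ N x) := by
  obtain ⟨x, rfl⟩ := Submodule.mkQ_surjective _ x
  induction x with
  | zero => simp
  | add x y hx hy => simp only [map_add, hx, hy]
  | tmul p y =>
    change (rightAct hδ N').lTensor P (TensorProduct.assoc ℂ P P N' (rightSplitting δ ℓ p ⊗ₜ f y)) =
      (f.restrictScalars ℂ).lTensor P ((rightAct hδ N).lTensor P
        (TensorProduct.assoc ℂ P P N (rightSplitting δ ℓ p ⊗ₜ y)))
    generalize rightSplitting δ ℓ p = w
    induction w with
    | zero => simp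
    | add a b ha hb => simp only [map_add, TensorProduct.add_tmul, ha, hb]
    | tmul a b => simp [rightAct_tmul]

lemma rightRetr_rightMap (hδ : IsComoduleAlgebra δ) (f : N →ₗ[coinvariants δ] N')
    (x : (P ⊗[ℂ] N) ⧸ rightRel (coinvariants δ) N) :
    rightRetr hδ N' (rightMap _ f x) = f (rightRetr hδ N x) := by
  obtain ⟨x, rfl⟩ := Submodule.mkQ_surjective _ x
  induction x with
  | zero => simp
  | add x y hx hy => simp only [map_add, hx, hy]
  | tmul p y => exact (map_smul f (coinvProj hδ p) y).symm

end right

/-- Flatness: P ⊗_M N is a natural retract of P ⊗ N, and tensoring over the field ℂ is exact.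
Faithfulness: N is a natural retract of P ⊗_M N, through y ↦ 1 ⊗ y and the projection to degree
zero. -/
lemma isRightFaithfullyFlat_coinvariants (hδ : IsComoduleAlgebra δ)
    (h : IsPrincipalEllMap laurent_antipode_bijective δ ℓ) :
    IsRightFaithfullyFlat (coinvariants δ) := by
  intro N₁ N₂ N₃ _ _ _ _ _ _ _ _ _ _ _ _ f g
  constructor
  · intro hfg
    exact exact_of_retract (rightEmbed hδ ℓ N₁) (rightEmbed hδ ℓ N₂) (rightEmbed hδ ℓ N₃)
      (rightRel (coinvariants δ) N₁).mkQ (rightRel (coinvariants δ) N₂).mkQ (rightRel (coinvariants δ) N₃).mkQ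
      (rightEmbed_rightMap hδ f) (rightEmbed_rightMap hδ g) (fun _ => rfl)
      (mkQ_rightEmbed hδ h) (mkQ_rightEmbed hδ h) (map_zero _) (map_zero _)
      (Module.Flat.lTensor_exact P (f := f.restrictScalars ℂ) (g := g.restrictScalars ℂ) hfg)
  · intro hfg
    have hs : ∀ (N : Type u) [AddCommGroup N] [Module ℂ N] [Module (coinvariants δ) N]
        [IsScalarTower ℂ (coinvariants δ) N] (y : N),
        rightRetr hδ N ((rightRel (coinvariants δ) N).mkQ (1 ⊗ₜ y)) = y := by
      intro N _ _ _ _ y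
      change coinvProj hδ 1 • y = y
      rw [coinvProj_one, one_smul]
    exact exact_of_retract (fun y => (rightRel (coinvariants δ) N₁).mkQ (1 ⊗ₜ y))
      (fun y => (rightRel (coinvariants δ) N₂).mkQ (1 ⊗ₜ y)) (fun y => (rightRel (coinvariants δ) N₃).mkQ (1 ⊗ₜ y))
      (rightRetr hδ N₁) (rightRetr hδ N₂) (rightRetr hδ N₃) (fun _ => rfl) (fun _ => rfl)
      (rightRetr_rightMap hδ f) (hs N₂) (hs N₃) (by simp) (map_zero _) hfg

section left

variable {N N' : Type u} [AddCommGroup N] [Module ℂ N] [Module (coinvariants δ)ᵐᵒᵖ N]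
  [IsScalarTower ℂ (coinvariants δ)ᵐᵒᵖ N] [AddCommGroup N'] [Module ℂ N']
  [Module (coinvariants δ)ᵐᵒᵖ N'] [IsScalarTower ℂ (coinvariants δ)ᵐᵒᵖ N']

/-- The map `N ⊗ P → N` given by projection to the coinvariants. -/
noncomputable def leftAct (hδ : IsComoduleAlgebra δ) (N : Type u) [AddCommGroup N] [Module ℂ N]
    [Module (coinvariants δ)ᵐᵒᵖ N] [IsScalarTower ℂ (coinvariants δ)ᵐᵒᵖ N] :
    N ⊗[ℂ] P →ₗ[ℂ] N :=
  TensorProduct.lift (LinearMap.mk₂ ℂ (fun y p => MulOpposite.op (coinvProj hδ p) • y)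
    (fun y y' p => smul_add _ _ _) (fun c y p => by
      rw [← algebraMap_smul (coinvariants δ)ᵐᵒᵖ c y,
        ← algebraMap_smul (coinvariants δ)ᵐᵒᵖ c (_ • y), smul_smul, smul_smul, Algebra.commutes])
    (fun y p p' => by rw [map_add, MulOpposite.op_add, add_smul])
    (fun c y p => by rw [map_smul, MulOpposite.op_smul, smul_assoc]))

lemma leftAct_tmul (hδ : IsComoduleAlgebra δ) (y : N) (p : P) :
    leftAct hδ N (y ⊗ₜ p) = MulOpposite.op (coinvProj hδ p) • y := rfl

/-- The retraction of `N ⊗_M P` onto `N`. -/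
noncomputable def leftRetr (hδ : IsComoduleAlgebra δ) (N : Type u) [AddCommGroup N] [Module ℂ N]
    [Module (coinvariants δ)ᵐᵒᵖ N] [IsScalarTower ℂ (coinvariants δ)ᵐᵒᵖ N] :
    ((N ⊗[ℂ] P) ⧸ leftRel (coinvariants δ) N) →ₗ[ℂ] N :=
  Submodule.liftQ _ (leftAct hδ N) (by
    rw [leftRel, Submodule.span_le]
    rintro _ ⟨y, a, p, rfl⟩
    simp [leftAct_tmul, coinvProj_mul_left, mul_smul])

/-- The embedding of `N ⊗_M P` into `N ⊗ P`. -/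
noncomputable def leftEmbed (hδ : IsComoduleAlgebra δ) (ℓ : ℂ[T;T⁻¹] →ₗ[ℂ] P ⊗[ℂ] P)
    (N : Type u) [AddCommGroup N] [Module ℂ N]
    [Module (coinvariants δ)ᵐᵒᵖ N] [IsScalarTower ℂ (coinvariants δ)ᵐᵒᵖ N] :
    ((N ⊗[ℂ] P) ⧸ leftRel (coinvariants δ) N) →ₗ[ℂ] N ⊗[ℂ] P :=
  Submodule.liftQ _ ((leftAct hδ N).rTensor P ∘ₗ (TensorProduct.assoc ℂ N P P).symm.toLinearMap ∘ₗ
    (leftSplitting δ ℓ).lTensor N) (by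
    rw [leftRel, Submodule.span_le]
    rintro _ ⟨y, a, p, rfl⟩
    simp only [SetLike.mem_coe, LinearMap.mem_ker, map_sub, LinearMap.comp_apply,
      LinearMap.lTensor_tmul, leftSplitting_mul hδ]
    generalize leftSplitting δ ℓ p = w
    rw [sub_eq_zero]
    induction w with
    | zero => simp
    | add x y hx hy => simp only [map_add, TensorProduct.tmul_add, hx, hy]
    | tmul x y => simp [leftAct_tmul, coinvProj_mul_left, mul_smul])

/-- Mirror image of `mkQ_rightEmbed`: now the first leg of `leftSplitting` lies in M and is moved
back across the tensor sign. -/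
lemma mkQ_leftEmbed (hδ : IsComoduleAlgebra δ)
    (h : IsPrincipalEllMap laurent_antipode_bijective δ ℓ)
    (x : (N ⊗[ℂ] P) ⧸ leftRel (coinvariants δ) N) :
    (leftRel (coinvariants δ) N).mkQ (leftEmbed hδ ℓ N x) = x := by
  obtain ⟨x, rfl⟩ := Submodule.mkQ_surjective _ x
  induction x with
  | zero => simp
  | add x y hx hy => simp only [map_add, hx, hy]
  | tmul y p =>
    have key : ∀ w : P ⊗[ℂ] P, (leftRel (coinvariants δ) N).mkQ
        ((leftAct hδ N).rTensor P ((TensorProduct.assoc ℂ N P P).symm (y ⊗ₜ w))) =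
        (leftRel (coinvariants δ) N).mkQ
          (y ⊗ₜ LinearMap.mul' ℂ P ((degreeZero δ).rTensor P w)) := by
      intro w
      induction w with
      | zero => simp
      | add a b ha hb => simp only [map_add, TensorProduct.tmul_add, ha, hb]
      | tmul a b => exact mk_leftRel _ y (coinvProj hδ a) b
    refine (key (leftSplitting δ ℓ p)).trans ?_
    rw [degreeZero_leftSplitting hδ h, mul_leftSplitting hδ h]

lemma leftEmbed_leftMap (hδ : IsComoduleAlgebra δ) (f : N →ₗ[(coinvariants δ)ᵐᵒᵖ] N')
    (x : (N ⊗[ℂ] P) ⧸ leftRel (coinvariants δ) N) :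
    leftEmbed hδ ℓ N' (leftMap _ f x) =
      (f.restrictScalars ℂ).rTensor P (leftEmbed hδ ℓ N x) := by
  obtain ⟨x, rfl⟩ := Submodule.mkQ_surjective _ x
  induction x with
  | zero => simp
  | add x y hx hy => simp only [map_add, hx, hy]
  | tmul y p =>
    change (leftAct hδ N').rTensor P ((TensorProduct.assoc ℂ N' P P).symm
        (f y ⊗ₜ leftSplitting δ ℓ p)) =
      (f.restrictScalars ℂ).rTensor P ((leftAct hδ N).rTensor P
        ((TensorProduct.assoc ℂ N P P).symm (y ⊗ₜ leftSplitting δ ℓ p)))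
    generalize leftSplitting δ ℓ p = w
    induction w with
    | zero => simp
    | add a b ha hb => simp only [map_add, TensorProduct.tmul_add, ha, hb]
    | tmul a b => simp [leftAct_tmul]

lemma leftRetr_leftMap (hδ : IsComoduleAlgebra δ) (f : N →ₗ[(coinvariants δ)ᵐᵒᵖ] N')
    (x : (N ⊗[ℂ] P) ⧸ leftRel (coinvariants δ) N) :
    leftRetr hδ N' (leftMap _ f x) = f (leftRetr hδ N x) := by
  obtain ⟨x, rfl⟩ := Submodule.mkQ_surjective _ x
  induction x with
  | zero => simp
  | add x y hx hy => simp only [map_add, hx, hy]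
  | tmul y p => exact (map_smul f (MulOpposite.op (coinvProj hδ p)) y).symm

end left

lemma isLeftFaithfullyFlat_coinvariants (hδ : IsComoduleAlgebra δ)
    (h : IsPrincipalEllMap laurent_antipode_bijective δ ℓ) :
    IsLeftFaithfullyFlat (coinvariants δ) := by
  intro N₁ N₂ N₃ _ _ _ _ _ _ _ _ _ _ _ _ f g
  constructor
  · intro hfg
    exact exact_of_retract (leftEmbed hδ ℓ N₁) (leftEmbed hδ ℓ N₂) (leftEmbed hδ ℓ N₃)
      (leftRel (coinvariants δ) N₁).mkQ (leftRel (coinvariants δ) N₂).mkQ (leftRel (coinvariants δ) N₃).mkQ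
      (leftEmbed_leftMap hδ f) (leftEmbed_leftMap hδ g) (fun _ => rfl)
      (mkQ_leftEmbed hδ h) (mkQ_leftEmbed hδ h) (map_zero _) (map_zero _)
      (Module.Flat.rTensor_exact P (f := f.restrictScalars ℂ) (g := g.restrictScalars ℂ) hfg)
  · intro hfg
    have hs : ∀ (N : Type u) [AddCommGroup N] [Module ℂ N] [Module (coinvariants δ)ᵐᵒᵖ N]
        [IsScalarTower ℂ (coinvariants δ)ᵐᵒᵖ N] (y : N),
        leftRetr hδ N ((leftRel (coinvariants δ) N).mkQ (y ⊗ₜ 1)) = y := by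
      intro N _ _ _ _ y
      change MulOpposite.op (coinvProj hδ 1) • y = y
      rw [coinvProj_one, MulOpposite.op_one, one_smul]
    exact exact_of_retract (fun y => (leftRel (coinvariants δ) N₁).mkQ (y ⊗ₜ 1))
      (fun y => (leftRel (coinvariants δ) N₂).mkQ (y ⊗ₜ 1)) (fun y => (leftRel (coinvariants δ) N₃).mkQ (y ⊗ₜ 1))
      (leftRetr hδ N₁) (leftRetr hδ N₂) (leftRetr hδ N₃) (fun _ => rfl) (fun _ => rfl)
      (leftRetr_leftMap hδ f) (hs N₂) (hs N₃) (by simp) (map_zero _) hfg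

/-- A `ℂ[U_1]`-comodule algebra with a principal `ℓ`-map is principal. -/
lemma IsPrincipalEllMap.isPrincipal (h : IsPrincipalEllMap laurent_antipode_bijective δ ℓ)
    (hδ : IsComoduleAlgebra δ) : IsPrincipal δ :=
  ⟨hδ, can_bijective hδ h, isRightFaithfullyFlat_coinvariants hδ h,
    isLeftFaithfullyFlat_coinvariants hδ h⟩

end flat

/-! ### Torus actions -/

section scale

variable {q : ℂ} {n : ℕ} {B : Type*} [Ring B] [Algebra ℂ B]

/-- Each defining relation is homogeneous: all its products involve the same two rows and the same
two columns, so row and column weights contribute one common power of t. -/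
lemma IsQMatrix.scale {T : Fin n → Fin n → B} (hT : IsQMatrix q T) (w w' : Fin n → ℤ) :
    IsQMatrix q fun i j => T i j ⊗ₜ[ℂ] (LaurentPolynomial.T (w i + w' j) : ℂ[T;T⁻¹]) where
  col i j k h := by
    simp only [Algebra.TensorProduct.tmul_mul_tmul, ← LaurentPolynomial.T_add, hT.col i j k h,
      TensorProduct.smul_tmul', add_comm]
  row i j k h := by
    simp only [Algebra.TensorProduct.tmul_mul_tmul, ← LaurentPolynomial.T_add, hT.row i j k h,
      TensorProduct.smul_tmul', add_comm]
  comm i j k l h h' := by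
    simp only [Algebra.TensorProduct.tmul_mul_tmul, ← LaurentPolynomial.T_add, hT.comm i j k l h h',
      add_comm]
  cross i j k l h h' := by
    simp only [Algebra.TensorProduct.tmul_mul_tmul, ← LaurentPolynomial.T_add,
      hT.cross i j k l h h', TensorProduct.smul_tmul', TensorProduct.add_tmul]
    congr 3 <;> ring

lemma prod_ofFn_tmul_T (a : Fin n → B) (f : Fin n → ℤ) :
    (List.ofFn fun i => a i ⊗ₜ[ℂ] (LaurentPolynomial.T (f i) : ℂ[T;T⁻¹])).prod =
      (List.ofFn a).prod ⊗ₜ LaurentPolynomial.T (∑ i, f i) := by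
  induction n with
  | zero => simp [Algebra.TensorProduct.one_def]
  | succ n ih =>
    simp only [List.ofFn_succ, List.prod_cons, ih, Algebra.TensorProduct.tmul_mul_tmul,
      ← LaurentPolynomial.T_add, Fin.sum_univ_succ]

/-- Every monomial of the determinant meets each row and each column exactly once, so all monomials
have the same weight. -/
lemma qdet_scale (T : Fin n → Fin n → B) (w w' : Fin n → ℤ) :
    qdet q (fun i j => T i j ⊗ₜ[ℂ] (LaurentPolynomial.T (w i + w' j) : ℂ[T;T⁻¹])) =
      qdet q T ⊗ₜ LaurentPolynomial.T (∑ i, w i + ∑ i, w' i) := by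
  simp only [qdet, prod_ofFn_tmul_T, Finset.sum_add_distrib, TensorProduct.sum_tmul,
    TensorProduct.smul_tmul']
  refine Finset.sum_congr rfl fun σ _ => ?_
  rw [Equiv.sum_comp σ w']

lemma prod_ofFn_T (f : Fin n → ℤ) :
    (List.ofFn fun i => (LaurentPolynomial.T (f i) : ℂ[T;T⁻¹])).prod =
      LaurentPolynomial.T (∑ i, f i) := by
  induction n with
  | zero => simp
  | succ n ih =>
    simp only [List.ofFn_succ, List.prod_cons, ih, ← LaurentPolynomial.T_add, Fin.sum_univ_succ]

end scale

lemma units_zpow_eq_T {t : ℂ[T;T⁻¹]ˣ} (ht : (t : ℂ[T;T⁻¹]) = LaurentPolynomial.T 1) (k : ℤ) :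
    ((t ^ k : ℂ[T;T⁻¹]ˣ) : ℂ[T;T⁻¹]) = LaurentPolynomial.T k := by
  have hinv : ((t⁻¹ : ℂ[T;T⁻¹]ˣ) : ℂ[T;T⁻¹]) = LaurentPolynomial.T (-1) :=
    Units.inv_eq_of_mul_eq_one_right (by rw [ht, ← LaurentPolynomial.T_add]; simp)
  induction k using Int.induction_on with
  | zero => simp
  | succ i ih => rw [zpow_add_one, Units.val_mul, ih, ht, ← LaurentPolynomial.T_add]
  | pred i ih => rw [zpow_sub_one, Units.val_mul, ih, hinv, ← LaurentPolynomial.T_add]; rfl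

/-- The algebra map `ℂ[t, t⁻¹] → B` sending `t` to a given unit. -/
noncomputable def laurentLift {B : Type*} [Ring B] [Algebra ℂ B] (t : Bˣ) : ℂ[T;T⁻¹] →ₐ[ℂ] B :=
  AddMonoidAlgebra.lift ℂ B ℤ ((Units.coeHom B).comp (zpowersHom Bˣ t))

lemma laurentLift_T {B : Type*} [Ring B] [Algebra ℂ B] (t : Bˣ) (k : ℤ) :
    laurentLift t (LaurentPolynomial.T k) = ((t ^ k : Bˣ) : B) := by
  rw [laurentLift, LaurentPolynomial.T, AddMonoidAlgebra.lift_single, one_smul]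
  simp

/-- The map `(a ⊗ s) ⊗ (b ⊗ t) ↦ (a ⊗ b) ⊗ s t`. -/
noncomputable def mergeLaurent (A B : Type*) [Ring A] [Algebra ℂ A] [Ring B] [Algebra ℂ B] :
    (A ⊗[ℂ] ℂ[T;T⁻¹]) ⊗[ℂ] (B ⊗[ℂ] ℂ[T;T⁻¹]) →ₐ[ℂ] (A ⊗[ℂ] B) ⊗[ℂ] ℂ[T;T⁻¹] :=
  (Algebra.TensorProduct.map (AlgHom.id ℂ _) (Algebra.TensorProduct.lmul' ℂ)).comp
    (Algebra.TensorProduct.tensorTensorTensorComm ℂ ℂ ℂ ℂ A ℂ[T;T⁻¹] B ℂ[T;T⁻¹]).toAlgHom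

lemma mergeLaurent_tmul {A B : Type*} [Ring A] [Algebra ℂ A] [Ring B] [Algebra ℂ B]
    (a : A) (b : B) (s t : ℂ[T;T⁻¹]) :
    mergeLaurent A B ((a ⊗ₜ s) ⊗ₜ (b ⊗ₜ t)) = (a ⊗ₜ b) ⊗ₜ (s * t) := by
  simp [mergeLaurent]

section torus

variable {q : ℝ} {n : ℕ}

/-- The diagonal character `u^i_j ↦ δ_{ij} t^{w i}` of `ℂ_q[SU_n]`. -/
noncomputable def torus (q : ℝ) (w : Fin n → ℤ) (hw : ∑ i, w i = 0) : QSU q n →ₐ[ℂ] ℂ[T;T⁻¹] :=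
  QSU.lift (fun i j => if i = j then LaurentPolynomial.T (w i) else 0)
    (isQMatrix_diag (fun i => LaurentPolynomial.T (w i)) fun _ _ => Commute.all _ _)
    (by rw [qdet_diag (fun i => (LaurentPolynomial.T (w i) : ℂ[T;T⁻¹])), prod_ofFn_T, hw,
      LaurentPolynomial.T_zero])

lemma torus_u (w : Fin n → ℤ) (hw : ∑ i, w i = 0) (i j : Fin n) : torus q w hw (QSU.u q i j) =
    if i = j then LaurentPolynomial.T (w i) else 0 := QSU.lift_u _ _ _ _ _

/-- Conjugation by the torus, `u^i_j ↦ u^i_j ⊗ t^{w j - w i}`. -/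
noncomputable def torusConj (q : ℝ) (w : Fin n → ℤ) : QSU q n →ₐ[ℂ] QSU q n ⊗[ℂ] ℂ[T;T⁻¹] :=
  QSU.lift (fun i j => QSU.u q i j ⊗ₜ LaurentPolynomial.T (-w i + w j))
    (QSU.isQMatrix_u.scale (fun i => -w i) w)
    (by rw [qdet_scale (QSU.u q) (fun i => -w i) w, QSU.qdet_u, Finset.sum_neg_distrib,
      neg_add_cancel]; simp [Algebra.TensorProduct.one_def])

lemma torusConj_u (w : Fin n → ℤ) (i j : Fin n) : torusConj q w (QSU.u q i j) =
    QSU.u q i j ⊗ₜ LaurentPolynomial.T (-w i + w j) := QSU.lift_u _ _ _ _ _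

variable [Fact (0 < q)]

lemma inducedCoaction_u {K : Type*} [Ring K] [Algebra ℂ K] (f : QSU q n →ₐ[ℂ] K) (i j : Fin n) :
    inducedCoaction f (QSU.u q i j) = ∑ k, QSU.u q i k ⊗ₜ f (QSU.u q k j) := by
  simp [inducedCoaction, QSU.comul_u]

/-- The coaction `x ↦ x_(2) ⊗ f(x_(1))`. -/
noncomputable def flipCoaction {G K : Type*} [Ring G] [Bialgebra ℂ G] [Ring K] [Algebra ℂ K]
    (f : G →ₐ[ℂ] K) : G →ₐ[ℂ] G ⊗[ℂ] K :=
  (Algebra.TensorProduct.map (AlgHom.id ℂ G) f).comp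
    ((Algebra.TensorProduct.comm ℂ G G).toAlgHom.comp (Bialgebra.comulAlgHom ℂ G))

lemma flipCoaction_u {K : Type*} [Ring K] [Algebra ℂ K] (f : QSU q n →ₐ[ℂ] K) (i j : Fin n) :
    flipCoaction f (QSU.u q i j) = ∑ k, QSU.u q k j ⊗ₜ f (QSU.u q i k) := by
  simp [flipCoaction, QSU.comul_u]

lemma inducedCoaction_torus_u (w : Fin n → ℤ) (hw : ∑ i, w i = 0) (i j : Fin n) :
    inducedCoaction (torus q w hw) (QSU.u q i j) = QSU.u q i j ⊗ₜ LaurentPolynomial.T (w j) := by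
  rw [inducedCoaction_u]
  simp only [torus_u]
  rw [Finset.sum_eq_single j] <;> simp +contextual

/-- Translation on the left scales rows, where translation on the right scales columns. -/
lemma flipCoaction_torus_u (w : Fin n → ℤ) (hw : ∑ i, w i = 0) (i j : Fin n) :
    flipCoaction (torus q w hw) (QSU.u q i j) = QSU.u q i j ⊗ₜ LaurentPolynomial.T (w i) := by
  rw [flipCoaction_u]
  simp only [torus_u]
  rw [Finset.sum_eq_single i] <;> simp +contextual [eq_comm]

/-- Both axioms compare algebra maps, so generators suffice; there they say that t^{w j} is
grouplike with counit 1. -/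
lemma isComoduleAlgebra_torus (w : Fin n → ℤ) (hw : ∑ i, w i = 0) :
    IsComoduleAlgebra (inducedCoaction (torus q w hw)) where
  coassoc := by
    have : ((Algebra.TensorProduct.assoc ℂ ℂ ℂ (QSU q n) ℂ[T;T⁻¹] ℂ[T;T⁻¹]).toAlgHom.comp
        ((Algebra.TensorProduct.map (inducedCoaction (torus q w hw)) (AlgHom.id ℂ _)).comp
          (inducedCoaction (torus q w hw)))) =
        (Algebra.TensorProduct.map (AlgHom.id ℂ _) (Bialgebra.comulAlgHom ℂ _)).comp
          (inducedCoaction (torus q w hw)) :=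
      QSU.algHom_ext fun i j => by
        simp [inducedCoaction_torus_u, LaurentPolynomial.comul_T]
    exact congrArg AlgHom.toLinearMap this
  counit := by
    have : ((Algebra.TensorProduct.rid ℂ ℂ (QSU q n)).toAlgHom.comp
        ((Algebra.TensorProduct.map (AlgHom.id ℂ _) (Bialgebra.counitAlgHom ℂ _)).comp
          (inducedCoaction (torus q w hw)))) = AlgHom.id ℂ _ :=
      QSU.algHom_ext fun i j => by
        simp [inducedCoaction_torus_u, LaurentPolynomial.counit_T]
    exact congrArg AlgHom.toLinearMap this

end torus

/-! ### The maps σ and π on generators. -/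

section maps

variable (q : ℝ) [Fact (0 < q)] (r m : ℕ) (hm : 0 < m)

/-- The entries of `α_r(u^i_i)` for `i > r`. -/
noncomputable def alphaDiag (i : Fin m) : QU q r := if (i : ℕ) + 1 = m then QU.detInv q r else 1

/-- Both factors of the map are block diagonal, with the identity as tail block of `alpha'` and as
head block of `beta`. So the coproduct sum has no off-diagonal block and keeps a single term within
each diagonal block. -/
lemma sigmaMap_u (i j : Fin (r + m)) : sigmaMap q r m (QSU.u q i j) =
    qblock (fun i j => QSU.u q i j ⊗ₜ[ℂ] (1 : QSU q m)) (fun i j => (1 : QSU q r) ⊗ₜ QSU.u q i j)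
      i j := by
  simp only [sigmaMap, AlgHom.comp_apply, Bialgebra.comulAlgHom_apply, QSU.comul_u, map_sum,
    Algebra.TensorProduct.map_tmul, alpha', beta, QSU.lift_u]
  induction i using Fin.addCases <;> induction j using Fin.addCases <;>
    simp [Fin.sum_univ_add, TensorProduct.tmul_ite, TensorProduct.ite_tmul]

lemma piMap_u (i j : Fin (r + m)) : piMap q r m hm (QSU.u q i j) =
    qblock (fun i j => QU.u q i j ⊗ₜ[ℂ] (1 : QSU q m)) (fun i j => alphaDiag q r m i ⊗ₜ QSU.u q i j)
      i j := by
  simp only [piMap, AlgHom.comp_apply, Bialgebra.comulAlgHom_apply, QSU.comul_u, map_sum,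
    Algebra.TensorProduct.map_tmul, alpha, beta, QSU.lift_u]
  induction i using Fin.addCases <;> induction j using Fin.addCases <;>
    simp [Fin.sum_univ_add, TensorProduct.tmul_ite, TensorProduct.ite_tmul, alphaDiag]

end maps

/-- Over a field, tensoring keeps i injective, so the axioms may be compared inside P, where they
are known. -/
lemma IsComoduleAlgebra.of_injective {P P' H : Type*} [Ring P] [Algebra ℂ P] [Ring P']
    [Algebra ℂ P'] [Ring H] [HopfAlgebra ℂ H] {δ : P →ₐ[ℂ] P ⊗[ℂ] H} (hδ : IsComoduleAlgebra δ)
    {δ' : P' →ₐ[ℂ] P' ⊗[ℂ] H} (i : P' →ₐ[ℂ] P) (hi : Function.Injective i)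
    (h : ∀ x, i.toLinearMap.rTensor H (δ' x) = δ (i x)) : IsComoduleAlgebra δ' where
  coassoc := by
    refine LinearMap.ext fun x => Module.Flat.rTensor_preserves_injective_linearMap
      (M := H ⊗[ℂ] H) i.toLinearMap hi ?_
    have hx := LinearMap.congr_fun hδ.coassoc (i x)
    simp only [LinearMap.comp_apply, AlgHom.toLinearMap_apply, ← h] at hx ⊢
    have h1 : ∀ w : P' ⊗[ℂ] H, i.toLinearMap.rTensor _ (TensorProduct.assoc ℂ _ _ _
        (δ'.toLinearMap.rTensor H w)) = TensorProduct.assoc ℂ _ _ _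
          (δ.toLinearMap.rTensor H (i.toLinearMap.rTensor _ w)) := by
      intro w
      induction w with
      | zero => simp
      | add a b ha hb => simp only [map_add, ha, hb]
      | tmul a t =>
        simp only [LinearMap.rTensor_tmul, AlgHom.toLinearMap_apply, ← h]
        generalize δ' a = w
        induction w with
        | zero => simp
        | add a b ha hb => simp only [map_add, TensorProduct.add_tmul, ha, hb]
        | tmul a t => simp
    have h2 : ∀ w : P' ⊗[ℂ] H, i.toLinearMap.rTensor _
        ((Coalgebra.comul (R := ℂ) (A := H)).lTensor _ w) =
        (Coalgebra.comul (R := ℂ) (A := H)).lTensor _ (i.toLinearMap.rTensor _ w) := by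
      intro w
      rw [← LinearMap.comp_apply, ← LinearMap.comp_apply, LinearMap.rTensor_comp_lTensor,
        LinearMap.lTensor_comp_rTensor]
    exact (h1 _).trans (hx.trans (h2 _).symm)
  counit := by
    refine LinearMap.ext fun x => hi ?_
    have hx := LinearMap.congr_fun hδ.counit (i x)
    simp only [LinearMap.comp_apply, AlgHom.toLinearMap_apply, ← h, LinearMap.id_apply,
      LinearEquiv.coe_coe] at hx ⊢
    refine Eq.trans ?_ hx
    generalize δ' x = w
    induction w with
    | zero => simp
    | add a b ha hb => simp only [map_add, ha, hb]
    | tmul a t => simp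

/-! ### The circle in SU_n and its coaction on the quantum sphere. -/

section circle

variable (q : ℝ) [Fact (0 < q)] (r m : ℕ) (hr : 0 < r) (hm : 0 < m)

/-- The weights of the circle `diag(t, 1, …, 1, t⁻¹)`, on the first block. -/
def headWeight (i : Fin r) : ℤ := if (i : ℕ) = 0 then 1 else 0

/-- The weights of the circle `diag(t, 1, …, 1, t⁻¹)`, on the second block. -/
def tailWeight (i : Fin m) : ℤ := if (i : ℕ) + 1 = m then -1 else 0

/-- The weights of the circle `diag(t, 1, …, 1, t⁻¹)`. -/
def circleWeight (i : Fin (r + m)) : ℤ :=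
  Fin.addCases (motive := fun _ => ℤ) (headWeight r) (tailWeight m) i

@[simp] lemma circleWeight_castAdd (i : Fin r) :
    circleWeight r m (Fin.castAdd m i) = headWeight r i := by simp [circleWeight]

@[simp] lemma circleWeight_natAdd (i : Fin m) :
    circleWeight r m (Fin.natAdd r i) = tailWeight m i := by simp [circleWeight]

variable {r m}

include hr in
-- This sum is the exponent of t in the determinant of the first block, hence the degree of the
-- minors z^I; the tail sum -1 plays the same role for z̄^J.
lemma sum_headWeight : ∑ i, headWeight r i = 1 := by
  obtain ⟨r, rfl⟩ := Nat.exists_eq_succ_of_ne_zero hr.ne'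
  rw [Fin.sum_univ_succ]
  simp [headWeight]

include hm in
lemma sum_tailWeight : ∑ i, tailWeight m i = -1 := by
  obtain ⟨m, rfl⟩ := Nat.exists_eq_succ_of_ne_zero hm.ne'
  have : ∀ i : Fin m, ¬ (i : ℕ) = m := fun i => i.2.ne
  rw [Fin.sum_univ_castSucc]
  simp [tailWeight, this]

include hr hm in
lemma sum_circleWeight : ∑ i, circleWeight r m i = 0 := by
  rw [Fin.sum_univ_add]
  simp [sum_headWeight hr, sum_tailWeight hm]

/-- The circle coaction on `ℂ_q[SU_{r+m}]`. -/
noncomputable def circleCoaction : QSU q (r + m) →ₐ[ℂ] QSU q (r + m) ⊗[ℂ] ℂ[T;T⁻¹] :=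
  inducedCoaction (torus q (circleWeight r m) (sum_circleWeight hr hm))

lemma circleCoaction_u (i j : Fin (r + m)) : circleCoaction q hr hm (QSU.u q i j) =
    QSU.u q i j ⊗ₜ LaurentPolynomial.T (circleWeight r m j) := inducedCoaction_torus_u _ _ _ _

/-- Conjugation by the circle on `ℂ_q[SU_r] ⊗ ℂ_q[SU_m]`. -/
noncomputable def blockConj (r m : ℕ) :
    QSU q r ⊗[ℂ] QSU q m →ₐ[ℂ] (QSU q r ⊗[ℂ] QSU q m) ⊗[ℂ] ℂ[T;T⁻¹] :=
  (mergeLaurent _ _).comp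
    (Algebra.TensorProduct.map (torusConj q (headWeight r)) (torusConj q (tailWeight m)))

/-- Off-diagonal blocks vanish under σ, so a nonzero entry has both its indices, and both weights,
in the same block; there conjugation is computed block by block. -/
lemma blockConj_sigmaMap (i j : Fin (r + m)) :
    blockConj q r m (sigmaMap q r m (QSU.u q i j)) = sigmaMap q r m (QSU.u q i j) ⊗ₜ
      LaurentPolynomial.T (-circleWeight r m i + circleWeight r m j) := by
  rw [sigmaMap_u]
  induction i using Fin.addCases <;> induction j using Fin.addCases <;>
    simp [blockConj, mergeLaurent_tmul, torusConj_u, Algebra.TensorProduct.one_def]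

/-- The circle normalises SU_r × SU_m: the order of the two translations can be exchanged at the
cost of a conjugation. On generators this is w j = w k + (-w k + w j). -/
lemma sigma_circle :
    (Algebra.TensorProduct.map (inducedCoaction (sigmaMap q r m)) (AlgHom.id ℂ ℂ[T;T⁻¹])).comp
      (circleCoaction q hr hm) =
    ((mergeLaurent _ _).comp (Algebra.TensorProduct.map (AlgHom.id ℂ _) (blockConj q r m))).comp
      ((Algebra.TensorProduct.map (circleCoaction q hr hm) (AlgHom.id ℂ _)).comp
        (inducedCoaction (sigmaMap q r m))) :=
  QSU.algHom_ext fun i j => by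
    simp only [AlgHom.comp_apply, circleCoaction_u, Algebra.TensorProduct.map_tmul,
      inducedCoaction_u, map_sum, blockConj_sigmaMap, AlgHom.id_apply, mergeLaurent_tmul,
      ← LaurentPolynomial.T_add, add_neg_cancel_left, TensorProduct.sum_tmul]

lemma mem_quantumSphere_iff {x : QSU q (r + m)} : x ∈ quantumSphere q r m ↔
    inducedCoaction (sigmaMap q r m) x = x ⊗ₜ 1 := Iff.rfl

lemma mem_lineBundle_iff {k : ℤ} {x : QSU q (r + m)} : x ∈ lineBundle q r m hm k ↔
    inducedCoaction (piMap q r m hm) x =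
      x ⊗ₜ (((QU.detUnit q r ^ k : (QU q r)ˣ) : QU q r) ⊗ₜ 1) := Iff.rfl

/-- The kernel form of membership in the quantum sphere. -/
noncomputable def sphereDefect (q : ℝ) [Fact (0 < q)] (r m : ℕ) :
    QSU q (r + m) →ₗ[ℂ] QSU q (r + m) ⊗[ℂ] (QSU q r ⊗[ℂ] QSU q m) :=
  (inducedCoaction (sigmaMap q r m)).toLinearMap -
    (Algebra.TensorProduct.includeLeft :
      QSU q (r + m) →ₐ[ℂ] QSU q (r + m) ⊗[ℂ] (QSU q r ⊗[ℂ] QSU q m)).toLinearMap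

lemma sphereDefect_apply (x : QSU q (r + m)) : sphereDefect q r m x =
    inducedCoaction (sigmaMap q r m) x - x ⊗ₜ 1 := rfl

/-- Presenting P as a kernel lets flatness over ℂ describe P ⊗ V and P ⊗ P inside larger tensor
products. -/
lemma exact_sphereDefect : Function.Exact (quantumSphere q r m).val.toLinearMap
    (sphereDefect q r m) := by
  intro x
  rw [sphereDefect_apply, sub_eq_zero, ← mem_quantumSphere_iff]
  simp

/-- Conjugation fixes 1, so for coinvariant x the right side of `sigma_circle` collapses to the
circle coaction of x with 1 inserted: each coefficient is again coinvariant. -/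
lemma sphereDefect_circleCoaction {x : QSU q (r + m)} (hx : x ∈ quantumSphere q r m) :
    (sphereDefect q r m).rTensor _ (circleCoaction q hr hm x) = 0 := by
  have h := AlgHom.congr_fun (sigma_circle q hr hm) x
  simp only [AlgHom.comp_apply] at h
  rw [(mem_quantumSphere_iff q).1 hx, Algebra.TensorProduct.map_tmul, Algebra.TensorProduct.map_tmul,
    map_one, map_one, AlgHom.id_apply] at h
  have key : (inducedCoaction (sigmaMap q r m)).toLinearMap.rTensor _ (circleCoaction q hr hm x) =
      (Algebra.TensorProduct.includeLeft : QSU q (r + m) →ₐ[ℂ]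
        QSU q (r + m) ⊗[ℂ] (QSU q r ⊗[ℂ] QSU q m)).toLinearMap.rTensor _
          (circleCoaction q hr hm x) := by
    refine (h : _ = _).trans ?_
    generalize circleCoaction q hr hm x = w
    induction w with
    | zero => simp
    | add a b ha hb => simp only [map_add, TensorProduct.add_tmul, ha, hb]
    | tmul a t =>
      simp [Algebra.TensorProduct.one_def (A := QSU q r ⊗[ℂ] QSU q m), mergeLaurent_tmul]
  rw [sphereDefect, LinearMap.rTensor_sub]
  exact sub_eq_zero.2 key

/-- The circle coaction on the quantum sphere. -/
lemma exists_sphereCoaction : ∃ δ : quantumSphere q r m →ₐ[ℂ] quantumSphere q r m ⊗[ℂ] ℂ[T;T⁻¹],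
    ∀ x, (quantumSphere q r m).val.toLinearMap.rTensor _ (δ x) = circleCoaction q hr hm x := by
  set ι := Algebra.TensorProduct.map (quantumSphere q r m).val (AlgHom.id ℂ ℂ[T;T⁻¹]) with hι
  have hinj : Function.Injective ι := Module.Flat.rTensor_preserves_injective_linearMap
    (M := ℂ[T;T⁻¹]) (quantumSphere q r m).val.toLinearMap Subtype.val_injective
  have hrange : ∀ x : quantumSphere q r m, circleCoaction q hr hm x ∈ ι.range := fun x => by
    -- By flatness the kernel of the defect tensored with ℂ[t, t⁻¹] is P ⊗ ℂ[t, t⁻¹].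
    obtain ⟨w, hw⟩ := (Module.Flat.rTensor_exact ℂ[T;T⁻¹] (exact_sphereDefect q) _).1
      (sphereDefect_circleCoaction q hr hm x.2)
    exact ⟨w, hw⟩
  -- Inverting the injective algebra map ι on its range makes the restricted coaction an algebra map
  -- without further checking.
  refine ⟨(AlgEquiv.ofInjective ι hinj).symm.toAlgHom.comp
    (((circleCoaction q hr hm).comp (quantumSphere q r m).val).codRestrict ι.range hrange),
    fun x => ?_⟩
  exact congrArg Subtype.val ((AlgEquiv.ofInjective ι hinj).apply_symm_apply
    ⟨circleCoaction q hr hm x, hrange x⟩)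

/-- The circle coaction on the quantum sphere. -/
noncomputable def sphereCoaction :
    quantumSphere q r m →ₐ[ℂ] quantumSphere q r m ⊗[ℂ] ℂ[T;T⁻¹] :=
  (exists_sphereCoaction q hr hm).choose

lemma val_sphereCoaction (x : quantumSphere q r m) :
    (quantumSphere q r m).val.toLinearMap.rTensor _ (sphereCoaction q hr hm x) =
      circleCoaction q hr hm x :=
  (exists_sphereCoaction q hr hm).choose_spec x

lemma sphere_rTensor_injective (V : Type*) [AddCommGroup V] [Module ℂ V] :
    Function.Injective ((quantumSphere q r m).val.toLinearMap.rTensor V) :=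
  Module.Flat.rTensor_preserves_injective_linearMap _ Subtype.val_injective

lemma sphereCoaction_eq_iff (x : quantumSphere q r m) (k : ℤ) :
    sphereCoaction q hr hm x = x ⊗ₜ LaurentPolynomial.T k ↔
      circleCoaction q hr hm x = (x : QSU q (r + m)) ⊗ₜ LaurentPolynomial.T k := by
  rw [← val_sphereCoaction, ← (sphere_rTensor_injective q ℂ[T;T⁻¹]).eq_iff]
  rfl

lemma isComoduleAlgebra_circleCoaction : IsComoduleAlgebra (circleCoaction q hr hm) :=
  isComoduleAlgebra_torus _ _

lemma isComoduleAlgebra_sphereCoaction : IsComoduleAlgebra (sphereCoaction q hr hm) :=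
  (isComoduleAlgebra_circleCoaction q hr hm).of_injective (quantumSphere q r m).val
    Subtype.val_injective (val_sphereCoaction q hr hm)

end circle

lemma prod_ofFn_zpow {B : Type*} [Ring B] {n : ℕ} (t : Bˣ) (f : Fin n → ℤ) :
    (List.ofFn fun i => ((t ^ f i : Bˣ) : B)).prod = ((t ^ (∑ i, f i) : Bˣ) : B) := by
  induction n with
  | zero => simp
  | succ n ih => simp only [List.ofFn_succ, List.prod_cons, ih, Fin.sum_univ_succ, zpow_add,
      Units.val_mul]

/-! ### The line bundles E_k as the homogeneous parts of the quantum sphere. -/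

section lineBundle

variable (q : ℝ) [hq : Fact (0 < q)] {r m : ℕ} (hr : 0 < r) (hm : 0 < m)

lemma commute_detUnit_zpow (k : ℤ) (i j : Fin r) :
    Commute ((QU.detUnit q r ^ k : (QU q r)ˣ) : QU q r) (QU.u q i j) :=
  Commute.units_zpow_left (show Commute (QU.detUnit q r : QU q r) (QU.u q i j) from
    qdet_comm hq.out QU.isQMatrix_u i j) k

/-- The array of `ℂ_q[U_r]` with unit quantum determinant, got by rescaling the first row. -/
noncomputable def specialArray (q : ℝ) (r : ℕ) (i j : Fin r) : QU q r :=
  ((QU.detUnit q r ^ (-headWeight r i) : (QU q r)ˣ) : QU q r) * QU.u q i j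

omit hq in
-- Written as a product of a diagonal array and the generators, the rescaled array falls under
-- `IsQMatrix.mul` and `qdet_mul`, since powers of det_r commute with the generators.
lemma specialArray_eq : specialArray q r = fun i j => ∑ a,
    (if i = a then ((QU.detUnit q r ^ (-headWeight r i) : (QU q r)ˣ) : QU q r) else 0) *
      QU.u q a j := by
  funext i j
  simp [specialArray]

lemma commute_diag_u (i j k l : Fin r) : Commute
    (if i = j then ((QU.detUnit q r ^ (-headWeight r i) : (QU q r)ˣ) : QU q r) else 0)
    (QU.u q k l) := by
  split_ifs
  · exact commute_detUnit_zpow q _ k l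
  · exact Commute.zero_left _

lemma isQMatrix_specialArray : IsQMatrix (q : ℂ) (specialArray q r) := by
  rw [specialArray_eq]
  exact (isQMatrix_diag (fun i => ((QU.detUnit q r ^ (-headWeight r i) : (QU q r)ˣ) : QU q r))
    fun i j => by
      rw [Commute, SemiconjBy, ← Units.val_mul, ← Units.val_mul, ← zpow_add, ← zpow_add,
        add_comm]).mul QSU.q_ne_zero QU.isQMatrix_u (commute_diag_u q)

include hr in
-- The head weights add up to 1, so the diagonal factor contributes exactly det_r⁻¹.
lemma qdet_specialArray : qdet (q : ℂ) (specialArray q r) = 1 := by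
  rw [specialArray_eq, qdet_mul QSU.q_ne_zero QU.isQMatrix_u (commute_diag_u q),
    qdet_diag (fun i => ((QU.detUnit q r ^ (-headWeight r i) : (QU q r)ˣ) : QU q r)),
    prod_ofFn_zpow, Finset.sum_neg_distrib, sum_headWeight hr, zpow_neg_one]
  exact (QU.detUnit q r).inv_mul

/-- The embedding of `ℂ_q[SU_r]` in `ℂ_q[U_r]` given by rescaling the first row. -/
noncomputable def specialEmbed : QSU q r →ₐ[ℂ] QU q r :=
  QSU.lift (specialArray q r) (isQMatrix_specialArray q) (qdet_specialArray q hr)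

lemma specialEmbed_u (i j : Fin r) :
    specialEmbed q hr (QSU.u q i j) = specialArray q r i j := QSU.lift_u _ _ _ _ _

lemma commute_laurentLift_specialEmbed (t : ℂ[T;T⁻¹]) (x : QSU q r) :
    Commute (laurentLift (QU.detUnit q r) t) (specialEmbed q hr x) := by
  induction x using QSU.induction with
  | hc c => rw [AlgHom.commutes]; exact (Algebra.commutes _ _).symm
  | hadd x y hx hy => rw [map_add]; exact hx.add_right hy
  | hmul x y hx hy => rw [map_mul]; exact hx.mul_right hy
  | hu i j =>
    induction t using LaurentPolynomial.induction_on' with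
    | add a b ha hb => rw [map_add]; exact ha.add_left hb
    | C_mul_T k a =>
      rw [C_mul_T_eq_smul, map_smul, laurentLift_T, specialEmbed_u]
      refine Commute.smul_left ?_ a
      rw [specialArray]
      refine Commute.mul_right ?_ (commute_detUnit_zpow q k i j)
      rw [Commute, SemiconjBy, ← Units.val_mul, ← Units.val_mul, ← zpow_add, ← zpow_add, add_comm]

/-- The algebra map `ℂ[t, t⁻¹] ⊗ ℂ_q[SU_r] → ℂ_q[U_r]`. -/
noncomputable def unitaryOfSpecial : ℂ[T;T⁻¹] ⊗[ℂ] QSU q r →ₐ[ℂ] QU q r :=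
  Algebra.TensorProduct.lift (laurentLift (QU.detUnit q r)) (specialEmbed q hr)
    (commute_laurentLift_specialEmbed q hr)

/-- The map recovering `Δ_π` from the circle coaction and `Δ_σ`. -/
noncomputable def assembleCoaction :
    (QSU q (r + m) ⊗[ℂ] ℂ[T;T⁻¹]) ⊗[ℂ] (QSU q r ⊗[ℂ] QSU q m) →ₐ[ℂ]
      QSU q (r + m) ⊗[ℂ] (QU q r ⊗[ℂ] QSU q m) :=
  (Algebra.TensorProduct.map (AlgHom.id ℂ _)
    ((Algebra.TensorProduct.map (unitaryOfSpecial q hr) (AlgHom.id ℂ _)).comp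
      (Algebra.TensorProduct.assoc ℂ ℂ ℂ ℂ[T;T⁻¹] (QSU q r) (QSU q m)).symm.toAlgHom)).comp
    (Algebra.TensorProduct.assoc ℂ ℂ ℂ (QSU q (r + m)) ℂ[T;T⁻¹] (QSU q r ⊗[ℂ] QSU q m)).toAlgHom

lemma assembleCoaction_tmul (x : QSU q (r + m)) (t : ℂ[T;T⁻¹]) (a : QSU q r) (b : QSU q m) :
    assembleCoaction q hr ((x ⊗ₜ t) ⊗ₜ (a ⊗ₜ b)) =
      x ⊗ₜ ((laurentLift (QU.detUnit q r) t * specialEmbed q hr a) ⊗ₜ b) := by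
  simp [assembleCoaction, unitaryOfSpecial]

omit hq in
-- On the second block α_r is the circle evaluated at t = det_r, which is what ties π to the circle.
lemma alphaDiag_eq (i : Fin m) : alphaDiag q r m i =
    ((QU.detUnit q r ^ tailWeight m i : (QU q r)ˣ) : QU q r) := by
  unfold alphaDiag tailWeight
  split_ifs
  · rw [zpow_neg_one]; rfl
  · simp

/-- Evaluating t at det_r turns the row weight into a power of det_r. In the first block it cancels
the rescaling of `specialArray`; in the second it is the diagonal entry of α_r. -/
lemma assembleCoaction_sigmaMap (x : QSU q (r + m)) (i j : Fin (r + m)) :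
    assembleCoaction q hr ((x ⊗ₜ LaurentPolynomial.T (circleWeight r m i)) ⊗ₜ
      sigmaMap q r m (QSU.u q i j)) = x ⊗ₜ piMap q r m hm (QSU.u q i j) := by
  rw [sigmaMap_u, piMap_u]
  induction i using Fin.addCases <;> induction j using Fin.addCases
  · simp [assembleCoaction_tmul, laurentLift_T, specialEmbed_u, specialArray]
  · simp
  · simp
  · simp [assembleCoaction_tmul, laurentLift_T, alphaDiag_eq]

/-- Counterpart of the factorisation of S(U_r × U_m) into the circle and SU_r × SU_m: Δ_π is
determined by the circle coaction and Δ_σ. -/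
lemma inducedCoaction_piMap_eq : inducedCoaction (piMap q r m hm) =
    (assembleCoaction q hr).comp
      ((Algebra.TensorProduct.map (circleCoaction q hr hm) (AlgHom.id ℂ _)).comp
        (inducedCoaction (sigmaMap q r m))) :=
  QSU.algHom_ext fun i j => by
    simp only [AlgHom.comp_apply, inducedCoaction_u, map_sum, Algebra.TensorProduct.map_tmul,
      circleCoaction_u, AlgHom.id_apply, assembleCoaction_sigmaMap q hr hm]

/-- The character `u^i_j ↦ δ_{ij} t^{w i}` of `ℂ_q[U_r]`, where `w = (1, 0, …, 0)`. -/
noncomputable def headCharacter : QU q r →ₐ[ℂ] ℂ[T;T⁻¹] :=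
  QU.lift (fun i j => if i = j then LaurentPolynomial.T (headWeight r i) else 0)
    (LaurentPolynomial.T (-1))
    (isQMatrix_diag (fun i => LaurentPolynomial.T (headWeight r i)) fun _ _ => Commute.all _ _)
    (by rw [qdet_diag (fun i => (LaurentPolynomial.T (headWeight r i) : ℂ[T;T⁻¹])), prod_ofFn_T,
      sum_headWeight hr, ← LaurentPolynomial.T_add]; simp)
    (by rw [qdet_diag (fun i => (LaurentPolynomial.T (headWeight r i) : ℂ[T;T⁻¹])), prod_ofFn_T,
      sum_headWeight hr, ← LaurentPolynomial.T_add]; simp)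

omit hq in
lemma headCharacter_u (i j : Fin r) : headCharacter q hr (QU.u q i j) =
    if i = j then LaurentPolynomial.T (headWeight r i) else 0 := QU.lift_u _ _ _ _ _ _ _

omit hq in
lemma headCharacter_det (k : ℤ) : headCharacter q hr ((QU.detUnit q r ^ k : (QU q r)ˣ) : QU q r) =
    LaurentPolynomial.T k := by
  have h1 : headCharacter q hr (QU.detUnit q r : QU q r) = LaurentPolynomial.T 1 := by
    change headCharacter q hr (qdet (q : ℂ) (QU.u q)) = _
    rw [map_qdet]
    simp only [headCharacter_u]
    rw [qdet_diag (fun i => (LaurentPolynomial.T (headWeight r i) : ℂ[T;T⁻¹])), prod_ofFn_T,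
      sum_headWeight hr]
  have h2 := units_zpow_eq_T (t := Units.map (headCharacter q hr : QU q r →* ℂ[T;T⁻¹])
    (QU.detUnit q r)) h1 k
  rw [← map_zpow] at h2
  exact h2

/-- The character of `ℂ_q[U_r] ⊗ ℂ_q[SU_m]` restricting to the circle. -/
noncomputable def blockCharacter : QU q r ⊗[ℂ] QSU q m →ₐ[ℂ] ℂ[T;T⁻¹] :=
  (Algebra.TensorProduct.rid ℂ ℂ ℂ[T;T⁻¹]).toAlgHom.comp
    (Algebra.TensorProduct.map (headCharacter q hr) (Bialgebra.counitAlgHom ℂ (QSU q m)))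

/-- The circle is a subgroup of the one defined by π, so semi-coinvariance under π fixes the circle
degree. -/
lemma blockCharacter_piMap : (blockCharacter q hr).comp (piMap q r m hm) =
    torus q (circleWeight r m) (sum_circleWeight hr hm) :=
  QSU.algHom_ext fun i j => by
    have hne : ∀ (i : Fin r) (j : Fin m), Fin.castAdd m i ≠ Fin.natAdd r j := fun i j h => by
      have := congrArg Fin.val h
      simp at this
      omega
    rw [AlgHom.comp_apply, piMap_u, torus_u]
    induction i using Fin.addCases <;> induction j using Fin.addCases <;>
      simp [blockCharacter, headCharacter_u, alphaDiag_eq, headCharacter_det, QSU.counit_u,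
        ite_smul, hne, (hne _ _).symm]

lemma inducedCoaction_comp {G K K' : Type*} [Ring G] [Bialgebra ℂ G] [Ring K] [Algebra ℂ K]
    [Ring K'] [Algebra ℂ K'] (f : G →ₐ[ℂ] K) (g : K →ₐ[ℂ] K') : inducedCoaction (g.comp f) =
      (Algebra.TensorProduct.map (AlgHom.id ℂ G) g).comp (inducedCoaction f) := by
  rw [inducedCoaction, inducedCoaction, ← AlgHom.comp_assoc, ← Algebra.TensorProduct.map_comp,
    AlgHom.id_comp]

/-- Setting det_r = 1 turns π into σ, so the twist by det_r^k becomes trivial and E_k is contained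
in P. -/
lemma proj_piMap : (Algebra.TensorProduct.map (QSU.proj q r) (AlgHom.id ℂ (QSU q m))).comp
    (piMap q r m hm) = sigmaMap q r m :=
  QSU.algHom_ext fun i j => by
    have h : QSU.proj q r (QU.detInv q r) = 1 := by
      have := congrArg (QSU.proj q r) (QU.qdet_mul_detInv (q := q) (n := r))
      rw [map_mul, map_qdet, map_one] at this
      have h1 : qdet (q : ℂ) (fun i j => QSU.proj q r (QU.u q i j)) = 1 := QSU.qdet_u
      rwa [h1, one_mul] at this
    have h' : ∀ i, QSU.proj q r (alphaDiag q r m i) = 1 := fun i => by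
      unfold alphaDiag
      split_ifs
      · exact h
      · exact map_one _
    rw [AlgHom.comp_apply, piMap_u, sigmaMap_u]
    induction i using Fin.addCases <;> induction j using Fin.addCases <;>
      simp [h', QSU.u]

omit hq in
lemma proj_detUnit_zpow (k : ℤ) :
    QSU.proj q r ((QU.detUnit q r ^ k : (QU q r)ˣ) : QU q r) = 1 := by
  have h1 : Units.map (QSU.proj q r : QU q r →* QSU q r) (QU.detUnit q r) = 1 := by
    refine Units.ext ?_
    change QSU.proj q r (qdet (q : ℂ) (QU.u q)) = 1
    rw [map_qdet]
    exact QSU.qdet_u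
  have h2 : Units.map (QSU.proj q r : QU q r →* QSU q r) (QU.detUnit q r ^ k) = 1 := by
    rw [map_zpow, h1, one_zpow]
  exact congrArg Units.val h2

/-- The line bundles are the homogeneous components of the quantum sphere. -/
lemma mem_lineBundle_iff_homogeneous {k : ℤ} {x : QSU q (r + m)} :
    x ∈ lineBundle q r m hm k ↔ x ∈ quantumSphere q r m ∧
      circleCoaction q hr hm x = x ⊗ₜ LaurentPolynomial.T k := by
  rw [mem_lineBundle_iff, mem_quantumSphere_iff]
  constructor
  -- Push the defining equation of E_k along det_r ↦ 1 for coinvariance, and along the circle, where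
  -- det_r^k becomes t^k, for the degree.
  · intro hx
    constructor
    · rw [← proj_piMap q hm, inducedCoaction_comp, AlgHom.comp_apply, hx,
        Algebra.TensorProduct.map_tmul, Algebra.TensorProduct.map_tmul, proj_detUnit_zpow, map_one,
        AlgHom.id_apply, Algebra.TensorProduct.one_def]
    · rw [circleCoaction, ← blockCharacter_piMap q hr hm, inducedCoaction_comp, AlgHom.comp_apply,
        hx, Algebra.TensorProduct.map_tmul, AlgHom.id_apply]
      simp [blockCharacter, headCharacter_det]
  -- Reassembling Δ_π, the degree k enters only through t^k, which is evaluated to det_r^k.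
  · rintro ⟨h1, h2⟩
    rw [inducedCoaction_piMap_eq q hr hm, AlgHom.comp_apply, AlgHom.comp_apply, h1,
      Algebra.TensorProduct.map_tmul, h2, map_one, Algebra.TensorProduct.one_def,
      assembleCoaction_tmul, laurentLift_T, map_one, mul_one]

lemma sphereCoaction_eq_iff_mem_lineBundle (x : quantumSphere q r m) (k : ℤ) :
    sphereCoaction q hr hm x = x ⊗ₜ LaurentPolynomial.T k ↔
      (x : QSU q (r + m)) ∈ lineBundle q r m hm k := by
  rw [sphereCoaction_eq_iff, mem_lineBundle_iff_homogeneous q hr hm]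
  exact ⟨fun h => ⟨x.2, h⟩, fun h => h.2⟩

/-- Every element of P is a sum of homogeneous ones, and those of degree k lie in E_k, where the
value is prescribed. -/
lemma sphereCoaction_unique (δ : quantumSphere q r m →ₐ[ℂ] quantumSphere q r m ⊗[ℂ] ℂ[T;T⁻¹])
    (hδ : ∀ (k : ℤ) (x : quantumSphere q r m), (x : QSU q (r + m)) ∈ lineBundle q r m hm k →
      δ x = x ⊗ₜ LaurentPolynomial.T k) : δ = sphereCoaction q hr hm := by
  refine AlgHom.toLinearMap_injective
    ((isComoduleAlgebra_sphereCoaction q hr hm).hom_ext fun k x hx => ?_)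
  exact (hδ k x ((sphereCoaction_eq_iff_mem_lineBundle q hr hm x k).1 hx)).trans hx.symm

/-- Both sides are E_0, since det_r^0 = 1 and t^0 = 1. -/
lemma map_coinvariants_sphereCoaction :
    (coinvariants (sphereCoaction q hr hm)).map (quantumSphere q r m).val =
      quantumGrassmannian q r m hm := by
  have hgr : ∀ x : QSU q (r + m), x ∈ quantumGrassmannian q r m hm ↔
      x ∈ lineBundle q r m hm 0 := fun x => by
    rw [mem_lineBundle_iff, zpow_zero, Units.val_one, ← Algebra.TensorProduct.one_def]
    rfl
  have hco : ∀ x : quantumSphere q r m, x ∈ coinvariants (sphereCoaction q hr hm) ↔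
      (x : QSU q (r + m)) ∈ lineBundle q r m hm 0 := fun x => by
    rw [mem_coinvariants_iff, ← sphereCoaction_eq_iff_mem_lineBundle q hr hm,
      LaurentPolynomial.T_zero]
  ext x
  rw [Subalgebra.mem_map, hgr]
  constructor
  · rintro ⟨y, hy, rfl⟩
    exact (hco y).1 hy
  · intro hx
    exact ⟨⟨x, ((mem_lineBundle_iff_homogeneous q hr hm).1 hx).1⟩, (hco _).2 hx, rfl⟩

end lineBundle

/-! ### Coinvariance and the antipode -/

section antipode

variable {G K : Type*} [Ring G] [HopfAlgebra ℂ G] [Ring K] [Algebra ℂ K]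

lemma inducedCoaction_apply (f : G →ₐ[ℂ] K) (x : G) :
    inducedCoaction f x = f.toLinearMap.lTensor G (Coalgebra.comul x) := rfl

lemma flipCoaction_apply (f : G →ₐ[ℂ] K) (x : G) :
    flipCoaction f x = f.toLinearMap.lTensor G (TensorProduct.comm ℂ G G (Coalgebra.comul x)) := rfl

/-- The map `x ↦ x_(2) ⊗ f(S(x_(1)))`. -/
noncomputable def antipodeFlip (f : G →ₐ[ℂ] K) : G →ₗ[ℂ] G ⊗[ℂ] K :=
  (f.toLinearMap ∘ₗ HopfAlgebra.antipode ℂ).lTensor G ∘ₗ (TensorProduct.comm ℂ G G).toLinearMap ∘ₗ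
    Coalgebra.comul

/-- The map `(a, b ⊗ c) ↦ c ⊗ f(a) f(S(b))`. -/
noncomputable def antipodeFlipAux (f : G →ₐ[ℂ] K) : G ⊗[ℂ] (G ⊗[ℂ] G) →ₗ[ℂ] G ⊗[ℂ] K :=
  TensorProduct.lift ((LinearMap.mul ℂ (G ⊗[ℂ] K)).compl₁₂
    ((TensorProduct.mk ℂ G K 1) ∘ₗ f.toLinearMap)
    ((f.toLinearMap ∘ₗ HopfAlgebra.antipode ℂ).lTensor G ∘ₗ
      (TensorProduct.comm ℂ G G).toLinearMap))

lemma antipodeFlipAux_tmul (f : G →ₐ[ℂ] K) (a : G) (w : G ⊗[ℂ] G) :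
    antipodeFlipAux f (a ⊗ₜ w) = (1 ⊗ₜ f a) *
      (f.toLinearMap ∘ₗ HopfAlgebra.antipode ℂ).lTensor G (TensorProduct.comm ℂ G G w) := rfl

lemma antipodeFlipAux_assoc (f : G →ₐ[ℂ] K) (w : G ⊗[ℂ] G) (c : G) :
    antipodeFlipAux f (TensorProduct.assoc ℂ G G G (w ⊗ₜ c)) =
      c ⊗ₜ f (LinearMap.mul' ℂ G ((HopfAlgebra.antipode ℂ).lTensor G w)) := by
  induction w with
  | zero => simp
  | add x y hx hy => simp only [map_add, TensorProduct.add_tmul, TensorProduct.tmul_add, hx, hy]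
  | tmul a b => simp [antipodeFlipAux_tmul]

/-- In Sweedler notation, x_(3) ⊗ f(x_(1) S(x_(2))) = x ⊗ 1 by the antipode and counit axioms. -/
lemma antipodeFlipAux_comul_comul (f : G →ₐ[ℂ] K) (x : G) :
    antipodeFlipAux f ((Coalgebra.comul (R := ℂ)).lTensor G (Coalgebra.comul x)) = x ⊗ₜ 1 := by
  rw [← Coalgebra.coassoc_apply]
  have key : ∀ w : G ⊗[ℂ] G, antipodeFlipAux f
      (TensorProduct.assoc ℂ G G G ((Coalgebra.comul (R := ℂ)).rTensor G w)) =
      TensorProduct.lid ℂ G ((Coalgebra.counit (R := ℂ)).rTensor G w) ⊗ₜ 1 := by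
    intro w
    induction w with
    | zero => simp
    | add x y hx hy => simp only [map_add, TensorProduct.add_tmul, hx, hy]
    | tmul a b =>
      rw [LinearMap.rTensor_tmul, antipodeFlipAux_assoc,
        HopfAlgebra.mul_antipode_lTensor_comul_apply, AlgHom.commutes, LinearMap.rTensor_tmul,
        TensorProduct.lid_tmul, Algebra.algebraMap_eq_smul_one, TensorProduct.tmul_smul,
        TensorProduct.smul_tmul']
  rw [key, Coalgebra.rTensor_counit_comul, TensorProduct.lid_tmul, one_smul]

/-- A convolution argument: left semi-coinvariance gives (1 ⊗ g) · (x_(2) ⊗ f(S(x_(1)))) = x ⊗ 1,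
and g is then cancelled. K is only an algebra, so no antipode of K is available. -/
lemma antipodeFlip_eq (f : G →ₐ[ℂ] K) {x : G} {g : Kˣ} (hx : flipCoaction f x = x ⊗ₜ (g : K)) :
    antipodeFlip f x = x ⊗ₜ ((g⁻¹ : Kˣ) : K) := by
  let Θ : G ⊗[ℂ] K →ₗ[ℂ] G ⊗[ℂ] K := TensorProduct.lift
    ((LinearMap.mul ℂ (G ⊗[ℂ] K)).compl₁₂ (TensorProduct.mk ℂ G K 1) (antipodeFlip f)).flip
  have hΘ : ∀ a k, Θ (a ⊗ₜ k) = (1 ⊗ₜ k) * antipodeFlip f a := fun a k => rfl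
  have key : ∀ w : G ⊗[ℂ] G, Θ (f.toLinearMap.lTensor G (TensorProduct.comm ℂ G G w)) =
      antipodeFlipAux f ((Coalgebra.comul (R := ℂ)).lTensor G w) := by
    intro w
    induction w with
    | zero => simp
    | add x y hx hy => simp only [map_add, hx, hy]
    | tmul a b =>
      rw [TensorProduct.comm_tmul, LinearMap.lTensor_tmul, hΘ, LinearMap.lTensor_tmul,
        antipodeFlipAux_tmul]
      rfl
  have h1 : (1 ⊗ₜ (g : K)) * antipodeFlip f x = x ⊗ₜ 1 := by
    rw [← hΘ, ← hx, flipCoaction_apply, key, antipodeFlipAux_comul_comul]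
  calc antipodeFlip f x = (1 ⊗ₜ ((g⁻¹ : Kˣ) : K)) * ((1 ⊗ₜ (g : K)) * antipodeFlip f x) := by
        rw [← mul_assoc, Algebra.TensorProduct.tmul_mul_tmul, Units.inv_mul, one_mul,
          ← Algebra.TensorProduct.one_def, one_mul]
    _ = _ := by rw [h1, Algebra.TensorProduct.tmul_mul_tmul, one_mul, mul_one]

/-- The antipode is a coalgebra antihomomorphism. -/
def AntipodeComul (G : Type*) [Ring G] [HopfAlgebra ℂ G] : Prop :=
  ∀ x : G, Coalgebra.comul (R := ℂ) (HopfAlgebra.antipode ℂ x) =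
    TensorProduct.map (HopfAlgebra.antipode ℂ) (HopfAlgebra.antipode ℂ)
      (TensorProduct.comm ℂ G G (Coalgebra.comul x))

/-- If `x` is left semi-coinvariant, then so is the left leg of `S(x_(1)) ⊗ x_(2)` on the right. -/
lemma inducedCoaction_antipode (hS : AntipodeComul G) (f : G →ₐ[ℂ] K) {x : G} {g : Kˣ}
    (hx : flipCoaction f x = x ⊗ₜ (g : K)) :
    (inducedCoaction f).toLinearMap.rTensor G
        ((HopfAlgebra.antipode ℂ).rTensor G (Coalgebra.comul x)) =
      ((TensorProduct.mk ℂ G K).flip ((g⁻¹ : Kˣ) : K)).rTensor G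
        ((HopfAlgebra.antipode ℂ).rTensor G (Coalgebra.comul x)) := by
  have h := antipodeFlip_eq f hx
  -- Q sends a ⊗ k to (S(a_(1)) ⊗ k) ⊗ a_(2). It transports `antipodeFlip_eq` to a statement about
  -- S(x_(1)) ⊗ x_(2).
  let Q : G ⊗[ℂ] K →ₗ[ℂ] (G ⊗[ℂ] K) ⊗[ℂ] G := (TensorProduct.rightComm ℂ G G K).toLinearMap ∘ₗ
    ((HopfAlgebra.antipode ℂ).rTensor G ∘ₗ Coalgebra.comul).rTensor K
  let R : G ⊗[ℂ] (G ⊗[ℂ] G) →ₗ[ℂ] (G ⊗[ℂ] K) ⊗[ℂ] G :=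
    (TensorProduct.comm ℂ G (G ⊗[ℂ] K)).toLinearMap ∘ₗ
    ((TensorProduct.comm ℂ K G).toLinearMap).lTensor G ∘ₗ
    (TensorProduct.leftComm ℂ K G G).toLinearMap ∘ₗ
    TensorProduct.map (f.toLinearMap ∘ₗ HopfAlgebra.antipode ℂ)
      ((TensorProduct.comm ℂ G G).toLinearMap ∘ₗ (HopfAlgebra.antipode ℂ).rTensor G)
  have hR : ∀ a b c, R (a ⊗ₜ (b ⊗ₜ c)) =
      (HopfAlgebra.antipode ℂ b ⊗ₜ f (HopfAlgebra.antipode ℂ a)) ⊗ₜ c := fun a b c => by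
    simp [R]
  have hQ : ∀ w : G ⊗[ℂ] G, Q ((f.toLinearMap ∘ₗ HopfAlgebra.antipode ℂ).lTensor G
      (TensorProduct.comm ℂ G G w)) = R ((Coalgebra.comul (R := ℂ)).lTensor G w) := by
    intro w
    induction w with
    | zero => simp
    | add x y hx hy => simp only [map_add, hx, hy]
    | tmul a b =>
      simp only [TensorProduct.comm_tmul, LinearMap.lTensor_tmul, Q, LinearMap.comp_apply,
        LinearMap.rTensor_tmul, LinearEquiv.coe_coe]
      generalize Coalgebra.comul (R := ℂ) b = w
      induction w with
      | zero => simp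
      | add x y hx hy => simp only [map_add, TensorProduct.add_tmul, TensorProduct.tmul_add, hx, hy]
      | tmul b c => rw [hR]; simp
  -- Because S reverses the coproduct, translating the left leg yields (S(x_(2)) ⊗ f(S(x_(1)))) ⊗
  -- x_(3).
  have hL : ∀ w : G ⊗[ℂ] G, (inducedCoaction f).toLinearMap.rTensor G
      ((HopfAlgebra.antipode ℂ).rTensor G w) =
      R (TensorProduct.assoc ℂ G G G ((Coalgebra.comul (R := ℂ)).rTensor G w)) := by
    intro w
    induction w with
    | zero => simp
    | add x y hx hy => simp only [map_add, hx, hy]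
    | tmul a c =>
      simp only [LinearMap.rTensor_tmul, AlgHom.toLinearMap_apply, inducedCoaction_apply]
      rw [hS]
      generalize Coalgebra.comul (R := ℂ) a = w
      induction w with
      | zero => simp
      | add x y hx hy => simp only [map_add, TensorProduct.add_tmul, hx, hy]
      | tmul a b =>
        rw [TensorProduct.assoc_tmul, hR]; simp
  have hM : ∀ w : G ⊗[ℂ] G, (TensorProduct.rightComm ℂ G G K)
      ((HopfAlgebra.antipode ℂ).rTensor G w ⊗ₜ[ℂ] ((g⁻¹ : Kˣ) : K)) =
      ((TensorProduct.mk ℂ G K).flip ((g⁻¹ : Kˣ) : K)).rTensor G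
        ((HopfAlgebra.antipode ℂ).rTensor G w) := by
    intro w
    induction w with
    | zero => simp
    | add x y hx hy => simp only [map_add, TensorProduct.add_tmul, hx, hy]
    | tmul a c => simp
  -- Coassociativity regroups the three factors, so the expression is Q applied to x_(2) ⊗
  -- f(S(x_(1))), which is x ⊗ g⁻¹.
  rw [hL, Coalgebra.coassoc_apply, ← hQ]
  change Q (antipodeFlip f x) = _
  rw [h, ← hM]
  rfl

/-- If `x` is right semi-coinvariant, then so is the right leg of `S(x_(1)) ⊗ x_(2)`. -/
lemma inducedCoaction_right_leg (f : G →ₐ[ℂ] K) {x : G} {g : K}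
    (hx : inducedCoaction f x = x ⊗ₜ g) :
    (inducedCoaction f).toLinearMap.lTensor G
        ((HopfAlgebra.antipode ℂ).rTensor G (Coalgebra.comul x)) =
      ((TensorProduct.mk ℂ G K).flip g).lTensor G
        ((HopfAlgebra.antipode ℂ).rTensor G (Coalgebra.comul x)) := by
  have h1 : ∀ w : G ⊗[ℂ] G, (inducedCoaction f).toLinearMap.lTensor G
      ((HopfAlgebra.antipode ℂ).rTensor G w) =
      (HopfAlgebra.antipode ℂ).rTensor (G ⊗[ℂ] K) ((f.toLinearMap.lTensor G).lTensor G
        ((Coalgebra.comul (R := ℂ)).lTensor G w)) := by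
    intro w
    induction w with
    | zero => simp
    | add x y hx hy => simp only [map_add, hx, hy]
    | tmul a b => simp [inducedCoaction_apply]
  have h2 : ∀ w : G ⊗[ℂ] G, (f.toLinearMap.lTensor G).lTensor G
      (TensorProduct.assoc ℂ G G G ((Coalgebra.comul (R := ℂ)).rTensor G w)) =
      TensorProduct.assoc ℂ G G K ((Coalgebra.comul (R := ℂ)).rTensor K
        (f.toLinearMap.lTensor G w)) := by
    intro w
    induction w with
    | zero => simp
    | add x y hx hy => simp only [map_add, hx, hy]
    | tmul a b =>
      simp only [LinearMap.rTensor_tmul, LinearMap.lTensor_tmul]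
      generalize Coalgebra.comul (R := ℂ) a = w
      induction w with
      | zero => simp
      | add x y hx hy => simp only [map_add, TensorProduct.add_tmul, hx, hy]
      | tmul a c => simp
  have h3 : ∀ w : G ⊗[ℂ] G, (HopfAlgebra.antipode ℂ).rTensor (G ⊗[ℂ] K)
      (TensorProduct.assoc ℂ G G K (w ⊗ₜ g)) = ((TensorProduct.mk ℂ G K).flip g).lTensor G
        ((HopfAlgebra.antipode ℂ).rTensor G w) := by
    intro w
    induction w with
    | zero => simp
    | add x y hx hy => simp only [map_add, TensorProduct.add_tmul, hx, hy]
    | tmul a b => simp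
  -- By coassociativity, translating the second leg of Δ(x) amounts to translating x first and then
  -- splitting it.
  rw [h1, ← Coalgebra.coassoc_apply, h2, ← inducedCoaction_apply, hx, LinearMap.rTensor_tmul, h3]

end antipode

/-- Both sides are algebra maps to the opposite algebra, so generators suffice. There both matrices
are inverse to the matrix with entries Δ(u^i_j). -/
lemma QSU.antipodeComul {q : ℝ} [Fact (0 < q)] {n : ℕ} : AntipodeComul (QSU q n) := by
  let A : QSU q n →ₐ[ℂ] (QSU q n ⊗[ℂ] QSU q n)ᵐᵒᵖ :=
    (AlgHom.op (Bialgebra.comulAlgHom ℂ (QSU q n))).comp (QSU.antipodeHom q n)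
  let B : QSU q n →ₐ[ℂ] (QSU q n ⊗[ℂ] QSU q n)ᵐᵒᵖ :=
    (Algebra.TensorProduct.opAlgEquiv ℂ ℂ (QSU q n) (QSU q n)).toAlgHom.comp
      ((Algebra.TensorProduct.map (QSU.antipodeHom q n) (QSU.antipodeHom q n)).comp
        ((Algebra.TensorProduct.comm ℂ _ _).toAlgHom.comp (Bialgebra.comulAlgHom ℂ (QSU q n))))
  have hB : ∀ w : QSU q n ⊗[ℂ] QSU q n,
      ((Algebra.TensorProduct.opAlgEquiv ℂ ℂ (QSU q n) (QSU q n))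
        (Algebra.TensorProduct.map (QSU.antipodeHom q n) (QSU.antipodeHom q n) w)).unop =
      TensorProduct.map (HopfAlgebra.antipode ℂ) (HopfAlgebra.antipode ℂ) w := by
    intro w
    induction w with
    | zero => simp
    | add x y hx hy => simp only [map_add, MulOpposite.unop_add, hx, hy]
    | tmul a b => simp; rfl
  have hAB : A = B := by
    refine QSU.algHom_ext fun i j => MulOpposite.unop_injective ?_
    change Coalgebra.comul (R := ℂ) (HopfAlgebra.antipode ℂ (QSU.u q i j)) =
      ((Algebra.TensorProduct.opAlgEquiv ℂ ℂ (QSU q n) (QSU q n))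
        (Algebra.TensorProduct.map (QSU.antipodeHom q n) (QSU.antipodeHom q n)
          (TensorProduct.comm ℂ _ _ (Coalgebra.comul (QSU.u q i j))))).unop
    rw [hB, QSU.comul_u, QSU.antipode_u]
    simp only [map_sum, TensorProduct.comm_tmul, TensorProduct.map_tmul, QSU.antipode_u]
    -- X = Δ(S(u)) is a left inverse of U = Δ(u), and Y, the reversed coproduct of cofactors, is a
    -- right inverse; hence X = Y.
    let U : Matrix (Fin n) (Fin n) (QSU q n ⊗[ℂ] QSU q n) :=
      Matrix.of fun i j => Coalgebra.comul (R := ℂ) (QSU.u q i j)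
    let X : Matrix (Fin n) (Fin n) (QSU q n ⊗[ℂ] QSU q n) :=
      Matrix.of fun i j => Coalgebra.comul (R := ℂ) (qcof (q : ℂ) (QSU.u q) i j)
    let Y : Matrix (Fin n) (Fin n) (QSU q n ⊗[ℂ] QSU q n) :=
      Matrix.of fun i j => ∑ k, qcof (q : ℂ) (QSU.u q) k j ⊗ₜ qcof (q : ℂ) (QSU.u q) i k
    have hXU : X * U = 1 := by
      ext i j
      simp only [Matrix.mul_apply, X, U, Matrix.of_apply, ← Bialgebra.comul_mul, ← map_sum,
        QSU.qcof_mul_u, Matrix.one_apply]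
      split_ifs <;> simp
    have hUY : U * Y = 1 := by
      ext i j
      simp only [Matrix.mul_apply, Y, U, Matrix.of_apply, QSU.comul_u, Finset.sum_mul_sum,
        Algebra.TensorProduct.tmul_mul_tmul]
      have : ∀ a b, ∑ k, (QSU.u q i a * qcof (q : ℂ) (QSU.u q) b j) ⊗ₜ[ℂ]
          (QSU.u q a k * qcof (q : ℂ) (QSU.u q) k b) =
          (QSU.u q i a * qcof (q : ℂ) (QSU.u q) b j) ⊗ₜ (if a = b then 1 else 0) := by
        intro a b
        rw [← TensorProduct.tmul_sum, QSU.u_mul_qcof]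
      trans ∑ a, ∑ b, (QSU.u q i a * qcof (q : ℂ) (QSU.u q) b j) ⊗ₜ[ℂ]
        (if a = b then (1 : QSU q n) else 0)
      · rw [Finset.sum_comm]
        refine Finset.sum_congr rfl fun a _ => ?_
        rw [Finset.sum_comm]
        exact Finset.sum_congr rfl fun b _ => this a b
      · simp only [TensorProduct.tmul_ite, Finset.sum_ite_eq,
          Finset.mem_univ, if_true, ← TensorProduct.sum_tmul, QSU.u_mul_qcof, Matrix.one_apply]
        split_ifs <;> simp [Algebra.TensorProduct.one_def]
    have hXY : X = Y := left_inv_eq_right_inv hXU hUY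
    exact congrFun (congrFun hXY i) j
  intro x
  have h := congrArg MulOpposite.unop (AlgHom.congr_fun hAB x)
  exact h.trans (hB _)

lemma map_injective_of_injective {V V' W W' : Type*} [AddCommGroup V] [Module ℂ V]
    [AddCommGroup V'] [Module ℂ V'] [AddCommGroup W] [Module ℂ W] [AddCommGroup W'] [Module ℂ W']
    {f : V →ₗ[ℂ] V'} {g : W →ₗ[ℂ] W'} (hf : Function.Injective f) (hg : Function.Injective g) :
    Function.Injective (TensorProduct.map f g) := by
  rw [← LinearMap.rTensor_comp_lTensor]
  exact (Module.Flat.rTensor_preserves_injective_linearMap f hf).comp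
    (Module.Flat.lTensor_preserves_injective_linearMap g hg)

/-- An element of `V ⊗ V` killed by `d` in both legs comes from the kernel of `d`. -/
lemma exists_map_eq_of_exact {U V W : Type*} [AddCommGroup U] [Module ℂ U] [AddCommGroup V]
    [Module ℂ V] [AddCommGroup W] [Module ℂ W] {i : U →ₗ[ℂ] V} {d : V →ₗ[ℂ] W}
    (hi : Function.Injective i) (h : Function.Exact i d) {w : V ⊗[ℂ] V}
    (h1 : d.rTensor V w = 0) (h2 : d.lTensor V w = 0) : ∃ y, TensorProduct.map i i y = w := by
  obtain ⟨w, rfl⟩ := (Module.Flat.rTensor_exact V h _).1 h1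
  -- After the first leg is lifted to U, the second is still killed by d, because U ⊗ W embeds in V
  -- ⊗ W.
  have h3 : d.lTensor U w = 0 := by
    refine Module.Flat.rTensor_preserves_injective_linearMap (M := W) i hi ?_
    rw [map_zero, ← h2, ← LinearMap.comp_apply, ← LinearMap.comp_apply,
      LinearMap.rTensor_comp_lTensor, LinearMap.lTensor_comp_rTensor]
  obtain ⟨y, rfl⟩ := (Module.Flat.lTensor_exact U h _).1 h3
  exact ⟨y, by rw [← LinearMap.rTensor_comp_lTensor, LinearMap.comp_apply]⟩

/-- Principal `ℓ`-maps can be checked after embedding the comodule algebra. -/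
lemma isPrincipalEllMap_of_injective {P P' : Type*} [Ring P] [Algebra ℂ P] [Ring P']
    [Algebra ℂ P'] {δ : P →ₐ[ℂ] P ⊗[ℂ] ℂ[T;T⁻¹]} {δ' : P' →ₐ[ℂ] P' ⊗[ℂ] ℂ[T;T⁻¹]}
    (i : P' →ₐ[ℂ] P) (hi : Function.Injective i)
    (h : ∀ x, i.toLinearMap.rTensor _ (δ' x) = δ (i x)) {ℓ : ℂ[T;T⁻¹] →ₗ[ℂ] P' ⊗[ℂ] P'}
    {w : ℤ → P ⊗[ℂ] P}
    (hw : ∀ k, TensorProduct.map i.toLinearMap i.toLinearMap (ℓ (LaurentPolynomial.T k)) = w k)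
    (h0 : w 0 = 1 ⊗ₜ 1) (hmul : ∀ k, LinearMap.mul' ℂ P (w k) = 1)
    (hright : ∀ k, δ.toLinearMap.lTensor P (w k) =
      ((TensorProduct.mk ℂ P ℂ[T;T⁻¹]).flip (LaurentPolynomial.T k)).lTensor P (w k))
    (hleft : ∀ k, δ.toLinearMap.rTensor P (w k) =
      ((TensorProduct.mk ℂ P ℂ[T;T⁻¹]).flip (LaurentPolynomial.T (-k))).rTensor P (w k)) :
    IsPrincipalEllMap laurent_antipode_bijective δ' ℓ where
  map_one := by
    refine map_injective_of_injective (f := i.toLinearMap) (g := i.toLinearMap) hi hi ?_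
    rw [← LaurentPolynomial.T_zero, hw, h0]
    simp
  mul_comp := by
    refine laurent_hom_ext fun k => hi ?_
    have key : ∀ w : P' ⊗[ℂ] P', i (LinearMap.mul' ℂ P' w) =
        LinearMap.mul' ℂ P (TensorProduct.map i.toLinearMap i.toLinearMap w) := by
      intro w
      induction w with
      | zero => simp
      | add x y hx hy => simp only [map_add, hx, hy]
      | tmul a b => simp
    rw [LinearMap.comp_apply, key, hw, hmul, LinearMap.comp_apply, LaurentPolynomial.counit_T]
    simp
  right := by
    refine laurent_hom_ext fun k => ?_
    -- The right leg has degree k already in P', as the identity holds after the injective map into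
    -- P ⊗ (P ⊗ ℂ[t, t⁻¹]).
    have hk : δ'.toLinearMap.lTensor P' (ℓ (LaurentPolynomial.T k)) =
        ((TensorProduct.mk ℂ P' ℂ[T;T⁻¹]).flip (LaurentPolynomial.T k)).lTensor P'
          (ℓ (LaurentPolynomial.T k)) := by
      refine map_injective_of_injective (f := i.toLinearMap) (g := i.toLinearMap.rTensor ℂ[T;T⁻¹])
        hi (Module.Flat.rTensor_preserves_injective_linearMap i.toLinearMap hi) ?_
      have h1 : ∀ w : P' ⊗[ℂ] P', TensorProduct.map i.toLinearMap (i.toLinearMap.rTensor ℂ[T;T⁻¹])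
          (δ'.toLinearMap.lTensor P' w) =
          δ.toLinearMap.lTensor P (TensorProduct.map i.toLinearMap i.toLinearMap w) := by
        intro w
        induction w with
        | zero => simp
        | add x y hx hy => simp only [map_add, hx, hy]
        | tmul a b => simp [h]
      have h2 : ∀ w : P' ⊗[ℂ] P', TensorProduct.map i.toLinearMap (i.toLinearMap.rTensor ℂ[T;T⁻¹])
          (((TensorProduct.mk ℂ P' ℂ[T;T⁻¹]).flip (LaurentPolynomial.T k)).lTensor P' w) =
          ((TensorProduct.mk ℂ P ℂ[T;T⁻¹]).flip (LaurentPolynomial.T k)).lTensor P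
            (TensorProduct.map i.toLinearMap i.toLinearMap w) := by
        intro w
        induction w with
        | zero => simp
        | add x y hx hy => simp only [map_add, hx, hy]
        | tmul a b => simp
      rw [h1, h2, hw, hright]
    simp only [LinearMap.comp_apply, LaurentPolynomial.comul_T, LinearMap.rTensor_tmul, hk]
    generalize ℓ (LaurentPolynomial.T k) = w
    induction w with
    | zero => simp
    | add x y hx hy => simp only [map_add, TensorProduct.add_tmul, hx, hy]
    | tmul a b => simp
  left := by
    refine laurent_hom_ext fun k => ?_
    have hk : δ'.toLinearMap.rTensor P' (ℓ (LaurentPolynomial.T k)) =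
        ((TensorProduct.mk ℂ P' ℂ[T;T⁻¹]).flip (LaurentPolynomial.T (-k))).rTensor P'
          (ℓ (LaurentPolynomial.T k)) := by
      refine map_injective_of_injective (f := i.toLinearMap.rTensor ℂ[T;T⁻¹]) (g := i.toLinearMap)
        (Module.Flat.rTensor_preserves_injective_linearMap i.toLinearMap hi) hi ?_
      have h1 : ∀ w : P' ⊗[ℂ] P', TensorProduct.map (i.toLinearMap.rTensor ℂ[T;T⁻¹]) i.toLinearMap
          (δ'.toLinearMap.rTensor P' w) =
          δ.toLinearMap.rTensor P (TensorProduct.map i.toLinearMap i.toLinearMap w) := by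
        intro w
        induction w with
        | zero => simp
        | add x y hx hy => simp only [map_add, hx, hy]
        | tmul a b => simp [h]
      have h2 : ∀ w : P' ⊗[ℂ] P', TensorProduct.map (i.toLinearMap.rTensor ℂ[T;T⁻¹]) i.toLinearMap
          (((TensorProduct.mk ℂ P' ℂ[T;T⁻¹]).flip (LaurentPolynomial.T (-k))).rTensor P' w) =
          ((TensorProduct.mk ℂ P ℂ[T;T⁻¹]).flip (LaurentPolynomial.T (-k))).rTensor P
            (TensorProduct.map i.toLinearMap i.toLinearMap w) := by
        intro w
        induction w with
        | zero => simp
        | add x y hx hy => simp only [map_add, hx, hy]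
        | tmul a b => simp
      rw [h1, h2, hw, hleft]
    -- The inverse antipode in the left coaction turns the degree -k of the left leg into t^k.
    have hT : (LinearEquiv.ofBijective _ laurent_antipode_bijective).symm
        (LaurentPolynomial.T (-k)) = LaurentPolynomial.T k := by
      rw [LinearEquiv.symm_apply_eq, LinearEquiv.ofBijective_apply, LaurentPolynomial.antipode_T]
    simp only [LinearMap.comp_apply, LaurentPolynomial.comul_T, LinearMap.lTensor_tmul,
      leftCoaction, LinearMap.rTensor_comp, hk]
    generalize ℓ (LaurentPolynomial.T k) = w
    induction w with
    | zero => simp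
    | add x y hx hy => simp only [map_add, TensorProduct.tmul_add, hx, hy]
    | tmul a b => simp [hT]

/-! ### Quantum minors -/

/-- The two tensor factors commute, so this is multiplicativity of the determinant; only T has to
satisfy the quantum matrix relations. -/
lemma qdet_sum_tmul {q : ℂ} (hq : q ≠ 0) {n : ℕ} {A B : Type*} [Ring A] [Algebra ℂ A] [Ring B]
    [Algebra ℂ B] (S : Fin n → Fin n → A) {T : Fin n → Fin n → B} (hT : IsQMatrix q T) :
    qdet q (fun i j => ∑ k, S i k ⊗ₜ[ℂ] T k j) = qdet q S ⊗ₜ qdet q T := by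
  have h := qdet_mul hq (S := fun i j => S i j ⊗ₜ[ℂ] (1 : B))
    (hT.map (Algebra.TensorProduct.includeRight : B →ₐ[ℂ] A ⊗[ℂ] B))
    (fun i j k l => by simp [Commute, SemiconjBy])
  simp only [Algebra.TensorProduct.includeRight_apply, Algebra.TensorProduct.tmul_mul_tmul,
    mul_one, one_mul] at h
  rw [h]
  have h1 := map_qdet (q := q) S (Algebra.TensorProduct.includeLeft : A →ₐ[ℂ] A ⊗[ℂ] B)
  have h2 := map_qdet (q := q) T (Algebra.TensorProduct.includeRight : B →ₐ[ℂ] A ⊗[ℂ] B)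
  simp only [Algebra.TensorProduct.includeLeft_apply,
    Algebra.TensorProduct.includeRight_apply] at h1 h2
  rw [← h1, ← h2, Algebra.TensorProduct.tmul_mul_tmul, mul_one, one_mul]

lemma qdet_sum_tmul_flip {q : ℂ} (hq : q ≠ 0) {n : ℕ} {A B : Type*} [Ring A] [Algebra ℂ A]
    [Ring B] [Algebra ℂ B] (S : Fin n → Fin n → A) {T : Fin n → Fin n → B} (hT : IsQMatrix q T) :
    qdet q (fun i j => ∑ k, T k j ⊗ₜ[ℂ] S i k) = qdet q T ⊗ₜ qdet q S := by
  have h := congrArg (Algebra.TensorProduct.comm ℂ A B).toAlgHom (qdet_sum_tmul hq S hT)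
  rw [map_qdet] at h
  simpa using h

section minors

variable {q : ℝ} [hq : Fact (0 < q)] {r m : ℕ} (hr : 0 < r) (hm : 0 < m)

omit hq in
lemma isQMatrix_head : IsQMatrix (q : ℂ) fun i j : Fin r =>
    QSU.u q (Fin.castAdd m i) (Fin.castAdd m j) :=
  QSU.isQMatrix_u.submatrix (Fin.castAddOrderEmb m).strictMono (Fin.castAddOrderEmb m).strictMono

omit hq in
lemma isQMatrix_tail : IsQMatrix (q : ℂ) fun i j : Fin m =>
    QSU.u q (Fin.natAdd r i) (Fin.natAdd r j) :=
  QSU.isQMatrix_u.submatrix (Fin.natAddOrderEmb r).strictMono (Fin.natAddOrderEmb r).strictMono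

omit hq in
lemma isQMatrix_headBlock : IsQMatrix (q : ℂ) fun i j : Fin r =>
    QSU.u q i j ⊗ₜ[ℂ] (1 : QSU q m) :=
  QSU.isQMatrix_u.map (Algebra.TensorProduct.includeLeft : _ →ₐ[ℂ] QSU q r ⊗[ℂ] QSU q m)

omit hq in
lemma isQMatrix_tailBlock : IsQMatrix (q : ℂ) fun i j : Fin m =>
    (1 : QSU q r) ⊗ₜ[ℂ] QSU.u q i j :=
  QSU.isQMatrix_u.map (Algebra.TensorProduct.includeRight : _ →ₐ[ℂ] QSU q r ⊗[ℂ] QSU q m)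

omit hq in
lemma qdet_headBlock : qdet (q : ℂ) (fun i j : Fin r => QSU.u q i j ⊗ₜ[ℂ] (1 : QSU q m)) = 1 := by
  have h := map_qdet (q := (q : ℂ)) (QSU.u q (n := r))
    (Algebra.TensorProduct.includeLeft : _ →ₐ[ℂ] QSU q r ⊗[ℂ] QSU q m)
  rw [QSU.qdet_u, map_one] at h
  exact h.symm

omit hq in
lemma qdet_tailBlock : qdet (q : ℂ) (fun i j : Fin m => (1 : QSU q r) ⊗ₜ[ℂ] QSU.u q i j) = 1 := by
  have h := map_qdet (q := (q : ℂ)) (QSU.u q (n := m))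
    (Algebra.TensorProduct.includeRight : _ →ₐ[ℂ] QSU q r ⊗[ℂ] QSU q m)
  rw [QSU.qdet_u, map_one] at h
  exact h.symm

/-- For a column j ≤ r the entries σ(u^k_j) with k > r vanish, so translation multiplies the r × r
array by the first block of σ, whose determinant is 1. -/
lemma sigma_qminor_head (I : Fin r ↪o Fin (r + m)) :
    inducedCoaction (sigmaMap q r m) (qminor q I (Fin.castAddOrderEmb m)) =
      qminor q I (Fin.castAddOrderEmb m) ⊗ₜ 1 := by
  rw [qminor, map_qdet, ← qdet_headBlock, ← qdet_sum_tmul QSU.q_ne_zero _ isQMatrix_headBlock]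
  congr 1
  funext a b
  simp [inducedCoaction_u, sigmaMap_u, Fin.sum_univ_add]

lemma sigma_qminor_tail (J : Fin m ↪o Fin (r + m)) :
    inducedCoaction (sigmaMap q r m) (qminor q J (Fin.natAddOrderEmb r)) =
      qminor q J (Fin.natAddOrderEmb r) ⊗ₜ 1 := by
  rw [qminor, map_qdet, ← qdet_tailBlock, ← qdet_sum_tmul QSU.q_ne_zero _ isQMatrix_tailBlock]
  congr 1
  funext a b
  simp [inducedCoaction_u, sigmaMap_u, Fin.sum_univ_add]

/-- The same argument on rows; it needs the rows of the minor to be those of R, so it is available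
for z but not for every z^I. -/
lemma flip_sigma_qminor_head :
    flipCoaction (sigmaMap q r m) (qminor q (Fin.castAddOrderEmb m) (Fin.castAddOrderEmb m)) =
      qminor q (Fin.castAddOrderEmb m) (Fin.castAddOrderEmb m) ⊗ₜ 1 := by
  rw [qminor, map_qdet, ← qdet_headBlock]
  refine Eq.trans ?_ (qdet_sum_tmul_flip QSU.q_ne_zero _ isQMatrix_head)
  congr 1
  funext a b
  simp [flipCoaction_u, sigmaMap_u, Fin.sum_univ_add]

lemma flip_sigma_qminor_tail :
    flipCoaction (sigmaMap q r m) (qminor q (Fin.natAddOrderEmb r) (Fin.natAddOrderEmb r)) =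
      qminor q (Fin.natAddOrderEmb r) (Fin.natAddOrderEmb r) ⊗ₜ 1 := by
  rw [qminor, map_qdet, ← qdet_tailBlock]
  refine Eq.trans ?_ (qdet_sum_tmul_flip QSU.q_ne_zero _ isQMatrix_tail)
  congr 1
  funext a b
  simp [flipCoaction_u, sigmaMap_u, Fin.sum_univ_add]

/-- Only column weights enter, and those of R add up to 1 for every choice of rows. -/
lemma circle_qminor_head (I : Fin r ↪o Fin (r + m)) :
    circleCoaction q hr hm (qminor q I (Fin.castAddOrderEmb m)) =
      qminor q I (Fin.castAddOrderEmb m) ⊗ₜ LaurentPolynomial.T 1 := by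
  have h := qdet_scale (q := (q : ℂ)) (fun a b => QSU.u q (I a) (Fin.castAdd m b)) 0 (headWeight r)
  rw [sum_headWeight hr] at h
  rw [qminor, map_qdet]
  simpa [circleCoaction_u] using h

lemma circle_qminor_tail (J : Fin m ↪o Fin (r + m)) :
    circleCoaction q hr hm (qminor q J (Fin.natAddOrderEmb r)) =
      qminor q J (Fin.natAddOrderEmb r) ⊗ₜ LaurentPolynomial.T (-1) := by
  have h := qdet_scale (q := (q : ℂ)) (fun a b => QSU.u q (J a) (Fin.natAdd r b)) 0 (tailWeight m)
  rw [sum_tailWeight hm] at h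
  rw [qminor, map_qdet]
  simpa [circleCoaction_u] using h

lemma flip_torus_qminor_head :
    flipCoaction (torus q (circleWeight r m) (sum_circleWeight hr hm))
        (qminor q (Fin.castAddOrderEmb m) (Fin.castAddOrderEmb m)) =
      qminor q (Fin.castAddOrderEmb m) (Fin.castAddOrderEmb m) ⊗ₜ LaurentPolynomial.T 1 := by
  have h := qdet_scale (q := (q : ℂ))
    (fun a b => QSU.u q (Fin.castAdd m a) (Fin.castAdd m b)) (headWeight r) 0
  rw [sum_headWeight hr] at h
  rw [qminor, map_qdet]
  simpa [flipCoaction_torus_u] using h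

lemma flip_torus_qminor_tail :
    flipCoaction (torus q (circleWeight r m) (sum_circleWeight hr hm))
        (qminor q (Fin.natAddOrderEmb r) (Fin.natAddOrderEmb r)) =
      qminor q (Fin.natAddOrderEmb r) (Fin.natAddOrderEmb r) ⊗ₜ LaurentPolynomial.T (-1) := by
  have h := qdet_scale (q := (q : ℂ))
    (fun a b => QSU.u q (Fin.natAdd r a) (Fin.natAdd r b)) (tailWeight m) 0
  rw [sum_tailWeight hm] at h
  rw [qminor, map_qdet]
  simpa [flipCoaction_torus_u] using h

lemma counit_qminor {n k : ℕ} (I : Fin k ↪o Fin n) :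
    Coalgebra.counit (R := ℂ) (qminor q I I) = 1 := by
  change Bialgebra.counitAlgHom ℂ (QSU q n) _ = 1
  rw [qminor, map_qdet]
  have : (fun a b => Bialgebra.counitAlgHom ℂ (QSU q n) (QSU.u q (I a) (I b))) =
      fun a b => if a = b then (1 : ℂ) else 0 := by
    funext a b
    simp [QSU.counit_u]
  rw [this, qdet_diag (fun _ => (1 : ℂ))]
  simp

/-- The element `z^k` for `k ≥ 0`, and `z̄^{-k}` for `k < 0`. -/
noncomputable def sectionElt (q : ℝ) (r m : ℕ) (k : ℤ) : QSU q (r + m) :=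
  if 0 ≤ k then qminor q (Fin.castAddOrderEmb m) (Fin.castAddOrderEmb m) ^ k.toNat
  else qminor q (Fin.natAddOrderEmb r) (Fin.natAddOrderEmb r) ^ (-k).toNat

omit hq in
lemma sectionElt_natCast (k : ℕ) : sectionElt q r m k =
    qminor q (Fin.castAddOrderEmb m) (Fin.castAddOrderEmb m) ^ k := by
  rw [sectionElt, if_pos (Int.natCast_nonneg k), Int.toNat_natCast]

omit hq in
lemma sectionElt_neg_natCast (k : ℕ) : sectionElt q r m (-(k : ℤ)) =
    qminor q (Fin.natAddOrderEmb r) (Fin.natAddOrderEmb r) ^ k := by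
  rcases k with - | k
  -- At k = 0 the definition uses z^0, which agrees with z̄^0 = 1.
  · simp [sectionElt]
  · rw [sectionElt, if_neg (by omega), neg_neg, Int.toNat_natCast]

omit hq in
lemma sectionElt_induction {motive : ℤ → QSU q (r + m) → Prop}
    (head : ∀ k : ℕ, motive k (qminor q (Fin.castAddOrderEmb m) (Fin.castAddOrderEmb m) ^ k))
    (tail : ∀ k : ℕ, motive (-k) (qminor q (Fin.natAddOrderEmb r) (Fin.natAddOrderEmb r) ^ k))
    (k : ℤ) : motive k (sectionElt q r m k) := by
  obtain ⟨k, rfl | rfl⟩ := k.eq_nat_or_neg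
  · rw [sectionElt_natCast]; exact head k
  · rw [sectionElt_neg_natCast]; exact tail k

lemma sigma_sectionElt (k : ℤ) : inducedCoaction (sigmaMap q r m) (sectionElt q r m k) =
    sectionElt q r m k ⊗ₜ 1 :=
  sectionElt_induction
    (motive := fun _ x => inducedCoaction (sigmaMap q r m) x = x ⊗ₜ 1)
    (fun k => by rw [map_pow, sigma_qminor_head, Algebra.TensorProduct.tmul_pow, one_pow])
    (fun k => by rw [map_pow, sigma_qminor_tail, Algebra.TensorProduct.tmul_pow, one_pow]) k

lemma flip_sigma_sectionElt (k : ℤ) : flipCoaction (sigmaMap q r m) (sectionElt q r m k) =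
    sectionElt q r m k ⊗ₜ 1 :=
  sectionElt_induction
    (motive := fun _ x => flipCoaction (sigmaMap q r m) x = x ⊗ₜ 1)
    (fun k => by rw [map_pow, flip_sigma_qminor_head, Algebra.TensorProduct.tmul_pow, one_pow])
    (fun k => by rw [map_pow, flip_sigma_qminor_tail, Algebra.TensorProduct.tmul_pow, one_pow]) k

lemma circle_sectionElt (k : ℤ) : circleCoaction q hr hm (sectionElt q r m k) =
    sectionElt q r m k ⊗ₜ LaurentPolynomial.T k :=
  sectionElt_induction
    (motive := fun k x => circleCoaction q hr hm x = x ⊗ₜ LaurentPolynomial.T k)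
    (fun k => by rw [map_pow, circle_qminor_head, Algebra.TensorProduct.tmul_pow,
      LaurentPolynomial.T_pow, mul_one])
    (fun k => by rw [map_pow, circle_qminor_tail, Algebra.TensorProduct.tmul_pow,
      LaurentPolynomial.T_pow, mul_neg_one]) k

lemma flip_torus_sectionElt (k : ℤ) :
    flipCoaction (torus q (circleWeight r m) (sum_circleWeight hr hm)) (sectionElt q r m k) =
      sectionElt q r m k ⊗ₜ LaurentPolynomial.T k :=
  sectionElt_induction
    (motive := fun k x => flipCoaction (torus q (circleWeight r m) (sum_circleWeight hr hm)) x =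
      x ⊗ₜ LaurentPolynomial.T k)
    (fun k => by rw [map_pow, flip_torus_qminor_head hr hm, Algebra.TensorProduct.tmul_pow,
      LaurentPolynomial.T_pow, mul_one])
    (fun k => by rw [map_pow, flip_torus_qminor_tail hr hm, Algebra.TensorProduct.tmul_pow,
      LaurentPolynomial.T_pow, mul_neg_one]) k

lemma counit_sectionElt (k : ℤ) : Coalgebra.counit (R := ℂ) (sectionElt q r m k) = 1 :=
  sectionElt_induction (q := q) (r := r) (m := m)
    (motive := fun _ x => Coalgebra.counit (R := ℂ) x = 1)
    (fun k => by rw [Bialgebra.counit_pow, counit_qminor, one_pow])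
    (fun k => by rw [Bialgebra.counit_pow, counit_qminor, one_pow]) k

lemma qminor_head_mem (I : Fin r ↪o Fin (r + m)) :
    qminor q I (Fin.castAddOrderEmb m) ∈ quantumSphere q r m := sigma_qminor_head I

lemma qminor_tail_mem (J : Fin m ↪o Fin (r + m)) :
    qminor q J (Fin.natAddOrderEmb r) ∈ quantumSphere q r m := sigma_qminor_tail J

/-- The element `S(x_(1)) ⊗ x_(2)` for `x = z^k` or `x = z̄^{-k}`. -/
noncomputable def ellElt (q : ℝ) [Fact (0 < q)] (r m : ℕ) (k : ℤ) :
    QSU q (r + m) ⊗[ℂ] QSU q (r + m) :=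
  (HopfAlgebra.antipode ℂ).rTensor (QSU q (r + m)) (Coalgebra.comul (sectionElt q r m k))

/-- Left σ-coinvariance of z^k or z̄^{-k} controls the left leg and right σ-coinvariance the right
leg; an element killed by the defect in both legs lies in P ⊗ P. -/
lemma exists_ellElt (k : ℤ) : ∃ y : quantumSphere q r m ⊗[ℂ] quantumSphere q r m,
    TensorProduct.map (quantumSphere q r m).val.toLinearMap
      (quantumSphere q r m).val.toLinearMap y = ellElt q r m k := by
  refine exists_map_eq_of_exact Subtype.val_injective (exact_sphereDefect q) ?_ ?_
  · have h := inducedCoaction_antipode QSU.antipodeComul (sigmaMap q r m) (g := 1)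
      (flip_sigma_sectionElt (q := q) (r := r) (m := m) k)
    rw [inv_one] at h
    rw [sphereDefect, LinearMap.rTensor_sub]
    exact sub_eq_zero.2 h
  · have h := inducedCoaction_right_leg (sigmaMap q r m)
      (sigma_sectionElt (q := q) (r := r) (m := m) k)
    rw [sphereDefect, LinearMap.lTensor_sub]
    exact sub_eq_zero.2 h

/-- The `ℓ`-map of the circle bundle. -/
noncomputable def sphereEll (q : ℝ) [Fact (0 < q)] (r m : ℕ) :
    ℂ[T;T⁻¹] →ₗ[ℂ] quantumSphere q r m ⊗[ℂ] quantumSphere q r m :=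
  laurentConstr fun k => (exists_ellElt (q := q) (r := r) (m := m) k).choose

/-- This determines the chosen preimage, since the tensor square of the inclusion of P is injective.
-/
lemma map_sphereEll (k : ℤ) : TensorProduct.map (quantumSphere q r m).val.toLinearMap
    (quantumSphere q r m).val.toLinearMap (sphereEll q r m (LaurentPolynomial.T k)) =
      ellElt q r m k := by
  rw [sphereEll, laurentConstr_T]
  exact (exists_ellElt k).choose_spec

/-- All axioms are checked in G ⊗ G: the product of the legs is the counit, equal to 1 on
`sectionElt`, and the degrees k and -k come from its right and left circle weights, the latter
inverted by the antipode. -/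
lemma isPrincipalEllMap_sphereEll :
    IsPrincipalEllMap laurent_antipode_bijective (sphereCoaction q hr hm) (sphereEll q r m) := by
  refine isPrincipalEllMap_of_injective (δ := circleCoaction q hr hm) (quantumSphere q r m).val
    Subtype.val_injective (val_sphereCoaction q hr hm) map_sphereEll ?_ ?_ ?_ ?_
  · have h : sectionElt q r m 0 = 1 := by simpa using sectionElt_natCast (q := q) (r := r) (m := m) 0
    rw [ellElt, h, Bialgebra.comul_one, Algebra.TensorProduct.one_def, LinearMap.rTensor_tmul,
      HopfAlgebra.antipode_one]
  · intro k
    rw [ellElt, HopfAlgebra.mul_antipode_rTensor_comul_apply, counit_sectionElt, map_one]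
  · intro k
    exact inducedCoaction_right_leg _ (circle_sectionElt hr hm k)
  · intro k
    -- The left weight must be supplied as a unit: its inverse t^{-k} is the degree of the left leg.
    let t : ℂ[T;T⁻¹]ˣ := ⟨LaurentPolynomial.T k, LaurentPolynomial.T (-k),
      by rw [← LaurentPolynomial.T_add, add_neg_cancel, LaurentPolynomial.T_zero],
      by rw [← LaurentPolynomial.T_add, neg_add_cancel, LaurentPolynomial.T_zero]⟩
    exact inducedCoaction_antipode QSU.antipodeComul _ (g := t)
      (flip_torus_sectionElt hr hm k)

end minors

end QGr

theorem mainTheorem5 (q : ℝ) [Fact (0 < q)] (r m : ℕ) (hr : 0 < r) (hm : 0 < m) :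
    ∃ δ : quantumSphere q r m →ₐ[ℂ] quantumSphere q r m ⊗[ℂ] ℂ[T;T⁻¹],
      ((∀ (k : ℤ) (x : quantumSphere q r m), (x : QSU q (r + m)) ∈ lineBundle q r m hm k →
          δ x = x ⊗ₜ LaurentPolynomial.T k) ∧
        ∀ δ' : quantumSphere q r m →ₐ[ℂ] quantumSphere q r m ⊗[ℂ] ℂ[T;T⁻¹],
          (∀ (k : ℤ) (x : quantumSphere q r m), (x : QSU q (r + m)) ∈ lineBundle q r m hm k →
            δ' x = x ⊗ₜ LaurentPolynomial.T k) → δ' = δ) ∧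
      (∀ I : Fin r ↪o Fin (r + m), ∃ h : qminor q I (Fin.castAddOrderEmb m) ∈ quantumSphere q r m,
        δ ⟨_, h⟩ = ⟨_, h⟩ ⊗ₜ LaurentPolynomial.T 1) ∧
      (∀ J : Fin m ↪o Fin (r + m), ∃ h : qminor q J (Fin.natAddOrderEmb r) ∈ quantumSphere q r m,
        δ ⟨_, h⟩ = ⟨_, h⟩ ⊗ₜ LaurentPolynomial.T (-1)) ∧
      (coinvariants δ).map (quantumSphere q r m).val = quantumGrassmannian q r m hm ∧
      (∃ ℓ : ℂ[T;T⁻¹] →ₗ[ℂ] quantumSphere q r m ⊗[ℂ] quantumSphere q r m,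
        (∀ k : ℕ, TensorProduct.map (quantumSphere q r m).val.toLinearMap
            (quantumSphere q r m).val.toLinearMap (ℓ (LaurentPolynomial.T (k : ℤ))) =
          (HopfAlgebra.antipode ℂ).rTensor (QSU q (r + m)) (Coalgebra.comul
            (qminor q (Fin.castAddOrderEmb m) (Fin.castAddOrderEmb m) ^ k : QSU q (r + m)))) ∧
        (∀ k : ℕ, TensorProduct.map (quantumSphere q r m).val.toLinearMap
            (quantumSphere q r m).val.toLinearMap (ℓ (LaurentPolynomial.T (-(k : ℤ)))) =
          (HopfAlgebra.antipode ℂ).rTensor (QSU q (r + m)) (Coalgebra.comul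
            (qminor q (Fin.natAddOrderEmb r) (Fin.natAddOrderEmb r) ^ k : QSU q (r + m)))) ∧
        IsPrincipalEllMap laurent_antipode_bijective δ ℓ) ∧
      IsPrincipal δ := by
  have hℓ := isPrincipalEllMap_sphereEll (q := q) hr hm
  refine ⟨sphereCoaction q hr hm,
    ⟨fun k x hx => (sphereCoaction_eq_iff_mem_lineBundle q hr hm x k).2 hx,
      sphereCoaction_unique q hr hm⟩,
    fun I => ⟨qminor_head_mem I, (sphereCoaction_eq_iff q hr hm _ 1).2
      (circle_qminor_head hr hm I)⟩,
    fun J => ⟨qminor_tail_mem J, (sphereCoaction_eq_iff q hr hm _ (-1)).2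
      (circle_qminor_tail hr hm J)⟩,
    map_coinvariants_sphereCoaction q hr hm,
    ⟨sphereEll q r m, fun k => ?_, fun k => ?_, hℓ⟩,
    hℓ.isPrincipal (isComoduleAlgebra_sphereCoaction q hr hm)⟩
  · rw [map_sphereEll, ellElt, sectionElt_natCast]
  · rw [map_sphereEll, ellElt, sectionElt_neg_natCast]
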